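/- Let $\mathbb D=\{z\in\mathbb C:|z|<1\}$ and let $\mathcal C$ be the class of close-to-convex functions, that is, of holomorphic functions $f$ on $\mathbb D$ with $f(0)=0$, $f'(0)=1$ for which there is a univalent holomorphic function $g$ on $\mathbb D$ with convex image $g(\mathbb D)$ such that $\operatorname{Re}\big(f'(z)/g'(z)\big)>0$ for all $z\in\mathbb D$. Then for every $f\in\mathcal C$ there is a holomorphic branch on $\mathbb D$ of $\log\frac{f(z)}z=\log\left|\frac{f(z)}z\right|+i\arg\frac{f(z)}z$ with value $0$ at $z=0$; in the following this branch is used. For real $b$ put $$\Phi^+(b)=\sup_{z\in\mathbb D}\,\sup_{f\in\mathcal C}\left\{\log\left|\frac{f(z)}z\right|+b\arg\frac{f(z)}z\right\},\qquad \Phi^-(b)=\inf_{z\in\mathbb D}\,\inf_{f\in\mathcal C}\left\{\log\left|\frac{f(z)}z\right|+b\arg\frac{f(z)}z\right\}.$$ Then $\Phi^+(b)=+\infty$ for every $b\in\mathbb R$. The equation $$2b\left(\arctan b-\arctan\frac{3b}{\sqrt{1-8b^2}}+\pi\right)=\log\left(5-4b^2+3\sqrt{1-8b^2}\right)-\log 2$$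 has exactly one solution $b_0$ in the interval $0<b<\frac1{2\sqrt2}$; it satisfies $0.24001\le b_0<0.24002$, and for every $b\in\mathbb R$ $$\Phi^-(b)=\begin{cases}-\dfrac12\log\dfrac{2\left(5-4b^2+3\sqrt{1-8b^2}\right)}{1+b^2}-b\arctan\dfrac{3b}{\sqrt{1-8b^2}}&\text{if }|b|\le b_0,\\[2ex]\dfrac12\log(1+b^2)-\log2-|b|\left(\arctan|b|+\pi\right)&\text{if }|b|\ge b_0.\end{cases}$$ -/

import Mathlib

open Complex Set Metric

/-- The class `𝒜` of holomorphic functions on the unit disk with `f(0) = 0`, `f'(0) = 1`. -/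
def NormalizedAnalytic (f : ℂ → ℂ) : Prop :=
  DifferentiableOn ℂ f (ball 0 1) ∧ f 0 = 0 ∧ deriv f 0 = 1

/-- `g` maps the unit disk conformally onto a convex domain (no normalization). -/
def IsConvexUnivalent (g : ℂ → ℂ) : Prop :=
  DifferentiableOn ℂ g (ball 0 1) ∧ InjOn g (ball 0 1) ∧ Convex ℝ (g '' ball 0 1)

/-- The class of close-to-convex functions (in the sense of Kaplan): normalized holomorphic
functions `f` on the unit disk with `Re (f' / g') > 0` for some convex univalent function `g`.
Here `g'` has no zeros on the disk, since `g` is univalent. -/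
def CloseToConvex : Set (ℂ → ℂ) :=
  {f | NormalizedAnalytic f ∧ ∃ g : ℂ → ℂ, IsConvexUnivalent g ∧
    ∀ z ∈ ball (0 : ℂ) 1, 0 < (deriv f z / deriv g z).re}

/-- `L` is the holomorphic branch on the unit disk of `log (f(z)/z)` with `L(0) = 0`. -/
def IsLogRatio (f L : ℂ → ℂ) : Prop :=
  DifferentiableOn ℂ L (ball 0 1) ∧ L 0 = 0 ∧
    ∀ z ∈ ball (0 : ℂ) 1, z ≠ 0 → exp (L z) = f z / z

open Classical in
/-- The holomorphic branch of `log (f(z)/z) = log |f(z)/z| + i arg (f(z)/z)` vanishing at `0`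
(a branch is determined on the disk by `IsLogRatio`; the value is `0` if there is none). -/
noncomputable def logRatio (f : ℂ → ℂ) : ℂ → ℂ :=
  if h : ∃ L, IsLogRatio f L then h.choose else 0

/-- The functional `log |f(z)/z| + b arg (f(z)/z)`. -/
noncomputable def logArgFunctional (b : ℝ) (f : ℂ → ℂ) (z : ℂ) : ℝ :=
  (logRatio f z).re + b * (logRatio f z).im

/-- `Φ_z⁺(b, F)`. -/
noncomputable def PhiPlusAt (b : ℝ) (F : Set (ℂ → ℂ)) (z : ℂ) : EReal :=
  ⨆ f ∈ F, (logArgFunctional b f z : EReal)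

/-- `Φ_z⁻(b, F)`. -/
noncomputable def PhiMinusAt (b : ℝ) (F : Set (ℂ → ℂ)) (z : ℂ) : EReal :=
  ⨅ f ∈ F, (logArgFunctional b f z : EReal)

/-- `Φ⁺(b, F)`, the supremum over the disk and the class. -/
noncomputable def PhiPlus (b : ℝ) (F : Set (ℂ → ℂ)) : EReal :=
  ⨆ z ∈ ball (0 : ℂ) 1, PhiPlusAt b F z

/-- `Φ⁻(b, F)`, the infimum over the disk and the class. -/
noncomputable def PhiMinus (b : ℝ) (F : Set (ℂ → ℂ)) : EReal :=
  ⨅ z ∈ ball (0 : ℂ) 1, PhiMinusAt b F z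

/-- The transcendental equation that determines the threshold `b₀`. -/
def ThresholdEq (b : ℝ) : Prop :=
  2 * b * (Real.arctan b - Real.arctan (3 * b / √(1 - 8 * b ^ 2)) + Real.pi) =
    Real.log (5 - 4 * b ^ 2 + 3 * √(1 - 8 * b ^ 2)) - Real.log 2

/-!
Throughout, `L` is the branch of `log (f z / z)`, and the functional `Re L + b Im L` is the real
part of `c L` with `c = 1 - ib`.

*Reduction to a two-parameter family.* A close-to-convex function has derivative
`f' = (X + (1 - X) P) e^Γ`, where `|X| = 1`, `e^Γ` is the derivative of a normalized convex function
and `P` has values in `Re > 1/2` (`exists_deriv_eq_of_mem_closeToConvex`). On the radius to `z` the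
branch `L z` is a sum of principal logarithms of averages of `f'` and `e^Γ` (`logValue`,
`isLogRatio_logValue`), which exists because averaging along radii preserves half-planes
(`re_average_pos`). By the Herglotz representation, `Γ` and `P` are limits of finite sums
`-2 ∑ μₖ log (1 - yₖ t)` and `∑ νⱼ / (1 - ζⱼ t)` (`exists_logProd_approx`,
`exists_halfPlaneSum_approx`), so it suffices to minimize over `X` in the unit circle and points
`yₖ`, `ζⱼ` of modulus `|z|`, a compact torus. At a minimum the derivative of `c L` in each of the
variables, multiplied by the variable, is real and nonpositive. The transform
`h(η) = ∫ e^Γ / (1 - ηt) dt` separates points like a convex function (`re_separation_pos`), and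
these two facts together force all active points to coincide (`IsTorusMin.pole_eq`,
`IsTorusMin.exponent_eq`). Hence the infimum over the class is the infimum over the functions with
`f' = (1 - xz) / (1 - yz)³`, for which `L = log ((u + v) / 2) - 2 log v` with `u = 1 - xz` and
`v = 1 - yz` (`extremalLog`, `isLogRatio_and_le_of_extremal`).

*The range of the extremal functions.* For these, `w = exp L = (u + v) / (2 v²)` satisfies
`|1 / w - 1| ≤ 3` (`norm_two_mul_sq_sub_le`), while `|Im L| < 3π/2`, and `Re w ≤ -1/2` as soon as
`|Im L| > π` (`re_exp_extremalLog_le`). Each of the two restrictions bounds `Re L` below by a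
function of `t = |Im L|`. Minimizing over `0 ≤ t ≤ π` gives `interiorMin b` or the value at `t = π`;
minimizing over `π ≤ t < 3π/2` gives `boundaryMin b` (`interiorMin_le`, `boundaryMin_le`). Both
minima are approached on the boundary of the disk (`le_interiorMin`, `le_boundaryMin`), so the
infimum is the smaller of the two. Their difference `thresholdGap` is strictly increasing in `b ≥ 0`
and vanishes exactly at `b₀`.

The supremum is infinite because of the values of `z / (1 - z)` on the positive radius.
-/

/-! ### Boundary minima and radial averages -/

open Filter Topology MeasureTheory in
/-- Differentiation under the integral sign over `[0, 1]`, for a kernel that is jointly continuous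
together with its complex derivative. -/
theorem hasDerivAt_integral_unit {U : Set ℂ} (hU : IsOpen U) {f f' : ℂ → ℝ → ℂ}
    (hf : ContinuousOn (Function.uncurry f) (U ×ˢ Icc 0 1))
    (hf' : ContinuousOn (Function.uncurry f') (U ×ˢ Icc 0 1))
    (hd : ∀ z ∈ U, ∀ t ∈ Icc (0 : ℝ) 1, HasDerivAt (fun w => f w t) (f' z t) z)
    {z₀ : ℂ} (hz₀ : z₀ ∈ U) :
    HasDerivAt (fun z => ∫ t in (0 : ℝ)..1, f z t) (∫ t in (0 : ℝ)..1, f' z₀ t) z₀ := by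
  obtain ⟨ε, hε, hball⟩ := nhds_basis_closedBall.mem_iff.1 (hU.mem_nhds hz₀)
  have hcomp : IsCompact (closedBall z₀ ε ×ˢ Icc (0 : ℝ) 1) :=
    (isCompact_closedBall z₀ ε).prod isCompact_Icc
  obtain ⟨M, hM⟩ := hcomp.exists_bound_of_continuousOn
    (hf'.mono (prod_mono hball Subset.rfl))
  have hI : uIoc (0 : ℝ) 1 ⊆ Icc 0 1 := by
    rw [uIoc_of_le zero_le_one]; exact Ioc_subset_Icc_self
  have hcont : ∀ {φ : ℂ → ℝ → ℂ}, ContinuousOn (Function.uncurry φ) (U ×ˢ Icc 0 1) →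
      ∀ z ∈ U, ContinuousOn (φ z) (Icc 0 1) := by
    intro φ hφ z hz
    exact hφ.comp (f := fun t : ℝ => (z, t)) (by fun_prop) (fun t ht => ⟨hz, ht⟩)
  refine (intervalIntegral.hasDerivAt_integral_of_dominated_loc_of_deriv_le (bound := fun _ => M)
    (closedBall_mem_nhds z₀ hε) ?_ ?_ ?_ ?_ ?_ ?_).2
  · filter_upwards [hU.mem_nhds hz₀] with z hz
    exact ((hcont hf z hz).mono hI).aestronglyMeasurable measurableSet_uIoc
  · refine (hcont hf z₀ hz₀).intervalIntegrable_of_Icc zero_le_one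
  · exact ((hcont hf' z₀ hz₀).mono hI).aestronglyMeasurable measurableSet_uIoc
  · exact Eventually.of_forall fun t ht z hz => hM (z, t) ⟨hz, hI ht⟩
  · exact intervalIntegrable_const
  · exact Eventually.of_forall fun t ht z hz => hd z (hball hz) t (hI ht)

open Filter Topology in
/-- At a boundary point of the disk where the real part of a holomorphic function is minimal,
`z F'(z)` is real and nonpositive: the tangential derivative vanishes there, and by the minimum
principle the radial one points downwards. -/
theorem exists_mul_deriv_eq_neg_of_re_min {F : ℂ → ℂ} {F' η : ℂ} {r : ℝ} (hr : 0 < r)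
    (hd : DiffContOnCl ℂ F (ball 0 r)) (hη : ‖η‖ = r) (hF : HasDerivAt F F' η)
    (hmin : ∀ z, ‖z‖ = r → (F η).re ≤ (F z).re) : ∃ k : ℝ, 0 ≤ k ∧ η * F' = -(k : ℂ) := by
  have hin : ∀ z, ‖z‖ ≤ r → (F η).re ≤ (F z).re := by
    intro z hz
    have h1 : DiffContOnCl ℂ (fun z => exp (-F z)) (ball 0 r) :=
      ⟨(hd.differentiableOn.neg).cexp, hd.continuousOn.neg.cexp⟩
    have h2 := Complex.norm_le_of_forall_mem_frontier_norm_le isBounded_ball h1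
      (C := Real.exp (-(F η).re)) (by
        intro w hw
        rw [frontier_ball _ hr.ne', mem_sphere_zero_iff_norm] at hw
        rw [norm_exp]
        simpa using hmin w hw) (z := z) (by rw [closure_ball _ hr.ne']; simpa using hz)
    rw [norm_exp] at h2
    simpa using h2
  have him : (η * F').im = 0 := by
    have h1 : HasDerivAt (fun t : ℝ => F (η * exp (t * I))) (F' * (η * I)) 0 := by
      have h2 : HasDerivAt (fun t : ℝ => η * exp (t * I)) (η * I) 0 := by
        have h3 : HasDerivAt (fun t : ℂ => η * exp (t * I)) (η * I) ((0 : ℝ) : ℂ) := by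
          simpa using (((hasDerivAt_id (0 : ℂ)).mul_const I).cexp).const_mul η
        exact h3.comp_ofReal
      have h4 : HasDerivAt F F' (η * exp ((0 : ℝ) * I)) := by simpa using hF
      exact h4.comp (0 : ℝ) h2
    have h5 : HasDerivAt (fun t : ℝ => (F (η * exp (t * I))).re) (F' * (η * I)).re 0 :=
      (Complex.reCLM.hasFDerivAt.comp_hasDerivAt (0 : ℝ) h1)
    have h6 : IsLocalMin (fun t : ℝ => (F (η * exp (t * I))).re) 0 := by
      refine Eventually.of_forall fun t => ?_
      simpa using hmin (η * exp (t * I)) (by simp [norm_exp_ofReal_mul_I, hη])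
    have h7 := h6.hasDerivAt_eq_zero h5
    have : (F' * (η * I)).re = -(η * F').im := by simp; ring
    linarith
  have hre : (η * F').re ≤ 0 := by
    have h1 : HasDerivAt (fun t : ℝ => (F (t * η)).re) (F' * η).re 1 := by
      have h2 : HasDerivAt (fun t : ℝ => (t : ℂ) * η) η 1 := by
        simpa using (Complex.ofRealCLM.hasDerivAt (x := (1 : ℝ))).mul_const η
      have h4 : HasDerivAt F F' (((1 : ℝ) : ℂ) * η) := by simpa using hF
      exact (Complex.reCLM.hasFDerivAt.comp_hasDerivAt (1 : ℝ) (h4.comp (1 : ℝ) h2))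
    have h3 := (hasDerivAt_iff_tendsto_slope.1 h1).mono_left
      (nhdsWithin_mono (1 : ℝ) (s := Iio 1) (by intro x hx; exact ne_of_lt hx))
    rw [mul_comm]
    refine le_of_tendsto h3 ?_
    filter_upwards [Ioo_mem_nhdsLT (zero_lt_one' ℝ)] with t ht
    rw [slope_def_field]
    refine div_nonpos_of_nonneg_of_nonpos ?_ (by linarith [ht.2])
    have := hin (t * η) (by
      rw [norm_mul, hη, Complex.norm_real, Real.norm_of_nonneg ht.1.le]
      nlinarith [ht.2])
    simpa using this
  refine ⟨-(η * F').re, by linarith, ?_⟩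
  apply Complex.ext <;> simp
  · simpa using him

/-- The average `α(z) = ∫₀¹ tᵐ h(tz) dt` is holomorphic and solves `z α' + (m + 1) α = h`. -/
theorem hasDerivAt_average {R : ℝ} (m : ℕ) {h : ℂ → ℂ} (hh : DifferentiableOn ℂ h (ball 0 R)) :
    ∃ α' : ℂ → ℂ, ∀ z ∈ ball (0 : ℂ) R,
      HasDerivAt (fun z => ∫ t in (0 : ℝ)..1, (t : ℂ) ^ m * h (t * z)) (α' z) z ∧
      z * α' z + (m + 1) * (∫ t in (0 : ℝ)..1, (t : ℂ) ^ m * h (t * z)) = h z := by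
  have hmem : ∀ z ∈ ball (0 : ℂ) R, ∀ t ∈ Icc (0 : ℝ) 1, (t : ℂ) * z ∈ ball (0 : ℂ) R := by
    intro z hz t ht
    rw [mem_ball_zero_iff] at hz ⊢
    rw [norm_mul, Complex.norm_real, Real.norm_of_nonneg ht.1]
    nlinarith [ht.2, norm_nonneg z]
  have hh' : DifferentiableOn ℂ (deriv h) (ball 0 R) := hh.deriv isOpen_ball
  have hmaps : MapsTo (fun p : ℂ × ℝ => (p.2 : ℂ) * p.1) (ball (0 : ℂ) R ×ˢ Icc 0 1)
      (ball 0 R) := fun p hp => hmem p.1 hp.1 p.2 hp.2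
  have hc : ContinuousOn (fun p : ℂ × ℝ => (p.2 : ℂ) ^ m * h (p.2 * p.1))
      (ball (0 : ℂ) R ×ˢ Icc 0 1) :=
    ContinuousOn.mul (by fun_prop) (hh.continuousOn.comp (by fun_prop) hmaps)
  have hc' : ContinuousOn (fun p : ℂ × ℝ => (p.2 : ℂ) ^ m * (deriv h (p.2 * p.1) * p.2))
      (ball (0 : ℂ) R ×ˢ Icc 0 1) :=
    ContinuousOn.mul (by fun_prop)
      (ContinuousOn.mul (hh'.continuousOn.comp (by fun_prop) hmaps) (by fun_prop))
  have hder : ∀ z ∈ ball (0 : ℂ) R, HasDerivAt h (deriv h z) z := fun z hz =>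
    (hh.differentiableAt (isOpen_ball.mem_nhds hz)).hasDerivAt
  refine ⟨fun z => ∫ t in (0 : ℝ)..1, (t : ℂ) ^ m * (deriv h (t * z) * t), fun z hz => ⟨?_, ?_⟩⟩
  · refine hasDerivAt_integral_unit isOpen_ball (f := fun z t => (t : ℂ) ^ m * h (t * z))
      (f' := fun z t => (t : ℂ) ^ m * (deriv h (t * z) * t)) hc hc' ?_ hz
    intro w hw t ht
    have h1 : HasDerivAt (fun w : ℂ => (t : ℂ) * w) t w := by
      simpa using (hasDerivAt_id w).const_mul (t : ℂ)
    exact ((hder _ (hmem w hw t ht)).comp w h1).const_mul _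
  · have hi : ∀ {φ : ℂ × ℝ → ℂ}, ContinuousOn φ (ball (0 : ℂ) R ×ˢ Icc 0 1) →
        IntervalIntegrable (fun t => φ (z, t)) MeasureTheory.volume 0 1 := fun hφ =>
      (hφ.comp (f := fun t : ℝ => (z, t)) (by fun_prop)
        (fun t ht => ⟨hz, ht⟩)).intervalIntegrable_of_Icc zero_le_one
    have h1 : ∀ t ∈ uIcc (0 : ℝ) 1, HasDerivAt (fun t : ℝ => (t : ℂ) ^ (m + 1) * h (t * z))
        (z * ((t : ℂ) ^ m * (deriv h (t * z) * t)) + (m + 1) * ((t : ℂ) ^ m * h (t * z))) t := by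
      intro t ht
      rw [uIcc_of_le zero_le_one] at ht
      have e1 : HasDerivAt (fun t : ℂ => t * z) z (t : ℂ) := by
        simpa using (hasDerivAt_id (t : ℂ)).mul_const z
      have e2 : HasDerivAt (fun t : ℂ => t ^ (m + 1) * h (t * z))
          (((m + 1 : ℕ) * (t : ℂ) ^ m) * h (t * z) + (t : ℂ) ^ (m + 1) * (deriv h (t * z) * z))
          (t : ℂ) :=
        (hasDerivAt_pow (m + 1) (t : ℂ)).mul ((hder _ (hmem z hz t ht)).comp (t : ℂ) e1)
      convert e2.comp_ofReal using 1
      push_cast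
      ring
    have h2 := intervalIntegral.integral_eq_sub_of_hasDerivAt h1
      (((hi hc').const_mul z).add ((hi hc).const_mul _))
    rw [intervalIntegral.integral_add ((hi hc').const_mul z) ((hi hc).const_mul _),
      intervalIntegral.integral_const_mul, intervalIntegral.integral_const_mul] at h2
    simpa using h2

/-- Averages along radii keep the real part positive. With the measure `dA = tᵐ k(t) dt`, the
hypothesis on `k` says that the primitive `A` is an `(m + 1)`-valent convex function. The first
conclusion is that `A` is starlike, the second that the `dA`-average of a function with positive
real part has positive real part. Both follow by looking at a boundary point where the real part is
minimal. -/
theorem re_average_pos {R : ℝ} (hR : 1 < R) (m : ℕ) {k F : ℂ → ℂ}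
    (hk : DifferentiableOn ℂ k (ball 0 R)) (hk0 : ∀ z ∈ ball (0 : ℂ) R, k z ≠ 0)
    (hC : ∀ z, ‖z‖ ≤ 1 → 0 < ((m : ℂ) + 1 + z * deriv k z / k z).re)
    (hF : DifferentiableOn ℂ F (ball 0 R)) (hFp : ∀ z, ‖z‖ ≤ 1 → 0 < (F z).re) :
    0 < ((∫ t in (0 : ℝ)..1, (t : ℂ) ^ m * k t) / k 1).re ∧
    0 < ((∫ t in (0 : ℝ)..1, (t : ℂ) ^ m * (F t * k t)) /
      ∫ t in (0 : ℝ)..1, (t : ℂ) ^ m * k t).re := by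
  obtain ⟨α', hα⟩ := hasDerivAt_average m hk
  obtain ⟨β', hβ⟩ := hasDerivAt_average m (hF.mul hk)
  set α : ℂ → ℂ := fun z => ∫ t in (0 : ℝ)..1, (t : ℂ) ^ m * k (t * z) with hαdef
  set β : ℂ → ℂ := fun z => ∫ t in (0 : ℝ)..1, (t : ℂ) ^ m * (F (t * z) * k (t * z)) with hβdef
  have hin : ∀ z : ℂ, ‖z‖ ≤ 1 → z ∈ ball (0 : ℂ) R := fun z hz => by
    rw [mem_ball_zero_iff]; linarith
  have hkd : ∀ z : ℂ, z ∈ ball (0 : ℂ) R → HasDerivAt k (deriv k z) z := fun z hz =>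
    (hk.differentiableAt (isOpen_ball.mem_nhds hz)).hasDerivAt
  -- A function whose real part is positive wherever `z f'` is nonpositive has positive real part.
  have key : ∀ f f' : ℂ → ℂ, (∀ z, ‖z‖ ≤ 1 → HasDerivAt f (f' z) z) →
      (∀ z, ‖z‖ = 1 → ∀ κ : ℝ, 0 ≤ κ → z * f' z = -(κ : ℂ) → 0 < (f z).re) →
      ∀ z, ‖z‖ ≤ 1 → 0 < (f z).re := by
    intro f f' hf hpos z hz
    have hcont : ContinuousOn (fun z => (f z).re) (sphere 0 1) := fun w hw =>
      (Complex.continuous_re.continuousAt.comp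
        (hf w (by simpa using (mem_sphere_zero_iff_norm.1 hw).le)).continuousAt).continuousWithinAt
    obtain ⟨η, hη, hmin⟩ := (isCompact_sphere (0 : ℂ) 1).exists_isMinOn ⟨1, by simp⟩ hcont
    rw [mem_sphere_zero_iff_norm] at hη
    have hdc : DiffContOnCl ℂ f (ball 0 1) := by
      refine DifferentiableOn.diffContOnCl fun w hw => ?_
      rw [closure_ball _ one_ne_zero] at hw
      exact (hf w (by simpa using hw)).differentiableAt.differentiableWithinAt
    obtain ⟨κ, hκ, hκ'⟩ := exists_mul_deriv_eq_neg_of_re_min one_pos hdc hη (hf η hη.le)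
      (fun w hw => hmin (by simpa using hw))
    have h2 := Complex.norm_le_of_forall_mem_frontier_norm_le isBounded_ball
      (⟨hdc.differentiableOn.neg.cexp, hdc.continuousOn.neg.cexp⟩ :
        DiffContOnCl ℂ (fun z => exp (-f z)) (ball 0 1))
      (C := Real.exp (-(f η).re)) (by
        intro w hw
        rw [frontier_ball _ one_ne_zero] at hw
        rw [norm_exp]
        simpa using hmin hw) (z := z) (by rw [closure_ball _ one_ne_zero]; simpa using hz)
    rw [norm_exp] at h2
    exact (hpos η hη κ hκ hκ').trans_le (by simpa using h2)
  have hP : ∀ z, ‖z‖ ≤ 1 → 0 < (α z / k z).re := by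
    refine key _ (fun z => (α' z * k z - α z * deriv k z) / k z ^ 2)
      (fun z hz => (hα z (hin z hz)).1.div (hkd z (hin z hz)) (hk0 z (hin z hz))) ?_
    intro z hz κ hκ hz'
    have hkz := hk0 z (hin z hz.le)
    have e1 := (hα z (hin z hz.le)).2
    have e2 : α z / k z * ((m : ℂ) + 1 + z * deriv k z / k z) = ((1 + κ : ℝ) : ℂ) := by
      have : z * ((α' z * k z - α z * deriv k z) / k z ^ 2)
        = (z * α' z) / k z - α z / k z * (z * deriv k z / k z) := by field_simp
      rw [this] at hz'
      have e3 : z * α' z = k z - (m + 1) * α z := by rw [← e1]; simp only [hαdef]; ring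
      rw [e3] at hz'
      push_cast
      have e4 : (k z - (m + 1) * α z) / k z = 1 - (m + 1) * (α z / k z) := by field_simp
      rw [e4] at hz'
      linear_combination -hz'
    have hCz := hC z hz.le
    have hC0 : ((m : ℂ) + 1 + z * deriv k z / k z) ≠ 0 := by
      intro h0; rw [h0] at hCz; simp at hCz
    rw [eq_div_of_mul_eq hC0 e2, Complex.div_re]
    simp only [ofReal_re, ofReal_im, zero_mul, zero_div, add_zero]
    have := Complex.normSq_pos.2 hC0
    positivity
  have hαin : ∀ z, ‖z‖ ≤ 1 → α z ≠ 0 := by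
    intro z hz h0
    have := hP z hz
    rw [h0] at this; simp at this
  have hα1 : α 1 = ∫ t in (0 : ℝ)..1, (t : ℂ) ^ m * k t := by simp [hαdef]
  have hβ1 : β 1 = ∫ t in (0 : ℝ)..1, (t : ℂ) ^ m * (F t * k t) := by simp [hβdef]
  refine ⟨by simpa [hα1] using hP 1 (by simp), ?_⟩
  rw [← hα1, ← hβ1]
  refine key (fun z => β z / α z) (fun z => (β' z * α z - β z * α' z) / α z ^ 2)
    (fun z hz => (hβ z (hin z hz)).1.div (hα z (hin z hz)).1 (hαin z hz)) ?_ 1 (by simp)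
  intro z hz κ hκ hz'
  have hkz := hk0 z (hin z hz.le)
  have hαz := hαin z hz.le
  have e1 : z * α' z = k z - (m + 1) * α z := by
    rw [← (hα z (hin z hz.le)).2]; simp only [hαdef]; ring
  have e2 : z * β' z = F z * k z - (m + 1) * β z := by
    have := (hβ z (hin z hz.le)).2
    simp only [Pi.mul_apply] at this
    rw [← this]; simp only [hβdef]; ring
  have e3 : β z / α z = F z + (κ : ℂ) * (α z / k z) := by
    have : z * ((β' z * α z - β z * α' z) / α z ^ 2)
      = ((z * β' z) * α z - β z * (z * α' z)) / α z ^ 2 := by ring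
    rw [this, e1, e2] at hz'
    field_simp at hz' ⊢
    linear_combination -hz'
  show 0 < (β z / α z).re
  rw [e3]
  have := hFp z hz.le
  have := (hP z hz.le).le
  simp only [add_re, re_ofReal_mul]
  positivity

/-! ### Kernels of close-to-convex functions along a radius -/

theorem one_sub_mem_slitPlane {w : ℂ} (hw : ‖w‖ < 1) : 1 - w ∈ slitPlane := by
  refine Or.inl ?_
  have := (abs_le.1 (Complex.abs_re_le_norm w)).2
  simp; linarith

theorem one_sub_ne_zero {w : ℂ} (hw : ‖w‖ < 1) : 1 - w ≠ 0 :=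
  slitPlane_ne_zero (one_sub_mem_slitPlane hw)

theorem re_one_add_div_one_sub_pos {w : ℂ} (hw : ‖w‖ < 1) : 0 < ((1 + w) / (1 - w)).re := by
  have h1 := Complex.normSq_pos.2 (one_sub_ne_zero hw)
  have h2 : w.re ^ 2 + w.im ^ 2 < 1 := by
    have := Complex.sq_norm w
    rw [normSq_apply] at this
    nlinarith [norm_nonneg w]
  rw [Complex.div_re, ← add_div]
  refine div_pos ?_ h1
  simp
  nlinarith

/-- The half-plane estimate `Re (1 / (1 - w)) > 1/2`. -/
theorem re_one_div_one_sub {w : ℂ} (hw : ‖w‖ < 1) : 0 < (1 / (1 - w) - 1 / 2).re := by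
  have h := re_one_add_div_one_sub_pos hw
  have e : 1 / (1 - w) - 1 / 2 = ((1 / 2 : ℝ) : ℂ) * ((1 + w) / (1 - w)) := by
    have := one_sub_ne_zero hw
    push_cast
    field_simp
    ring
  rw [e, re_ofReal_mul]
  positivity

/-- The exponent of the product `∏ (1 - yₖ z) ^ (-2 μₖ)`, the derivative of a convex function. -/
noncomputable def logProd {ι : Type*} [Fintype ι] (μ : ι → ℝ) (y : ι → ℂ) (z : ℂ) : ℂ :=
  -2 * ∑ k, (μ k : ℂ) * log (1 - y k * z)

/-- A convex combination of the kernels `1 / (1 - ζⱼ z)`. -/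
noncomputable def halfPlaneSum {κ : Type*} [Fintype κ] (ν : κ → ℝ) (ζ : κ → ℂ) (z : ℂ) : ℂ :=
  ∑ j, (ν j : ℂ) * (1 / (1 - ζ j * z))

/-- A logarithm of `∫₀¹ (X + (1 - X) P) e^γ`, assembled from principal logarithms. For
`γ t = log G'(tz)` and `P` the half-plane part of `f' / G'` it is `log (f z / z)`: the three
summands stand for `log G'`, `log (G / (z G'))` and `log (f / G)`. -/
noncomputable def logValue (X : ℂ) (γ P : ℝ → ℂ) : ℂ :=
  γ 1 + log ((∫ t in (0 : ℝ)..1, exp (γ t)) / exp (γ 1)) +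
    log (X + (1 - X) * ((∫ t in (0 : ℝ)..1, P t * exp (γ t)) / ∫ t in (0 : ℝ)..1, exp (γ t)))

theorem norm_mul_lt_one {r : ℝ} (hr1 : r < 1) {y z : ℂ} (hy : ‖y‖ ≤ r)
    (hz : z ∈ ball (0 : ℂ) (max 1 r⁻¹)) (hr : 0 < r) : ‖y * z‖ < 1 := by
  have h1 : max 1 r⁻¹ = r⁻¹ := max_eq_right (by rw [one_le_inv₀ hr]; exact hr1.le)
  rw [h1, mem_ball_zero_iff] at hz
  rw [norm_mul]
  calc ‖y‖ * ‖z‖ ≤ r * ‖z‖ := by gcongr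
    _ < r * r⁻¹ := by gcongr
    _ = 1 := mul_inv_cancel₀ hr.ne'

theorem norm_mul_ofReal_lt_one {r : ℝ} (hr1 : r < 1) {y : ℂ} (hy : ‖y‖ ≤ r) {t : ℝ}
    (ht : t ∈ Icc (0 : ℝ) 1) : ‖y * t‖ < 1 := by
  rw [norm_mul, Complex.norm_real, Real.norm_of_nonneg ht.1]
  nlinarith [ht.2, norm_nonneg y, ht.1]

theorem hasDerivAt_log_one_sub {y z : ℂ} (h : ‖y * z‖ < 1) :
    HasDerivAt (fun z => log (1 - y * z)) (-y / (1 - y * z)) z := by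
  have h1 : HasDerivAt (fun z : ℂ => 1 - y * z) (-y) z := by
    simpa using ((hasDerivAt_id z).const_mul y).const_sub 1
  exact h1.clog (one_sub_mem_slitPlane h)

section Kernel

variable {ι κ : Type*} [Fintype ι] [Fintype κ] {r : ℝ} {μ : ι → ℝ} {ν : κ → ℝ}
  {y : ι → ℂ} {ζ : κ → ℂ}

theorem hasDerivAt_logProd {z : ℂ} (h : ∀ k, ‖y k * z‖ < 1) :
    HasDerivAt (logProd μ y) (∑ k, (μ k : ℂ) * (2 * y k / (1 - y k * z))) z := by
  have h1 : HasDerivAt (logProd μ y) (-2 * ∑ k, (μ k : ℂ) * (-y k / (1 - y k * z))) z :=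
    (HasDerivAt.fun_sum fun k _ => (hasDerivAt_log_one_sub (h k)).const_mul (μ k : ℂ)).const_mul _
  refine h1.congr_deriv ?_
  rw [Finset.mul_sum]
  exact Finset.sum_congr rfl fun k _ => by ring

theorem hasDerivAt_exp_logProd {z : ℂ} (h : ∀ k, ‖y k * z‖ < 1) :
    HasDerivAt (fun z => exp (logProd μ y z))
      (exp (logProd μ y z) * ∑ k, (μ k : ℂ) * (2 * y k / (1 - y k * z))) z :=
  (hasDerivAt_logProd h).cexp

theorem continuousOn_logProd (hr1 : r < 1) (hy : ∀ k, ‖y k‖ ≤ r) :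
    ContinuousOn (fun t : ℝ => logProd μ y t) (Icc 0 1) := by
  unfold logProd
  refine continuousOn_const.mul (continuousOn_finsetSum _ fun k _ => continuousOn_const.mul ?_)
  exact ContinuousOn.clog (by fun_prop)
    fun t ht => one_sub_mem_slitPlane (norm_mul_ofReal_lt_one hr1 (hy k) ht)

theorem continuousOn_one_div_one_sub (hr1 : r < 1) {η : ℂ} (hη : ‖η‖ ≤ r) :
    ContinuousOn (fun t : ℝ => 1 / (1 - η * t)) (Icc 0 1) :=
  continuousOn_const.div (by fun_prop)
    fun _ ht => one_sub_ne_zero (norm_mul_ofReal_lt_one hr1 hη ht)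

theorem re_one_add_sum_pos (hμ : ∀ k, 0 ≤ μ k) (hμ1 : ∑ k, μ k = 1) {z : ℂ}
    (h : ∀ k, ‖y k * z‖ < 1) :
    0 < (1 + z * ∑ k, (μ k : ℂ) * (2 * y k / (1 - y k * z))).re := by
  have e : 1 + z * ∑ k, (μ k : ℂ) * (2 * y k / (1 - y k * z))
      = ∑ k, ((μ k : ℝ) : ℂ) * ((1 + y k * z) / (1 - y k * z)) := by
    have h1 : (1 : ℂ) = ∑ k, (μ k : ℂ) := by rw [← Complex.ofReal_sum, hμ1, ofReal_one]
    nth_rewrite 1 [h1]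
    rw [Finset.mul_sum, ← Finset.sum_add_distrib]
    refine Finset.sum_congr rfl fun k _ => ?_
    have := one_sub_ne_zero (h k)
    have e : (1 + y k * z) / (1 - y k * z) = 1 + z * (2 * y k / (1 - y k * z)) := by
      field_simp; ring
    rw [e]
    ring
  rw [e, Complex.re_sum]
  obtain ⟨k, -, hk⟩ : ∃ k ∈ Finset.univ, 0 < μ k := by
    by_contra! hcon
    have := Finset.sum_nonpos hcon
    linarith
  refine Finset.sum_pos' (fun k _ => ?_) ⟨k, Finset.mem_univ _, ?_⟩
  · rw [re_ofReal_mul]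
    exact mul_nonneg (hμ k) (re_one_add_div_one_sub_pos (h k)).le
  · rw [re_ofReal_mul]
    exact mul_pos hk (re_one_add_div_one_sub_pos (h k))

/-- For a product `g = ∏ (1 - yₖ z) ^ (-2 μₖ)`, positivity of the real part is preserved by
averaging with respect to `g dt`. -/
theorem re_average_logProd_pos (hr : 0 < r) (hr1 : r < 1) (hμ : ∀ k, 0 ≤ μ k)
    (hμ1 : ∑ k, μ k = 1) (hy : ∀ k, ‖y k‖ ≤ r) {F : ℂ → ℂ}
    (hF : DifferentiableOn ℂ F (ball 0 (max 1 r⁻¹))) (hFp : ∀ z, ‖z‖ ≤ 1 → 0 < (F z).re) :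
    0 < ((∫ t in (0 : ℝ)..1, exp (logProd μ y t)) / exp (logProd μ y 1)).re ∧
    0 < ((∫ t in (0 : ℝ)..1, F t * exp (logProd μ y t)) /
      ∫ t in (0 : ℝ)..1, exp (logProd μ y t)).re := by
  have hR : 1 < max 1 r⁻¹ := lt_max_of_lt_right ((one_lt_inv₀ hr).2 hr1)
  have hd : ∀ z ∈ ball (0 : ℂ) (max 1 r⁻¹), HasDerivAt (fun z => exp (logProd μ y z)) _ z :=
    fun z hz => hasDerivAt_exp_logProd fun k => norm_mul_lt_one hr1 (hy k) hz hr
  have := re_average_pos hR 0 (k := fun z => exp (logProd μ y z)) (F := F)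
    (fun z hz => (hd z hz).differentiableAt.differentiableWithinAt) (fun z _ => exp_ne_zero _)
    (fun z hz => by
      have hz' : z ∈ ball (0 : ℂ) (max 1 r⁻¹) := by rw [mem_ball_zero_iff]; linarith
      rw [(hd z hz').deriv, mul_div_assoc, mul_div_cancel_left₀ _ (exp_ne_zero _)]
      simpa using re_one_add_sum_pos hμ hμ1 fun k => norm_mul_lt_one hr1 (hy k) hz' hr) hF hFp
  simpa using this

/-- The function `h(η) = ∫₀¹ g(t) / (1 - ηt) dt` has the separation property of a convex function:
`h(ζ) - h(η)` lies in the half-plane around `ζ h'(ζ)` when `|η| ≤ |ζ|`. -/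
theorem re_separation_pos (hr : 0 < r) (hr1 : r < 1) (hμ : ∀ k, 0 ≤ μ k)
    (hμ1 : ∑ k, μ k = 1) (hy : ∀ k, ‖y k‖ ≤ r) {ζ η : ℂ} (hζ : ‖ζ‖ = r) (hη : ‖η‖ ≤ r)
    (hne : η ≠ ζ) :
    0 < (((∫ t in (0 : ℝ)..1, 1 / (1 - ζ * t) * exp (logProd μ y t)) -
        ∫ t in (0 : ℝ)..1, 1 / (1 - η * t) * exp (logProd μ y t)) /
      (ζ * ∫ t in (0 : ℝ)..1, t / (1 - ζ * t) ^ 2 * exp (logProd μ y t))).re := by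
  have hR : 1 < max 1 r⁻¹ := lt_max_of_lt_right ((one_lt_inv₀ hr).2 hr1)
  have hζ0 : ζ ≠ 0 := by rintro rfl; simp at hζ; linarith
  have hlt : ∀ {w : ℂ}, ‖w‖ ≤ r → ∀ z ∈ ball (0 : ℂ) (max 1 r⁻¹), ‖w * z‖ < 1 :=
    fun hw z hz => norm_mul_lt_one hr1 hw hz hr
  have hd : ∀ z ∈ ball (0 : ℂ) (max 1 r⁻¹),
      HasDerivAt (fun z => exp (logProd μ y z) / (1 - ζ * z) ^ 2)
        (exp (logProd μ y z) / (1 - ζ * z) ^ 2 *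
          (∑ k, (μ k : ℂ) * (2 * y k / (1 - y k * z)) + 2 * ζ / (1 - ζ * z))) z := by
    intro z hz
    have h0 := one_sub_ne_zero (hlt hζ.le z hz)
    have h1 : HasDerivAt (fun z : ℂ => (1 - ζ * z) ^ 2) (2 * (1 - ζ * z) * (-ζ)) z := by
      have : HasDerivAt (fun z : ℂ => 1 - ζ * z) (-ζ) z := by
        simpa using ((hasDerivAt_id z).const_mul ζ).const_sub 1
      simpa using this.fun_pow 2
    refine ((hasDerivAt_exp_logProd (μ := μ) fun k => hlt (hy k) z hz).div h1
      (pow_ne_zero 2 h0)).congr_deriv ?_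
    generalize ∑ k, (μ k : ℂ) * (2 * y k / (1 - y k * z)) = S
    field_simp
    ring
  have hFd : DifferentiableOn ℂ (fun z => (1 - η / ζ) * (1 - ζ * z) / (1 - η * z))
      (ball 0 (max 1 r⁻¹)) :=
    DifferentiableOn.fun_div (by fun_prop) (by fun_prop) fun z hz => one_sub_ne_zero (hlt hη z hz)
  have hk0 : ∀ z ∈ ball (0 : ℂ) (max 1 r⁻¹), exp (logProd μ y z) / (1 - ζ * z) ^ 2 ≠ 0 :=
    fun z hz => div_ne_zero (exp_ne_zero _) (pow_ne_zero 2 (one_sub_ne_zero (hlt hζ.le z hz)))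
  have hmem : ∀ z : ℂ, ‖z‖ ≤ 1 → z ∈ ball (0 : ℂ) (max 1 r⁻¹) := fun z hz => by
    rw [mem_ball_zero_iff]; linarith
  have hFp : ∀ z : ℂ, ‖z‖ ≤ 1 → 0 < ((1 - η / ζ) * (1 - ζ * z) / (1 - η * z)).re := by
    intro z hz
    have hs := hlt hζ.le z (hmem z hz)
    have hs0 := one_sub_ne_zero hs
    have hη0 := one_sub_ne_zero (hlt hη z (hmem z hz))
    have hc : ‖η / ζ‖ ≤ 1 := by rw [norm_div, hζ]; exact div_le_one_of_le₀ hη hr.le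
    have hc0 : 1 - η / ζ ≠ 0 := by
      rw [sub_ne_zero]; intro h; apply hne; field_simp at h; exact h.symm
    have hpos : 0 < (1 / (1 - ζ * z) + η / ζ / (1 - η / ζ)).re := by
      have h1 := re_one_div_one_sub hs
      have h2 : 0 ≤ (η / ζ / (1 - η / ζ) + 1 / 2).re := by
        have e : η / ζ / (1 - η / ζ) + 1 / 2
            = ((1 / 2 : ℝ) : ℂ) * ((1 + η / ζ) / (1 - η / ζ)) := by
          push_cast; field_simp; ring
        rw [e, re_ofReal_mul, Complex.div_re, ← add_div]
        have h3 := Complex.normSq_nonneg (1 - η / ζ)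
        have h4 : (η / ζ).re ^ 2 + (η / ζ).im ^ 2 ≤ 1 := by
          have := Complex.sq_norm (η / ζ)
          rw [normSq_apply] at this
          nlinarith [norm_nonneg (η / ζ)]
        refine mul_nonneg (by norm_num) (div_nonneg ?_ h3)
        simp only [add_re, sub_re, add_im, sub_im, one_re, one_im]
        nlinarith
      simp only [add_re, sub_re] at h1 h2 ⊢
      linarith
    have e : (1 - η / ζ) * (1 - ζ * z) / (1 - η * z)
        = (1 / (1 - ζ * z) + η / ζ / (1 - η / ζ))⁻¹ := by
      rw [div_add_div _ _ hs0 hc0, inv_div]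
      congr 1
      · ring
      · field_simp; ring
    rw [e, inv_re]
    refine div_pos hpos (Complex.normSq_pos.2 ?_)
    intro h; rw [h] at hpos; simp at hpos
  have key := (re_average_pos hR 1 (k := fun z => exp (logProd μ y z) / (1 - ζ * z) ^ 2)
    (fun z hz => (hd z hz).differentiableAt.differentiableWithinAt) hk0
    (fun z hz => by
      rw [(hd z (hmem z hz)).deriv, mul_div_assoc, mul_div_cancel_left₀ _ (hk0 z (hmem z hz))]
      have h1 := re_one_add_sum_pos hμ hμ1 (y := y) (z := z) fun k => hlt (hy k) z (hmem z hz)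
      have h2 := re_one_add_div_one_sub_pos (hlt hζ.le z (hmem z hz))
      have h0 := one_sub_ne_zero (hlt hζ.le z (hmem z hz))
      have e : (1 + ζ * z) / (1 - ζ * z) = 1 + z * (2 * ζ / (1 - ζ * z)) := by
        field_simp; ring
      rw [e] at h2
      have e2 : ((1 : ℕ) : ℂ) + 1 + z * (∑ k, (μ k : ℂ) * (2 * y k / (1 - y k * z)) +
          2 * ζ / (1 - ζ * z)) = (1 + z * ∑ k, (μ k : ℂ) * (2 * y k / (1 - y k * z))) +
          (1 + z * (2 * ζ / (1 - ζ * z))) := by push_cast; ring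
      rw [e2, add_re]
      exact add_pos h1 h2) hFd hFp).2
  have hi : ∀ w : ℂ, ‖w‖ ≤ r → IntervalIntegrable
      (fun t : ℝ => 1 / (1 - w * t) * exp (logProd μ y t)) MeasureTheory.volume 0 1 := fun w hw =>
    ((continuousOn_one_div_one_sub hr1 hw).mul
      (continuousOn_logProd hr1 hy).cexp).intervalIntegrable_of_Icc zero_le_one
  rw [← intervalIntegral.integral_sub (hi ζ hζ.le) (hi η hη),
    ← intervalIntegral.integral_const_mul]
  have e1 : ∫ t in (0 : ℝ)..1, (1 / (1 - ζ * t) * exp (logProd μ y t) -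
      1 / (1 - η * t) * exp (logProd μ y t)) = ζ * ∫ t in (0 : ℝ)..1, (t : ℂ) ^ 1 *
        ((1 - η / ζ) * (1 - ζ * t) / (1 - η * t) * (exp (logProd μ y t) / (1 - ζ * t) ^ 2)) := by
    rw [← intervalIntegral.integral_const_mul]
    refine intervalIntegral.integral_congr fun t ht => ?_
    rw [uIcc_of_le zero_le_one] at ht
    have h1 := one_sub_ne_zero (norm_mul_ofReal_lt_one hr1 hζ.le ht)
    have h2 := one_sub_ne_zero (norm_mul_ofReal_lt_one hr1 hη ht)
    have h3 : 1 - (t : ℂ) * η ≠ 0 := by rwa [mul_comm]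
    field_simp
    ring
  have e2 : ∫ t in (0 : ℝ)..1, ζ * (t / (1 - ζ * t) ^ 2 * exp (logProd μ y t))
      = ζ * ∫ t in (0 : ℝ)..1, (t : ℂ) ^ 1 * (exp (logProd μ y t) / (1 - ζ * t) ^ 2) := by
    rw [← intervalIntegral.integral_const_mul]
    refine intervalIntegral.integral_congr fun t _ => ?_
    ring
  rw [e1, e2, mul_div_mul_left _ _ hζ0]
  exact key

end Kernel

/-! ### First-order conditions on the torus of parameters -/

open MeasureTheory in
theorem continuousOn_integral_unit {E : Type*} [TopologicalSpace E] {S : Set E}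
    {f : E → ℝ → ℂ} (hf : ContinuousOn (Function.uncurry f) (S ×ˢ Icc 0 1)) :
    ContinuousOn (fun x => ∫ t in (0 : ℝ)..1, f x t) S := by
  rw [continuousOn_iff_continuous_domRestrict]
  have h1 : Continuous (Function.uncurry fun (x : S) (t : ℝ) => f x (projIcc 0 1 zero_le_one t)) :=
    hf.comp_continuous (f := fun p : S × ℝ => ((p.1 : E), (projIcc 0 1 zero_le_one p.2 : ℝ)))
      (by fun_prop) (fun p => ⟨p.1.2, (projIcc 0 1 zero_le_one p.2).2⟩)
  have h2 := intervalIntegral.continuous_parametric_intervalIntegral_of_continuous' (μ := volume)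
    h1 0 1
  convert h2 using 2 with x
  refine intervalIntegral.integral_congr fun t ht => ?_
  rw [uIcc_of_le zero_le_one] at ht
  simp [projIcc_of_mem zero_le_one ht]

theorem sum_update_apply {κ M N : Type*} [Fintype κ] [DecidableEq κ] [AddCommMonoid N]
    (f : κ → M → N) (x : κ → M) (j : κ) (η : M) :
    ∑ i, f i (Function.update x j η i) = f j η + ∑ i ∈ Finset.univ.erase j, f i (x i) := by
  rw [← Finset.add_sum_erase _ _ (Finset.mem_univ j), Function.update_self]
  congr 1
  refine Finset.sum_congr rfl fun i hi => ?_
  rw [Function.update_of_ne (Finset.ne_of_mem_erase hi)]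

/-- A half-plane average `Q` of real part above `1/2` gives `X + (1 - X) Q` off the negative axis:
otherwise `|Q - 1| < |Q|` would contradict `|s + X| ≤ s + 1`. -/
theorem affine_mem_slitPlane {X Q : ℂ} (hX : ‖X‖ ≤ 1) (hQ : 0 < (Q - 1 / 2).re) :
    X + (1 - X) * Q ∈ slitPlane := by
  by_contra hcon
  rw [mem_slitPlane_iff, not_or, not_lt, not_not] at hcon
  set s : ℝ := -(X + (1 - X) * Q).re with hs
  have hs0 : 0 ≤ s := by linarith [hcon.1]
  have hq : X + (1 - X) * Q = -(s : ℂ) := by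
    apply Complex.ext
    · simp [hs]
    · simpa using hcon.2
  have h1 : ‖1 - X‖ * ‖Q - 1‖ = 1 + s := by
    rw [← norm_mul, show (1 - X) * (Q - 1) = -((1 + s : ℝ) : ℂ) by
      push_cast; linear_combination hq, norm_neg, Complex.norm_real, Real.norm_of_nonneg]
    linarith
  have h2 : ‖1 - X‖ * ‖Q‖ ≤ 1 + s := by
    rw [← norm_mul, show (1 - X) * Q = -(s + X) by linear_combination hq, norm_neg]
    refine (norm_add_le _ _).trans ?_
    rw [Complex.norm_real, Real.norm_of_nonneg hs0]
    linarith
  have h3 : ‖Q - 1‖ < ‖Q‖ := by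
    refine lt_of_pow_lt_pow_left₀ 2 (norm_nonneg _) ?_
    rw [Complex.sq_norm, Complex.sq_norm, normSq_apply, normSq_apply]
    simp at hQ ⊢
    nlinarith
  have h4 : 0 < ‖1 - X‖ := by
    rcases (norm_nonneg (1 - X)).eq_or_lt with h | h
    · rw [← h] at h1; linarith
    · exact h
  nlinarith

open Filter Topology in
/-- First-order condition at a minimum over a circle of `Re (c log J)`, where the logarithm is
assembled from `J = exp A * N₁ * N₂` and principal logarithms of `N₁` and `N₂`. -/
theorem exists_mul_logDeriv_eq_neg {r : ℝ} (hr : 0 < r) {c : ℂ} {A N₁ N₂ J : ℂ → ℂ} {J' η : ℂ}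
    (hA : ∀ z, ‖z‖ ≤ r → DifferentiableAt ℂ A z) (h₁ : ∀ z, ‖z‖ ≤ r → DifferentiableAt ℂ N₁ z)
    (h₂ : ∀ z, ‖z‖ ≤ r → DifferentiableAt ℂ N₂ z) (s₁ : ∀ z, ‖z‖ ≤ r → N₁ z ∈ slitPlane)
    (s₂ : ∀ z, ‖z‖ ≤ r → N₂ z ∈ slitPlane) (hη : ‖η‖ = r)
    (hJ : ∀ z, N₁ z ≠ 0 → J z = exp (A z) * N₁ z * N₂ z) (hJ' : HasDerivAt J J' η)
    (hmin : ∀ z, ‖z‖ = r → (c * (A η + log (N₁ η) + log (N₂ η))).re ≤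
      (c * (A z + log (N₁ z) + log (N₂ z))).re) :
    ∃ k : ℝ, 0 ≤ k ∧ η * (c * J' / J η) = -(k : ℂ) := by
  have hd : ∀ z, ‖z‖ ≤ r →
      DifferentiableAt ℂ (fun z => A z + log (N₁ z) + log (N₂ z)) z := fun z hz =>
    ((hA z hz).add ((h₁ z hz).clog (s₁ z hz))).add ((h₂ z hz).clog (s₂ z hz))
  have hL := (hd η hη.le).hasDerivAt
  set L' := deriv (fun z => A z + log (N₁ z) + log (N₂ z)) η
  have hdc : DiffContOnCl ℂ (fun z => c * (A z + log (N₁ z) + log (N₂ z))) (ball 0 r) := by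
    refine DifferentiableOn.diffContOnCl fun z hz => ?_
    rw [closure_ball _ hr.ne'] at hz
    exact ((hd z (by simpa using hz)).const_mul c).differentiableWithinAt
  obtain ⟨k, hk, hk'⟩ := exists_mul_deriv_eq_neg_of_re_min hr hdc hη (hL.const_mul c) hmin
  refine ⟨k, hk, ?_⟩
  have hexp : ∀ z, N₁ z ∈ slitPlane → N₂ z ∈ slitPlane →
      J z = exp (A z + log (N₁ z) + log (N₂ z)) := by
    intro z hz₁ hz₂
    rw [exp_add, exp_add, exp_log (slitPlane_ne_zero hz₁), exp_log (slitPlane_ne_zero hz₂),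
      hJ z (slitPlane_ne_zero hz₁)]
  have hev : J =ᶠ[𝓝 η] fun z => exp (A z + log (N₁ z) + log (N₂ z)) := by
    filter_upwards [(h₁ η hη.le).continuousAt.eventually_mem
      (isOpen_slitPlane.mem_nhds (s₁ η hη.le)), (h₂ η hη.le).continuousAt.eventually_mem
      (isOpen_slitPlane.mem_nhds (s₂ η hη.le))] with z hz₁ hz₂ using hexp z hz₁ hz₂
  have hu := hJ'.unique (hL.cexp.congr_of_eventuallyEq hev)
  rw [← hexp η (s₁ η hη.le) (s₂ η hη.le)] at hu
  have hJ0 : J η ≠ 0 := by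
    rw [hexp η (s₁ η hη.le) (s₂ η hη.le)]; exact exp_ne_zero _
  rw [← hk', hu]
  field_simp

open MeasureTheory in
theorem hasDerivAt_integral_one_div {g : ℝ → ℂ} (hg : ContinuousOn g (Icc 0 1)) {η : ℂ}
    (hη : ‖η‖ < 1) :
    HasDerivAt (fun η => ∫ t in (0 : ℝ)..1, 1 / (1 - η * t) * g t)
      (∫ t in (0 : ℝ)..1, t / (1 - η * t) ^ 2 * g t) η := by
  have hne : ∀ p ∈ ball (0 : ℂ) 1 ×ˢ Icc (0 : ℝ) 1, 1 - p.1 * (p.2 : ℂ) ≠ 0 := fun p hp =>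
    one_sub_ne_zero (norm_mul_ofReal_lt_one (mem_ball_zero_iff.1 hp.1) le_rfl hp.2)
  have hg' : ContinuousOn (fun p : ℂ × ℝ => g p.2) (ball (0 : ℂ) 1 ×ˢ Icc 0 1) :=
    hg.comp (by fun_prop) fun p hp => hp.2
  refine hasDerivAt_integral_unit isOpen_ball (f := fun η t => 1 / (1 - η * t) * g t)
    (f' := fun η t => t / (1 - η * t) ^ 2 * g t) ?_ ?_ ?_ (mem_ball_zero_iff.2 hη)
  · exact (ContinuousOn.div (by fun_prop) (by fun_prop) hne).mul hg'
  · exact (ContinuousOn.div (by fun_prop) (by fun_prop)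
      fun p hp => pow_ne_zero 2 (hne p hp)).mul hg'
  · intro z hz t ht
    have h0 := hne (z, t) ⟨hz, ht⟩
    have h1 : HasDerivAt (fun z : ℂ => 1 - z * (t : ℂ)) (-t) z := by
      simpa using ((hasDerivAt_id z).mul_const (t : ℂ)).const_sub 1
    have h2 := (h1.inv h0).mul_const (g t)
    simpa [one_div] using h2

theorem hasDerivAt_integral_exp_log {φ : ℝ → ℂ} (hφ : ContinuousOn φ (Icc 0 1)) (μ : ℂ) {η : ℂ}
    (hη : ‖η‖ < 1) :
    HasDerivAt (fun η => ∫ t in (0 : ℝ)..1, φ t * exp (-2 * (μ * log (1 - η * t))))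
      (∫ t in (0 : ℝ)..1, φ t * (exp (-2 * (μ * log (1 - η * t))) *
        (2 * μ * t / (1 - η * t)))) η := by
  have hs : ∀ p ∈ ball (0 : ℂ) 1 ×ˢ Icc (0 : ℝ) 1, 1 - p.1 * (p.2 : ℂ) ∈ slitPlane := fun p hp =>
    one_sub_mem_slitPlane (norm_mul_ofReal_lt_one (mem_ball_zero_iff.1 hp.1) le_rfl hp.2)
  have hφ' : ContinuousOn (fun p : ℂ × ℝ => φ p.2) (ball (0 : ℂ) 1 ×ˢ Icc 0 1) :=
    hφ.comp (by fun_prop) fun p hp => hp.2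
  have he : ContinuousOn (fun p : ℂ × ℝ => exp (-2 * (μ * log (1 - p.1 * p.2))))
      (ball (0 : ℂ) 1 ×ˢ Icc 0 1) :=
    (continuousOn_const.mul (continuousOn_const.mul
      (ContinuousOn.clog (by fun_prop) hs))).cexp
  refine hasDerivAt_integral_unit isOpen_ball
    (f := fun η t => φ t * exp (-2 * (μ * log (1 - η * t))))
    (f' := fun η t => φ t * (exp (-2 * (μ * log (1 - η * t))) * (2 * μ * t / (1 - η * t))))
    ?_ ?_ ?_ (mem_ball_zero_iff.2 hη)
  · exact hφ'.mul he
  · exact hφ'.mul (he.mul (ContinuousOn.div (by fun_prop) (by fun_prop)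
      fun p hp => slitPlane_ne_zero (hs p hp)))
  · intro z hz t ht
    have h1 : HasDerivAt (fun z : ℂ => 1 - z * (t : ℂ)) (-t) z := by
      simpa using ((hasDerivAt_id z).mul_const (t : ℂ)).const_sub 1
    have h2 := (((h1.clog (hs (z, t) ⟨hz, ht⟩)).const_mul μ).const_mul (-2)).cexp.const_mul (φ t)
    refine h2.congr_deriv ?_
    ring

section Conditions

variable {ι κ : Type*} [Fintype ι] [Fintype κ] {r : ℝ} {μ : ι → ℝ} {ν : κ → ℝ}
  {X : ℂ} {ζ : κ → ℂ} {y : ι → ℂ}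

theorem continuousOn_halfPlaneSum (hr1 : r < 1) (hζ : ∀ j, ‖ζ j‖ ≤ r) :
    ContinuousOn (fun t : ℝ => halfPlaneSum ν ζ t) (Icc 0 1) :=
  continuousOn_finsetSum _ fun j _ => continuousOn_const.mul
    (continuousOn_one_div_one_sub hr1 (hζ j))

theorem integral_halfPlaneSum (hr1 : r < 1) (hζ : ∀ j, ‖ζ j‖ ≤ r) {g : ℝ → ℂ}
    (hg : ContinuousOn g (Icc 0 1)) :
    ∫ t in (0 : ℝ)..1, halfPlaneSum ν ζ t * g t =
      ∑ j, (ν j : ℂ) * ∫ t in (0 : ℝ)..1, 1 / (1 - ζ j * t) * g t := by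
  have hi : ∀ j, IntervalIntegrable (fun t : ℝ => (ν j : ℂ) * (1 / (1 - ζ j * t) * g t))
      MeasureTheory.volume 0 1 := fun j =>
    (continuousOn_const.mul ((continuousOn_one_div_one_sub hr1 (hζ j)).mul
      hg)).intervalIntegrable_of_Icc zero_le_one
  simp only [← intervalIntegral.integral_const_mul]
  rw [← intervalIntegral.integral_finsetSum fun j _ => hi j]
  refine intervalIntegral.integral_congr fun t _ => ?_
  simp only [halfPlaneSum, Finset.sum_mul]
  exact Finset.sum_congr rfl fun j _ => by ring

variable (hr : 0 < r) (hr1 : r < 1) (hμ : ∀ k, 0 ≤ μ k) (hμ1 : ∑ k, μ k = 1)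
  (hν : ∀ j, 0 ≤ ν j) (hν1 : ∑ j, ν j = 1)

include hr hr1 hμ hμ1 in
theorem integral_logProd_mem_slitPlane (hy : ∀ k, ‖y k‖ ≤ r) :
    (∫ t in (0 : ℝ)..1, exp (logProd μ y t)) / exp (logProd μ y 1) ∈ slitPlane :=
  Or.inl (re_average_logProd_pos hr hr1 hμ hμ1 hy (F := fun _ => 1) (by fun_prop) (by simp)).1

include hr hr1 hμ hμ1 hν hν1 in
theorem affine_average_mem_slitPlane (hX : ‖X‖ ≤ 1) (hζ : ∀ j, ‖ζ j‖ ≤ r) (hy : ∀ k, ‖y k‖ ≤ r) :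
    X + (1 - X) * ((∫ t in (0 : ℝ)..1, halfPlaneSum ν ζ t * exp (logProd μ y t)) /
      ∫ t in (0 : ℝ)..1, exp (logProd μ y t)) ∈ slitPlane := by
  refine affine_mem_slitPlane hX ?_
  have hg := (continuousOn_logProd (μ := μ) hr1 hy).cexp
  have hne : (∫ t in (0 : ℝ)..1, exp (logProd μ y t)) ≠ 0 := fun h => by
    have := integral_logProd_mem_slitPlane hr hr1 hμ hμ1 hy
    simp [h] at this
  have h := (re_average_logProd_pos hr hr1 hμ hμ1 hy
    (F := fun z => halfPlaneSum ν ζ z - 1 / 2) ?_ ?_).2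
  · convert h using 2
    rw [eq_div_iff hne, sub_mul, div_mul_cancel₀ _ hne, ← intervalIntegral.integral_const_mul,
      ← intervalIntegral.integral_sub]
    · exact intervalIntegral.integral_congr fun t _ => by ring
    · exact ((continuousOn_halfPlaneSum hr1 hζ).mul hg).intervalIntegrable_of_Icc zero_le_one
    · exact (continuousOn_const.mul hg).intervalIntegrable_of_Icc zero_le_one
  · unfold halfPlaneSum
    refine DifferentiableOn.sub (DifferentiableOn.fun_sum fun j _ => ?_) (by fun_prop)
    exact DifferentiableOn.const_mul (DifferentiableOn.fun_div (by fun_prop) (by fun_prop)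
      fun z hz => one_sub_ne_zero (norm_mul_lt_one hr1 (hζ j) hz hr)) _
  · intro z hz
    have hz' : z ∈ ball (0 : ℂ) (max 1 r⁻¹) := by
      rw [mem_ball_zero_iff]
      exact hz.trans_lt (lt_max_of_lt_right ((one_lt_inv₀ hr).2 hr1))
    have hpos := fun j => re_one_div_one_sub (norm_mul_lt_one hr1 (hζ j) hz' hr)
    have e : halfPlaneSum ν ζ z - 1 / 2 = ∑ j, ((ν j : ℝ) : ℂ) * (1 / (1 - ζ j * z) - 1 / 2) := by
      simp only [halfPlaneSum, mul_sub, Finset.sum_sub_distrib, ← Finset.sum_mul,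
        ← Complex.ofReal_sum, hν1, ofReal_one, one_mul]
    rw [e, Complex.re_sum]
    obtain ⟨j, -, hj⟩ : ∃ j ∈ Finset.univ, 0 < ν j := by
      by_contra! hcon
      have := Finset.sum_nonpos hcon
      linarith
    refine Finset.sum_pos' (fun j _ => ?_) ⟨j, Finset.mem_univ _, ?_⟩
    · rw [re_ofReal_mul]; exact mul_nonneg (hν j) (hpos j).le
    · rw [re_ofReal_mul]; exact mul_pos hj (hpos j)

end Conditions

section Minimizer

variable {ι κ : Type*} [Fintype ι] [Fintype κ]

/-- `logValue` for the product with exponents `μ` at the points `y` and the half-plane sum with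
weights `ν` at the points `ζ`. -/
noncomputable def torusValue (μ : ι → ℝ) (ν : κ → ℝ) (X : ℂ) (ζ : κ → ℂ) (y : ι → ℂ) : ℂ :=
  logValue X (fun t => logProd μ y t) (fun t => halfPlaneSum ν ζ t)

/-- The weighted integral `h(η) = ∫₀¹ g(t) / (1 - ηt) dt` with `g = ∏ (1 - yₖ t) ^ (-2 μₖ)`. -/
noncomputable def radialTransform (μ : ι → ℝ) (y : ι → ℂ) (η : ℂ) : ℂ :=
  ∫ t in (0 : ℝ)..1, 1 / (1 - η * t) * exp (logProd μ y t)

/-- The mean value `∫₀¹ (X + (1 - X) P) g dt` whose logarithm is `torusValue`. -/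
noncomputable def meanValue (μ : ι → ℝ) (ν : κ → ℝ) (X : ℂ) (ζ : κ → ℂ) (y : ι → ℂ) : ℂ :=
  X * radialTransform μ y 0 + (1 - X) * ∑ j, (ν j : ℂ) * radialTransform μ y (ζ j)

variable {r : ℝ} {μ : ι → ℝ} {ν : κ → ℝ} {X c : ℂ} {ζ : κ → ℂ} {y : ι → ℂ}

theorem radialTransform_zero :
    radialTransform μ y 0 = ∫ t in (0 : ℝ)..1, exp (logProd μ y t) := by
  simp [radialTransform]

variable (hr : 0 < r) (hr1 : r < 1) (hμ : ∀ k, 0 ≤ μ k) (hμ1 : ∑ k, μ k = 1)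
  (hν : ∀ j, 0 ≤ ν j) (hν1 : ∑ j, ν j = 1)

include hr hr1 hμ hμ1 in
theorem radialTransform_zero_ne_zero (hy : ∀ k, ‖y k‖ ≤ r) : radialTransform μ y 0 ≠ 0 := by
  intro h
  have := integral_logProd_mem_slitPlane hr hr1 hμ hμ1 hy
  rw [← radialTransform_zero, h] at this
  simp at this

include hr1 in
theorem torusValue_eq (hζ : ∀ j, ‖ζ j‖ ≤ r) (hy : ∀ k, ‖y k‖ ≤ r) :
    torusValue μ ν X ζ y = logProd μ y 1 + log (radialTransform μ y 0 / exp (logProd μ y 1)) +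
      log (X + (1 - X) * ((∑ j, (ν j : ℂ) * radialTransform μ y (ζ j)) /
        radialTransform μ y 0)) := by
  rw [torusValue, logValue, integral_halfPlaneSum hr1 hζ (continuousOn_logProd hr1 hy).cexp,
    ← radialTransform_zero, ofReal_one]
  rfl

include hr hr1 hμ hμ1 hν hν1 in
theorem slitPlane_factors (hX : ‖X‖ ≤ 1) (hζ : ∀ j, ‖ζ j‖ ≤ r) (hy : ∀ k, ‖y k‖ ≤ r) :
    radialTransform μ y 0 / exp (logProd μ y 1) ∈ slitPlane ∧
    X + (1 - X) * ((∑ j, (ν j : ℂ) * radialTransform μ y (ζ j)) /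
        radialTransform μ y 0) ∈ slitPlane := by
  constructor
  · rw [radialTransform_zero]
    exact integral_logProd_mem_slitPlane hr hr1 hμ hμ1 hy
  · have := affine_average_mem_slitPlane hr hr1 hμ hμ1 hν hν1 hX hζ hy
    rwa [integral_halfPlaneSum hr1 hζ (continuousOn_logProd hr1 hy).cexp,
      ← radialTransform_zero] at this

include hr hr1 hμ hμ1 hν hν1 in
theorem meanValue_ne_zero (hX : ‖X‖ ≤ 1) (hζ : ∀ j, ‖ζ j‖ ≤ r) (hy : ∀ k, ‖y k‖ ≤ r) :
    meanValue μ ν X ζ y ≠ 0 := by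
  have h := (slitPlane_factors hr hr1 hμ hμ1 hν hν1 hX hζ hy).2
  have h0 := radialTransform_zero_ne_zero hr hr1 hμ hμ1 hy
  have e : meanValue μ ν X ζ y = (X + (1 - X) * ((∑ j, (ν j : ℂ) * radialTransform μ y (ζ j)) /
        radialTransform μ y 0)) * radialTransform μ y 0 := by
    rw [meanValue]; field_simp
  rw [e]
  exact mul_ne_zero (slitPlane_ne_zero h) h0

/-- The point `(X, ζ, y)` of the torus minimizes `Re (c * torusValue)`. -/
def IsTorusMin (r : ℝ) (μ : ι → ℝ) (ν : κ → ℝ) (c X : ℂ) (ζ : κ → ℂ) (y : ι → ℂ) : Prop :=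
  (‖X‖ = 1 ∧ (∀ j, ‖ζ j‖ = r) ∧ ∀ k, ‖y k‖ = r) ∧
  ∀ X' ζ' y', ‖X'‖ = 1 → (∀ j, ‖ζ' j‖ = r) → (∀ k, ‖y' k‖ = r) →
    (c * torusValue μ ν X ζ y).re ≤ (c * torusValue μ ν X' ζ' y').re

include hr hr1 hμ hμ1 hν hν1 in
/-- The first-order condition in `X`: the logarithmic derivative of the mean value, multiplied by
`c X`, is real and nonpositive. -/
theorem IsTorusMin.condition_const (h : IsTorusMin r μ ν c X ζ y) :
    ∃ k : ℝ, 0 ≤ k ∧ X * (c * (radialTransform μ y 0 - ∑ j, (ν j : ℂ) * radialTransform μ y (ζ j)) /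
      meanValue μ ν X ζ y) = -(k : ℂ) := by
  obtain ⟨⟨hX, hζ, hy⟩, hmin⟩ := h
  have hζ' := fun j => (hζ j).le
  have hy' := fun j => (hy j).le
  have h0 := radialTransform_zero_ne_zero hr hr1 hμ hμ1 hy'
  refine exists_mul_logDeriv_eq_neg one_pos (A := fun _ => logProd μ y 1)
    (N₁ := fun _ => radialTransform μ y 0 / exp (logProd μ y 1))
    (N₂ := fun X => X + (1 - X) * ((∑ j, (ν j : ℂ) * radialTransform μ y (ζ j)) /
        radialTransform μ y 0)) (J := fun X => meanValue μ ν X ζ y)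
    (fun _ _ => by fun_prop) (fun _ _ => by fun_prop) (fun _ _ => by fun_prop)
    (fun X hX => (slitPlane_factors hr hr1 hμ hμ1 hν hν1 hX hζ' hy').1)
    (fun X hX => (slitPlane_factors hr hr1 hμ hμ1 hν hν1 hX hζ' hy').2) hX ?_ ?_ ?_
  · intro X _
    have := exp_ne_zero (logProd μ y 1)
    simp only [meanValue]
    field_simp
  · have h1 := ((hasDerivAt_id X).mul_const (radialTransform μ y 0)).add
      (((hasDerivAt_id X).const_sub 1).mul_const (∑ j, (ν j : ℂ) * radialTransform μ y (ζ j)))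
    refine h1.congr_deriv ?_
    ring
  · intro X' hX'
    have := hmin X' ζ y hX' hζ hy
    rwa [torusValue_eq hr1 hζ' hy', torusValue_eq hr1 hζ' hy'] at this

include hr1 in
theorem hasDerivAt_radialTransform (hy : ∀ k, ‖y k‖ ≤ r) {η : ℂ} (hη : ‖η‖ ≤ r) :
    HasDerivAt (radialTransform μ y)
      (∫ t in (0 : ℝ)..1, t / (1 - η * t) ^ 2 * exp (logProd μ y t)) η :=
  hasDerivAt_integral_one_div (continuousOn_logProd hr1 hy).cexp (hη.trans_lt hr1)

include hr hr1 hμ hμ1 hν hν1 in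
/-- The first-order condition in the point `ζⱼ` of the half-plane sum: `c ζⱼ` times the partial
logarithmic derivative is real and nonpositive. -/
theorem IsTorusMin.condition_pole (h : IsTorusMin r μ ν c X ζ y) (j : κ) :
    ∃ k : ℝ, 0 ≤ k ∧ ζ j * (c * ((1 - X) * ((ν j : ℂ) *
      ∫ t in (0 : ℝ)..1, t / (1 - ζ j * t) ^ 2 * exp (logProd μ y t))) /
      meanValue μ ν X ζ y) = -(k : ℂ) := by
  classical
  obtain ⟨⟨hX, hζ, hy⟩, hmin⟩ := h
  have hζ' := fun j => (hζ j).le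
  have hy' := fun j => (hy j).le
  have h0 := radialTransform_zero_ne_zero hr hr1 hμ hμ1 hy'
  have hup : ∀ {z : ℂ}, ‖z‖ ≤ r → ∀ i, ‖Function.update ζ j z i‖ ≤ r := fun hz i => by
    rcases eq_or_ne i j with rfl | hi
    · simpa using hz
    · simpa [hi] using hζ' i
  have hup' : ∀ {z : ℂ}, ‖z‖ = r → ∀ i, ‖Function.update ζ j z i‖ = r := fun hz i => by
    rcases eq_or_ne i j with rfl | hi
    · simpa using hz
    · simpa [hi] using hζ i
  have hW : ∀ z : ℂ, ‖z‖ ≤ r → HasDerivAt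
      (fun z => ∑ i, (ν i : ℂ) * radialTransform μ y (Function.update ζ j z i)) ((ν j : ℂ) *
        ∫ t in (0 : ℝ)..1, t / (1 - z * t) ^ 2 * exp (logProd μ y t)) z := by
    intro z hz
    simp only [sum_update_apply fun i x => (ν i : ℂ) * radialTransform μ y x]
    exact ((hasDerivAt_radialTransform hr1 hy' hz).const_mul _).add_const _
  have key := exists_mul_logDeriv_eq_neg hr (c := c) (η := ζ j) (A := fun _ => logProd μ y 1)
    (N₁ := fun _ => radialTransform μ y 0 / exp (logProd μ y 1))
    (N₂ := fun z => X + (1 - X) * ((∑ i, (ν i : ℂ) *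
      radialTransform μ y (Function.update ζ j z i)) / radialTransform μ y 0))
    (J := fun z => meanValue μ ν X (Function.update ζ j z) y)
    (fun _ _ => by fun_prop) (fun _ _ => by fun_prop)
    (fun z hz => (((hW z hz).div_const _).const_mul _).differentiableAt.const_add _)
    (fun z hz => (slitPlane_factors hr hr1 hμ hμ1 hν hν1 hX.le hζ' hy').1)
    (fun z hz => (slitPlane_factors hr hr1 hμ hμ1 hν hν1 hX.le (hup hz) hy').2) (hζ j) ?_
    (((hW (ζ j) (hζ' j)).const_mul (1 - X)).const_add (X * radialTransform μ y 0)) ?_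
  · simpa using key
  · intro z _
    have := exp_ne_zero (logProd μ y 1)
    simp only [meanValue]
    field_simp
  · intro z hz
    have := hmin X (Function.update ζ j z) y hX (hup' hz) hy
    rw [torusValue_eq hr1 hζ' hy', torusValue_eq hr1 (hup hz.le) hy'] at this
    simpa using this

include hr hr1 hμ hμ1 hν hν1 in
/-- The first-order condition in the point `yₖ` of the product: `c yₖ` times the partial logarithmic
derivative is real and nonpositive. -/
theorem IsTorusMin.condition_exponent (h : IsTorusMin r μ ν c X ζ y) (k : ι) :
    ∃ q : ℝ, 0 ≤ q ∧ y k * (c * (∫ t in (0 : ℝ)..1, (X + (1 - X) * halfPlaneSum ν ζ t) *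
      (exp (logProd μ y t) * (2 * μ k * t / (1 - y k * t)))) / meanValue μ ν X ζ y) = -(q : ℂ) := by
  classical
  obtain ⟨⟨hX, hζ, hy⟩, hmin⟩ := h
  have hζ' := fun j => (hζ j).le
  have hy' := fun j => (hy j).le
  have hup : ∀ {z : ℂ}, ‖z‖ ≤ r → ∀ i, ‖Function.update y k z i‖ ≤ r := fun hz i => by
    rcases eq_or_ne i k with rfl | hi
    · simpa using hz
    · simpa [hi] using hy' i
  have hup' : ∀ {z : ℂ}, ‖z‖ = r → ∀ i, ‖Function.update y k z i‖ = r := fun hz i => by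
    rcases eq_or_ne i k with rfl | hi
    · simpa using hz
    · simpa [hi] using hy i
  set e : ℂ → ℂ := fun t => -2 * ∑ i ∈ Finset.univ.erase k, (μ i : ℂ) * log (1 - y i * t) with he
  have hlog : ∀ z t : ℂ, logProd μ (Function.update y k z) t =
      -2 * ((μ k : ℂ) * log (1 - z * t)) + e t := by
    intro z t
    rw [logProd, sum_update_apply fun i x => (μ i : ℂ) * log (1 - x * t), mul_add]
  have hec : ContinuousOn (fun t : ℝ => exp (e t)) (Icc 0 1) :=
    (continuousOn_const.mul (continuousOn_finsetSum _ fun i _ => continuousOn_const.mul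
      (ContinuousOn.clog (by fun_prop)
        fun t ht => one_sub_mem_slitPlane (norm_mul_ofReal_lt_one hr1 (hy' i) ht)))).cexp
  have hpc := continuousOn_halfPlaneSum (ν := ν) hr1 hζ'
  -- The two integrals as functions of the point `y k`.
  have hG : ∀ z : ℂ, ‖z‖ ≤ r → HasDerivAt
      (fun z => ∫ t in (0 : ℝ)..1, exp (logProd μ (Function.update y k z) t))
      (∫ t in (0 : ℝ)..1, exp (e t) * (exp (-2 * ((μ k : ℂ) * log (1 - z * t))) *
        (2 * μ k * t / (1 - z * t)))) z := by
    intro z hz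
    simp only [hlog, exp_add, mul_comm (exp (-2 * _))]
    simpa only [mul_comm (exp (-2 * _))] using
      hasDerivAt_integral_exp_log hec (μ k : ℂ) (hz.trans_lt hr1)
  have hW : ∀ z : ℂ, ‖z‖ ≤ r → HasDerivAt
      (fun z => ∫ t in (0 : ℝ)..1, halfPlaneSum ν ζ t * exp (logProd μ (Function.update y k z) t))
      (∫ t in (0 : ℝ)..1, (halfPlaneSum ν ζ t * exp (e t)) *
        (exp (-2 * ((μ k : ℂ) * log (1 - z * t))) * (2 * μ k * t / (1 - z * t)))) z := by
    intro z hz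
    have := hasDerivAt_integral_exp_log (hpc.mul hec) (μ k : ℂ) (hz.trans_lt hr1)
    simp only [hlog, exp_add]
    refine this.congr_of_eventuallyEq (Filter.Eventually.of_forall fun w => ?_)
    exact intervalIntegral.integral_congr fun t _ => by simp only [Pi.mul_apply]; ring
  have hA : ∀ z : ℂ, ‖z‖ ≤ r →
      DifferentiableAt ℂ (fun z => logProd μ (Function.update y k z) 1) z := by
    intro z hz
    simp only [hlog, mul_one]
    have h1 : DifferentiableAt ℂ (fun z : ℂ => log (1 - z)) z :=
      DifferentiableAt.clog (by fun_prop) (one_sub_mem_slitPlane (hz.trans_lt hr1))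
    exact ((h1.const_mul _).const_mul _).add_const _
  have hs := fun z (hz : ‖z‖ ≤ r) => integral_logProd_mem_slitPlane hr hr1 hμ hμ1 (hup hz)
  have hG0 : ∀ z : ℂ, ‖z‖ ≤ r →
      (∫ t in (0 : ℝ)..1, exp (logProd μ (Function.update y k z) t)) ≠ 0 := fun z hz h0 => by
    have := hs z hz
    simp [h0] at this
  have key := exists_mul_logDeriv_eq_neg hr (c := c) (η := y k)
    (A := fun z => logProd μ (Function.update y k z) 1)
    (N₁ := fun z => (∫ t in (0 : ℝ)..1, exp (logProd μ (Function.update y k z) t)) /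
      exp (logProd μ (Function.update y k z) 1))
    (N₂ := fun z => X + (1 - X) * ((∫ t in (0 : ℝ)..1, halfPlaneSum ν ζ t *
        exp (logProd μ (Function.update y k z) t)) /
      ∫ t in (0 : ℝ)..1, exp (logProd μ (Function.update y k z) t)))
    (J := fun z => X * (∫ t in (0 : ℝ)..1, exp (logProd μ (Function.update y k z) t)) +
      (1 - X) * ∫ t in (0 : ℝ)..1, halfPlaneSum ν ζ t *
        exp (logProd μ (Function.update y k z) t))
    hA (fun z hz => (hG z hz).differentiableAt.div (hA z hz).cexp (exp_ne_zero _))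
    (fun z hz => ((((hW z hz).differentiableAt.div (hG z hz).differentiableAt
      (hG0 z hz))).const_mul _).const_add _) hs
    (fun z hz => affine_average_mem_slitPlane hr hr1 hμ hμ1 hν hν1 hX.le hζ' (hup hz)) (hy k) ?_
    (((hG (y k) (hy' k)).const_mul X).add ((hW (y k) (hy' k)).const_mul (1 - X))) ?_
  · obtain ⟨q, hq, hq'⟩ := key
    refine ⟨q, hq, ?_⟩
    rw [← hq']
    simp only [Function.update_eq_self]
    have hlog' : ∀ t : ℂ, exp (logProd μ y t) =
        exp (-2 * ((μ k : ℂ) * log (1 - y k * t))) * exp (e t) := by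
      intro t
      rw [← exp_add, ← hlog, Function.update_eq_self]
    congr 3
    · have hk : ContinuousOn (fun t : ℝ => exp (-2 * ((μ k : ℂ) * log (1 - y k * t))) *
          (2 * μ k * t / (1 - y k * t))) (Icc 0 1) :=
        ((continuousOn_const.mul (continuousOn_const.mul (ContinuousOn.clog (by fun_prop)
          fun t ht => one_sub_mem_slitPlane (norm_mul_ofReal_lt_one hr1 (hy' k) ht)))).cexp).mul
          (ContinuousOn.div (by fun_prop) (by fun_prop)
            fun t ht => one_sub_ne_zero (norm_mul_ofReal_lt_one hr1 (hy' k) ht))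
      rw [← intervalIntegral.integral_const_mul, ← intervalIntegral.integral_const_mul,
        ← intervalIntegral.integral_add]
      · exact intervalIntegral.integral_congr fun t _ => by simp only [hlog']; ring
      · exact (continuousOn_const.mul (hec.mul hk)).intervalIntegrable_of_Icc zero_le_one
      · exact (continuousOn_const.mul
          ((hpc.mul hec).mul hk)).intervalIntegrable_of_Icc zero_le_one
    · rw [meanValue, integral_halfPlaneSum hr1 hζ' (continuousOn_logProd hr1 hy').cexp,
        radialTransform_zero]
      rfl
  · intro z hz
    have h1 : (∫ t in (0 : ℝ)..1, exp (logProd μ (Function.update y k z) t)) ≠ 0 := by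
      intro h; simp [h] at hz
    have := exp_ne_zero (logProd μ (Function.update y k z) 1)
    field_simp
  · intro z hz
    have := hmin X ζ (Function.update y k z) hX hζ (hup' hz)
    simpa [torusValue, logValue] using this

end Minimizer

/-! ### Coincidence of the points of a minimizer -/

section MinimizerReduction

variable {ι κ : Type*} [Fintype ι] [Fintype κ]
variable {r : ℝ} {μ : ι → ℝ} {ν : κ → ℝ} {X c : ℂ} {ζ : κ → ℂ} {y : ι → ℂ}
variable (hr : 0 < r) (hr1 : r < 1) (hμ : ∀ k, 0 ≤ μ k) (hμ1 : ∑ k, μ k = 1)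
  (hν : ∀ j, 0 ≤ ν j) (hν1 : ∑ j, ν j = 1)

/-- For distinct points of equal modulus, `x / (z - x)` lies on the line `Re = -1/2`. -/
theorem re_div_sub_of_norm_eq {x z : ℂ} (h : ‖x‖ = ‖z‖) (hne : x ≠ z) :
    (x / (z - x)).re = -1 / 2 := by
  have h0 : normSq (z - x) ≠ 0 := by
    rw [ne_eq, normSq_eq_zero, sub_eq_zero]; exact hne.symm
  have h1 : x.re ^ 2 + x.im ^ 2 = z.re ^ 2 + z.im ^ 2 := by
    have := congrArg (· ^ 2) h
    simp only [Complex.sq_norm, normSq_apply] at this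
    nlinarith
  rw [Complex.div_re, ← add_div, div_eq_iff h0, normSq_apply]
  simp only [sub_re, sub_im]
  nlinarith

theorem exists_pos_weight {α : Type*} [Fintype α] {w : α → ℝ} (h1 : ∑ i, w i = 1) :
    ∃ i, 0 < w i := by
  by_contra! hcon
  have := Finset.sum_nonpos fun i (_ : i ∈ Finset.univ) => hcon i
  linarith

theorem sum_weight_mul_of_eq {α : Type*} [Fintype α] {w : α → ℝ} (h0 : ∀ i, 0 ≤ w i)
    (h1 : ∑ i, w i = 1) {x : α → ℂ} {x₀ : ℂ} (hx : ∀ i, 0 < w i → x i = x₀) (f : ℂ → ℂ) :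
    ∑ i, (w i : ℂ) * f (x i) = f x₀ := by
  have : ∀ i, (w i : ℂ) * f (x i) = w i * f x₀ := fun i => by
    rcases (h0 i).eq_or_lt with h | h
    · simp [← h]
    · rw [hx i h]
  simp only [this, ← Finset.sum_mul]
  rw [← Complex.ofReal_sum, h1, ofReal_one, one_mul]

include hr hr1 hμ hμ1 in
theorem re_radialTransform_sub_div_pos (hy : ∀ k, ‖y k‖ ≤ r) {z η : ℂ} (hz : ‖z‖ = r)
    (hη : ‖η‖ ≤ r) (hne : η ≠ z) :
    0 < ((radialTransform μ y z - radialTransform μ y η) /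
      (z * ∫ t in (0 : ℝ)..1, t / (1 - z * t) ^ 2 * exp (logProd μ y t))).re :=
  re_separation_pos hr hr1 hμ hμ1 hy hz hη hne

include hr hr1 hμ hμ1 in
theorem radialTransform_ne_zero_point (hy : ∀ k, ‖y k‖ ≤ r) {z : ℂ} (hz : ‖z‖ = r) :
    radialTransform μ y z ≠ radialTransform μ y 0 := by
  intro h
  have := re_radialTransform_sub_div_pos hr hr1 hμ hμ1 hy hz (η := 0) (by simpa using hr.le)
    (by rintro rfl; simp at hz; linarith)
  simp [h] at this

include hr1 in
/-- The first variation in the exponent at `η`, expressed through `radialTransform` by partial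
fractions. -/
theorem mul_integral_exponent (hy : ∀ k, ‖y k‖ ≤ r) {z η m : ℂ} (hz : ‖z‖ ≤ r)
    (hη : ‖η‖ ≤ r) (hne : η ≠ z) :
    η * ∫ t in (0 : ℝ)..1, (X + (1 - X) * (1 / (1 - z * t))) *
        (exp (logProd μ y t) * (2 * m * t / (1 - η * t))) =
      2 * m * (X * (radialTransform μ y η - radialTransform μ y 0) +
        (1 - X) * (η / (z - η)) * (radialTransform μ y z - radialTransform μ y η)) := by
  have hi : ∀ w : ℂ, ‖w‖ ≤ r → IntervalIntegrable
      (fun t : ℝ => 1 / (1 - w * t) * exp (logProd μ y t)) MeasureTheory.volume 0 1 := fun w hw =>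
    ((continuousOn_one_div_one_sub hr1 hw).mul
      (continuousOn_logProd hr1 hy).cexp).intervalIntegrable_of_Icc zero_le_one
  have h0 : ‖(0 : ℂ)‖ ≤ r := by simpa using (norm_nonneg _).trans hz
  have hzη : z - η ≠ 0 := sub_ne_zero.2 hne.symm
  simp only [radialTransform]
  rw [← intervalIntegral.integral_sub (hi η hη) (hi 0 h0),
    ← intervalIntegral.integral_sub (hi z hz) (hi η hη), ← intervalIntegral.integral_const_mul,
    ← intervalIntegral.integral_const_mul, ← intervalIntegral.integral_const_mul,
    ← intervalIntegral.integral_add (((hi η hη).sub (hi 0 h0)).const_mul _)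
      (((hi z hz).sub (hi η hη)).const_mul _), ← intervalIntegral.integral_const_mul]
  refine intervalIntegral.integral_congr fun t ht => ?_
  rw [uIcc_of_le zero_le_one] at ht
  have h1 := one_sub_ne_zero (norm_mul_ofReal_lt_one hr1 hz ht)
  have h2 := one_sub_ne_zero (norm_mul_ofReal_lt_one hr1 hη ht)
  have h1' : 1 - (t : ℂ) * z ≠ 0 := by rwa [mul_comm]
  have h2' : 1 - (t : ℂ) * η ≠ 0 := by rwa [mul_comm]
  simp only [zero_mul, sub_zero]
  generalize exp (logProd μ y t) = g
  field_simp
  ring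

include hr hr1 hμ hμ1 hν hν1 in
/-- At a minimum the half-plane factor is not constant: for `X = 1` the points `ζⱼ` play no role and
may be moved to a point `yₖ`, where the two first-order conditions contradict each other. -/
theorem IsTorusMin.ne_one (hc : c ≠ 0) (h : IsTorusMin r μ ν c X ζ y) : X ≠ 1 := by
  rintro rfl
  obtain ⟨k, hk⟩ := exists_pos_weight hμ1
  have hy := h.1.2.2
  have hy' := fun j => (hy j).le
  have h' : IsTorusMin r μ ν c 1 (fun _ => y k) y := by
    refine ⟨⟨by simp, fun _ => hy k, hy⟩, fun X' ζ' y' h1 h2 h3 => ?_⟩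
    have e : torusValue μ ν 1 (fun _ : κ => y k) y = torusValue μ ν 1 ζ y := by
      simp [torusValue, logValue]
    rw [e]
    exact h.2 X' ζ' y' h1 h2 h3
  have hI : meanValue μ ν 1 (fun _ : κ => y k) y = radialTransform μ y 0 := by simp [meanValue]
  have h0 := radialTransform_zero_ne_zero hr hr1 hμ hμ1 hy'
  obtain ⟨p, hp, hp'⟩ := h'.condition_const hr hr1 hμ hμ1 hν hν1
  obtain ⟨q, hq, hq'⟩ := h'.condition_exponent hr hr1 hμ hμ1 hν hν1 k
  rw [hI, sum_weight_mul_of_eq hν hν1 (x₀ := y k) (fun _ _ => rfl), one_mul] at hp'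
  -- Any auxiliary pole `z ≠ yₖ` serves in the partial fraction identity, as `1 - X = 0`.
  have hne : y k ≠ 0 := by
    intro h0; have := hy k; rw [h0] at this; simp at this; linarith
  have e := mul_integral_exponent (X := 1) (μ := μ) hr1 hy' (z := 0) (m := (μ k : ℂ))
    (by simpa using hr.le) (hy' k) hne
  rw [hI, ← mul_div_assoc, mul_left_comm] at hq'
  simp only [sub_self, zero_mul, add_zero, one_mul] at e hq'
  rw [e] at hq'
  have hsum : (((2 * μ k) * p + q : ℝ) : ℂ) = 0 := by
    push_cast
    linear_combination (2 * (μ k : ℂ)) * hp' + hq'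
  have hsum' : (2 * μ k) * p + q = 0 := by exact_mod_cast hsum
  have hp0 : p = 0 := by nlinarith
  rw [hp0, ofReal_zero, neg_zero, div_eq_zero_iff, mul_eq_zero] at hp'
  rcases hp' with (hp' | hp') | hp'
  · exact hc hp'
  · exact radialTransform_ne_zero_point hr hr1 hμ hμ1 hy' (hy k) (sub_eq_zero.1 hp').symm
  · exact h0 hp'

include hr hr1 hμ hμ1 hν hν1 in
/-- At a minimum each active point `ζⱼ` is the strict minimum over the disk of the real part of the
linear functional given by the half-plane kernels. -/
theorem IsTorusMin.re_sub_pos (hc : c ≠ 0) (h : IsTorusMin r μ ν c X ζ y) {j : κ} (hj : 0 < ν j)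
    {η : ℂ} (hη : ‖η‖ ≤ r) (hne : η ≠ ζ j) :
    0 < ((1 - X) * c / meanValue μ ν X ζ y *
      (radialTransform μ y η - radialTransform μ y (ζ j))).re := by
  have hX := h.ne_one hr hr1 hμ hμ1 hν hν1 hc
  have hζ' := fun j => (h.1.2.1 j).le
  have hy' := fun j => (h.1.2.2 j).le
  have hI := meanValue_ne_zero hr hr1 hμ hμ1 hν hν1 h.1.1.le hζ' hy'
  obtain ⟨p, hp, hp'⟩ := h.condition_pole hr hr1 hμ hμ1 hν hν1 j
  have hsep := re_radialTransform_sub_div_pos hr hr1 hμ hμ1 hy' (h.1.2.1 j) hη hne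
  set E := ζ j * ∫ t in (0 : ℝ)..1, t / (1 - ζ j * t) ^ 2 * exp (logProd μ y t) with hE
  have hE0 : E ≠ 0 := by
    intro h0; rw [h0] at hsep; simp at hsep
  set a := (1 - X) * c / meanValue μ ν X ζ y with ha
  have ha0 : a ≠ 0 := div_ne_zero (mul_ne_zero (sub_ne_zero.2 hX.symm) hc) hI
  have hν0 : (ν j : ℂ) ≠ 0 := by exact_mod_cast hj.ne'
  have hpe : a * E = -((p / ν j : ℝ) : ℂ) := by
    push_cast
    rw [← neg_div, ← hp', hE, ha]
    field_simp
  have hp0 : p ≠ 0 := by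
    rintro rfl
    simp at hpe
    exact hpe.elim ha0 hE0
  have e : a * (radialTransform μ y η - radialTransform μ y (ζ j)) = ((p / ν j : ℝ) : ℂ) *
      ((radialTransform μ y (ζ j) - radialTransform μ y η) / E) := by
    have : ((p / ν j : ℝ) : ℂ) = -(a * E) := by rw [hpe, neg_neg]
    rw [this]
    field_simp
    ring
  rw [e, re_ofReal_mul]
  have : 0 < p := lt_of_le_of_ne hp hp0.symm
  positivity

include hr hr1 hμ hμ1 hν hν1 in
/-- All active points of the half-plane sum coincide, since each is a strict minimum. -/
theorem IsTorusMin.pole_eq (hc : c ≠ 0) (h : IsTorusMin r μ ν c X ζ y) {i j : κ} (hi : 0 < ν i)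
    (hj : 0 < ν j) : ζ i = ζ j := by
  by_contra hne
  have h1 := h.re_sub_pos hr hr1 hμ hμ1 hν hν1 hc hj (h.1.2.1 i).le hne
  have h2 := h.re_sub_pos hr hr1 hμ hμ1 hν hν1 hc hi (h.1.2.1 j).le (Ne.symm hne)
  rw [← neg_sub (radialTransform μ y (ζ i)), mul_neg, neg_re] at h2
  linarith

include hr hr1 hμ hμ1 hν hν1 in
/-- At a minimum the active exponents sit at the active pole. Otherwise the conditions in `X` and
`yₖ` combine to `D * w = -(p + q / (2 μₖ))`, where `p, q ≥ 0` come from these conditions,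
`Re D > 0` by the separation property, and `w` is imaginary because the points involved have equal
moduli. So `w = 0` and `p = 0`, and the latter contradicts the separation of `ζⱼ` from the
origin. -/
theorem IsTorusMin.exponent_eq (hc : c ≠ 0) (h : IsTorusMin r μ ν c X ζ y) {k : ι} (hk : 0 < μ k)
    {j : κ} (hj : 0 < ν j) : y k = ζ j := by
  by_contra hne
  have hX := h.ne_one hr hr1 hμ hμ1 hν hν1 hc
  have hX' : 1 - X ≠ 0 := sub_ne_zero.2 hX.symm
  have hζ' := fun j => (h.1.2.1 j).le
  have hy' := fun j => (h.1.2.2 j).le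
  have hI := meanValue_ne_zero hr hr1 hμ hμ1 hν hν1 h.1.1.le hζ' hy'
  have hpole : ∀ i, 0 < ν i → ζ i = ζ j := fun i hi => h.pole_eq hr hr1 hμ hμ1 hν hν1 hc hi hj
  obtain ⟨p, hp, hp'⟩ := h.condition_const hr hr1 hμ hμ1 hν hν1
  obtain ⟨q, hq, hq'⟩ := h.condition_exponent hr hr1 hμ hμ1 hν hν1 k
  rw [sum_weight_mul_of_eq hν hν1 hpole] at hp'
  have hhalf : ∀ t : ℂ, halfPlaneSum ν ζ t = 1 / (1 - ζ j * t) := fun t =>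
    sum_weight_mul_of_eq hν hν1 hpole fun z => 1 / (1 - z * t)
  simp only [hhalf] at hq'
  rw [← mul_div_assoc, mul_left_comm, mul_integral_exponent hr1 hy' (hζ' j) (hy' k) hne] at hq'
  have hD := h.re_sub_pos hr hr1 hμ hμ1 hν hν1 hc hj (hy' k) hne
  have hD0 := h.re_sub_pos hr hr1 hμ hμ1 hν hν1 hc hj (η := 0) (by simpa using hr.le)
    (by intro h0; have := h.1.2.1 j; rw [← h0] at this; simp at this; linarith)
  set I := meanValue μ ν X ζ y
  set D := (1 - X) * c / I * (radialTransform μ y (y k) - radialTransform μ y (ζ j)) with hDdef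
  set w := X / (1 - X) - y k / (ζ j - y k) with hw
  have hwre : w.re = 0 := by
    rw [hw, sub_re, re_div_sub_of_norm_eq (by rw [h.1.1, norm_one]) hX,
      re_div_sub_of_norm_eq (by rw [h.1.2.2 k, h.1.2.1 j]) hne, sub_self]
  have hsub : ζ j - y k ≠ 0 := sub_ne_zero.2 (Ne.symm hne)
  have hDw : D * w = -((p + q / (2 * μ k) : ℝ) : ℂ) := by
    have hμ0 : (μ k : ℂ) ≠ 0 := by exact_mod_cast hk.ne'
    have e1 : (q : ℂ) / (2 * μ k) = -(c * (X * (radialTransform μ y (y k) - radialTransform μ y 0) +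
        (1 - X) * (y k / (ζ j - y k)) *
          (radialTransform μ y (ζ j) - radialTransform μ y (y k))) / I) := by
      rw [div_eq_iff (by simpa using hμ0)]
      linear_combination hq'
    push_cast
    rw [e1, show (p : ℂ) = -(X * (c * (radialTransform μ y 0 - radialTransform μ y (ζ j)) / I)) by
      rw [hp', neg_neg], hDdef, hw]
    field_simp
    ring
  have him : D.re * w.im = 0 := by
    have := congrArg Complex.im hDw
    rwa [mul_im, hwre, mul_zero, add_zero, neg_im, ofReal_im, neg_zero] at this
  have hw0 : w = 0 := Complex.ext hwre ((mul_eq_zero.1 him).resolve_left hD.ne')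
  rw [hw0, mul_zero, eq_comm, neg_eq_zero] at hDw
  have hDw' : p + q / (2 * μ k) = 0 := by exact_mod_cast hDw
  have hp0 : p = 0 := by
    have : 0 ≤ q / (2 * μ k) := by positivity
    linarith
  have hX0 : X ≠ 0 := by rintro rfl; simpa using h.1.1
  rw [hp0] at hp'
  have : (1 - X) * c / I * (radialTransform μ y 0 - radialTransform μ y (ζ j)) = 0 := by
    have e : c * (radialTransform μ y 0 - radialTransform μ y (ζ j)) / I = 0 := by
      simpa [hX0] using hp'
    rw [show (1 - X) * c / I * (radialTransform μ y 0 - radialTransform μ y (ζ j)) =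
      (1 - X) * (c * (radialTransform μ y 0 - radialTransform μ y (ζ j)) / I) by ring, e, mul_zero]
  rw [this] at hD0
  simp at hD0

end MinimizerReduction

/-! ### Reduction to the extremal functions -/

/-- The branch of `log (f z / z)` for the close-to-convex function with
`f' = (1 - xz) / (1 - yz)³`, where `u = 1 - xz` and `v = 1 - yz`. -/
noncomputable def extremalLog (u v : ℂ) : ℂ := -log v + log ((u + v) / (2 * v))

theorem exp_neg_two_mul_log {w : ℂ} (hw : w ≠ 0) : exp (-2 * log w) = 1 / w ^ 2 := by
  rw [show -2 * log w = -(log w + log w) by ring, exp_neg, exp_add, exp_log hw, one_div, sq]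

/-- If all points coincide at `ζ`, the integrals are elementary, with primitives
`t / (1 - ζt)` and `(t - ζt² / 2) / (1 - ζt)²`. -/
theorem logValue_extremal {X ζ : ℂ} (hζ : ‖ζ‖ < 1) :
    logValue X (fun t => -2 * log (1 - ζ * t)) (fun t => 1 / (1 - ζ * t)) =
      extremalLog (1 - X * ζ) (1 - ζ) := by
  have hne : ∀ t ∈ Icc (0 : ℝ) 1, 1 - ζ * t ≠ 0 := fun t ht =>
    one_sub_ne_zero (norm_mul_ofReal_lt_one hζ le_rfl ht)
  have hv := one_sub_ne_zero hζ
  have hd : ∀ t : ℝ, HasDerivAt (fun t : ℝ => 1 - ζ * (t : ℂ)) (-ζ) t := fun t => by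
    simpa using ((Complex.ofRealCLM.hasDerivAt (x := t)).const_mul ζ).const_sub 1
  have hid : ∀ t : ℝ, HasDerivAt (fun t : ℝ => (t : ℂ)) 1 t := fun t =>
    Complex.ofRealCLM.hasDerivAt
  have h2 : ∫ t in (0 : ℝ)..1, exp (-2 * log (1 - ζ * t)) = 1 / (1 - ζ) := by
    have e : ∀ t ∈ uIcc (0 : ℝ) 1, HasDerivAt (fun t : ℝ => (t : ℂ) / (1 - ζ * t))
        (exp (-2 * log (1 - ζ * t))) t := by
      intro t ht
      rw [uIcc_of_le zero_le_one] at ht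
      have h0 := hne t ht
      refine ((hid t).div (hd t) h0).congr_deriv ?_
      rw [exp_neg_two_mul_log h0]
      congr 1
      ring
    rw [intervalIntegral.integral_eq_sub_of_hasDerivAt e]
    · simp
    · refine ContinuousOn.intervalIntegrable_of_Icc zero_le_one ?_
      exact (continuousOn_const.mul (ContinuousOn.clog (by fun_prop) fun t ht =>
        one_sub_mem_slitPlane (norm_mul_ofReal_lt_one hζ le_rfl ht))).cexp
  have h3 : ∫ t in (0 : ℝ)..1, 1 / (1 - ζ * t) * exp (-2 * log (1 - ζ * t)) =
      (1 - ζ / 2) / (1 - ζ) ^ 2 := by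
    have e : ∀ t ∈ uIcc (0 : ℝ) 1, HasDerivAt
        (fun t : ℝ => ((t : ℂ) - ζ / 2 * t ^ 2) / (1 - ζ * t) ^ 2)
        (1 / (1 - ζ * t) * exp (-2 * log (1 - ζ * t))) t := by
      intro t ht
      rw [uIcc_of_le zero_le_one] at ht
      have h0 := hne t ht
      have hn : HasDerivAt (fun t : ℝ => (t : ℂ) - ζ / 2 * t ^ 2)
          (1 - ζ / 2 * (2 * (t : ℂ) ^ 1 * 1)) t := by
        simpa using (hid t).fun_sub (((hid t).fun_pow 2).const_mul (ζ / 2))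
      have hp : HasDerivAt (fun t : ℝ => (1 - ζ * (t : ℂ)) ^ 2)
          (2 * (1 - ζ * t) ^ 1 * (-ζ)) t := by
        simpa using (hd t).fun_pow 2
      refine (hn.div hp (pow_ne_zero 2 h0)).congr_deriv ?_
      rw [exp_neg_two_mul_log h0]
      have h0' : 1 - (t : ℂ) * ζ ≠ 0 := by rwa [mul_comm]
      field_simp
      ring
    rw [intervalIntegral.integral_eq_sub_of_hasDerivAt e]
    · simp
    · refine ContinuousOn.intervalIntegrable_of_Icc zero_le_one ?_
      exact (continuousOn_const.div (by fun_prop) hne).mul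
        (continuousOn_const.mul (ContinuousOn.clog (by fun_prop) fun t ht =>
        one_sub_mem_slitPlane (norm_mul_ofReal_lt_one hζ le_rfl ht))).cexp
  rw [logValue, h2, h3, extremalLog, ofReal_one, mul_one, exp_neg_two_mul_log hv]
  have e1 : 1 / (1 - ζ) / (1 / (1 - ζ) ^ 2) = 1 - ζ := by field_simp
  have e2 : X + (1 - X) * ((1 - ζ / 2) / (1 - ζ) ^ 2 / (1 / (1 - ζ))) =
      (1 - X * ζ + (1 - ζ)) / (2 * (1 - ζ)) := by
    field_simp
    ring
  rw [e1, e2]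
  ring

open Function in
theorem continuousOn_torusValue {ι κ : Type*} [Fintype ι] [Fintype κ] {r : ℝ} {μ : ι → ℝ}
    {ν : κ → ℝ} (hr : 0 < r) (hr1 : r < 1) (hμ : ∀ k, 0 ≤ μ k) (hμ1 : ∑ k, μ k = 1)
    (hν : ∀ j, 0 ≤ ν j) (hν1 : ∑ j, ν j = 1) {S : Set (ℂ × (κ → ℂ) × (ι → ℂ))}
    (hS : ∀ p ∈ S, ‖p.1‖ = 1 ∧ (∀ j, ‖p.2.1 j‖ = r) ∧ ∀ k, ‖p.2.2 k‖ = r) :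
    ContinuousOn (fun p => torusValue μ ν p.1 p.2.1 p.2.2) S := by
  have hg : ContinuousOn (uncurry fun (p : ℂ × (κ → ℂ) × (ι → ℂ)) (t : ℝ) => logProd μ p.2.2 t)
      (S ×ˢ Icc 0 1) := by
    unfold logProd uncurry
    refine continuousOn_const.mul (continuousOn_finsetSum _ fun k _ => continuousOn_const.mul ?_)
    exact ContinuousOn.clog (by fun_prop) fun q hq => one_sub_mem_slitPlane
      (norm_mul_ofReal_lt_one hr1 ((hS _ hq.1).2.2 k).le hq.2)
  have hp : ContinuousOn (uncurry fun (p : ℂ × (κ → ℂ) × (ι → ℂ)) (t : ℝ) =>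
      halfPlaneSum ν p.2.1 t) (S ×ˢ Icc 0 1) := by
    unfold halfPlaneSum uncurry
    refine continuousOn_finsetSum _ fun j _ => continuousOn_const.mul ?_
    exact ContinuousOn.div (by fun_prop) (by fun_prop) fun q hq => one_sub_ne_zero
      (norm_mul_ofReal_lt_one hr1 ((hS _ hq.1).2.1 j).le hq.2)
  have hG : ContinuousOn (fun p : ℂ × (κ → ℂ) × (ι → ℂ) =>
      ∫ t in (0 : ℝ)..1, exp (logProd μ p.2.2 t)) S := continuousOn_integral_unit hg.cexp
  have hW : ContinuousOn (fun p : ℂ × (κ → ℂ) × (ι → ℂ) =>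
      ∫ t in (0 : ℝ)..1, halfPlaneSum ν p.2.1 t * exp (logProd μ p.2.2 t)) S :=
    continuousOn_integral_unit (hp.mul hg.cexp)
  have hg1 : ContinuousOn (fun p : ℂ × (κ → ℂ) × (ι → ℂ) => logProd μ p.2.2 ((1 : ℝ) : ℂ)) S :=
    hg.comp (f := fun p => (p, (1 : ℝ))) (by fun_prop) fun p hp => ⟨hp, by simp⟩
  have hs : ∀ p ∈ S, (∫ t in (0 : ℝ)..1, exp (logProd μ p.2.2 t)) /
      exp (logProd μ p.2.2 ((1 : ℝ) : ℂ)) ∈ slitPlane := fun p hp => by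
    simpa using integral_logProd_mem_slitPlane hr hr1 hμ hμ1 fun k => ((hS p hp).2.2 k).le
  have h0 : ∀ p ∈ S, (∫ t in (0 : ℝ)..1, exp (logProd μ p.2.2 t)) ≠ 0 := fun p hp h0 => by
    have := hs p hp
    simp [h0] at this
  have hX : ContinuousOn (fun p : ℂ × (κ → ℂ) × (ι → ℂ) => p.1) S := continuousOn_fst
  have h1 := (hG.div hg1.cexp fun _ _ => exp_ne_zero _).clog hs
  have h2 := (hX.add ((continuousOn_const (c := (1 : ℂ)).sub hX).mul (hW.div hG h0))).clog
    fun p hp => affine_average_mem_slitPlane hr hr1 hμ hμ1 hν hν1 (hS p hp).1.le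
        (fun j => ((hS p hp).2.1 j).le) (fun k => ((hS p hp).2.2 k).le)
  exact (hg1.add h1).add h2

/-- A lower bound for the functional on the two-parameter family of extremal functions carries over
to all products and half-plane sums: a minimizer on the torus has all its points in one place. -/
theorem le_torusValue_of_extremal {ι κ : Type*} [Fintype ι] [Fintype κ] {r m : ℝ} {μ : ι → ℝ}
    {ν : κ → ℝ} (hr : 0 < r) (hr1 : r < 1) (hμ : ∀ k, 0 ≤ μ k) (hμ1 : ∑ k, μ k = 1)
    (hν : ∀ j, 0 ≤ ν j) (hν1 : ∑ j, ν j = 1) {c : ℂ} (hc : c ≠ 0)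
    (hm : ∀ X ζ : ℂ, ‖X‖ = 1 → ‖ζ‖ = r → m ≤ (c * extremalLog (1 - X * ζ) (1 - ζ)).re)
    {X : ℂ} {ζ : κ → ℂ} {y : ι → ℂ} (hX : ‖X‖ = 1) (hζ : ∀ j, ‖ζ j‖ = r) (hy : ∀ k, ‖y k‖ = r) :
    m ≤ (c * torusValue μ ν X ζ y).re := by
  set S : Set (ℂ × (κ → ℂ) × (ι → ℂ)) := sphere (0 : ℂ) 1 ×ˢ
    ((univ.pi fun _ => sphere (0 : ℂ) r) ×ˢ (univ.pi fun _ => sphere (0 : ℂ) r)) with hS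
  have hScomp : IsCompact S := (isCompact_sphere _ _).prod
    ((isCompact_univ_pi fun _ => isCompact_sphere _ _).prod
      (isCompact_univ_pi fun _ => isCompact_sphere _ _))
  have hmem : ∀ p : ℂ × (κ → ℂ) × (ι → ℂ), p ∈ S ↔
      ‖p.1‖ = 1 ∧ (∀ j, ‖p.2.1 j‖ = r) ∧ ∀ k, ‖p.2.2 k‖ = r := by
    intro p; simp [hS, mem_prod]
  have hcont : ContinuousOn (fun p : ℂ × (κ → ℂ) × (ι → ℂ) =>
      (c * torusValue μ ν p.1 p.2.1 p.2.2).re) S :=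
    Complex.continuous_re.comp_continuousOn (continuousOn_const.mul
      (continuousOn_torusValue hr hr1 hμ hμ1 hν hν1 fun p hp => (hmem p).1 hp))
  obtain ⟨p, hpS, hpmin'⟩ := hScomp.exists_isMinOn ⟨(X, ζ, y), (hmem _).2 ⟨hX, hζ, hy⟩⟩ hcont
  have hpmin := isMinOn_iff.1 hpmin'
  have hmin : IsTorusMin r μ ν c p.1 p.2.1 p.2.2 := ⟨(hmem p).1 hpS,
    fun X' ζ' y' h1 h2 h3 => hpmin (X', ζ', y') ((hmem (X', ζ', y')).2 ⟨h1, h2, h3⟩)⟩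
  obtain ⟨j, hj⟩ := exists_pos_weight hν1
  have e1 : ∀ t : ℂ, logProd μ p.2.2 t = -2 * log (1 - p.2.1 j * t) := fun t => by
    rw [logProd, sum_weight_mul_of_eq hμ hμ1 (fun k hk =>
      hmin.exponent_eq hr hr1 hμ hμ1 hν hν1 hc hk hj) fun z => log (1 - z * t)]
  have e2 : ∀ t : ℂ, halfPlaneSum ν p.2.1 t = 1 / (1 - p.2.1 j * t) := fun t =>
    sum_weight_mul_of_eq hν hν1 (fun i hi => hmin.pole_eq hr hr1 hμ hμ1 hν hν1 hc hi hj)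
      fun z => 1 / (1 - z * t)
  have e3 : torusValue μ ν p.1 p.2.1 p.2.2 = extremalLog (1 - p.1 * p.2.1 j) (1 - p.2.1 j) := by
    simp only [torusValue, e1, e2]
    exact logValue_extremal ((hmin.1.2.1 j).le.trans_lt hr1)
  calc m ≤ _ := hm p.1 (p.2.1 j) hmin.1.1 (hmin.1.2.1 j)
    _ = (c * torusValue μ ν p.1 p.2.1 p.2.2).re := by rw [e3]
    _ ≤ _ := hpmin (X, ζ, y) ((hmem (X, ζ, y)).2 ⟨hX, hζ, hy⟩)

/-! ### Approximation by finite products and sums -/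

open MeasureTheory in
/-- Riemann sums for a continuous kernel against a probability density, with one and the same choice
of weights and nodes for all values of the parameter `s`. -/
theorem exists_finite_convex_approx {a b : ℝ} (hab : a < b) {w : ℝ → ℝ}
    (hw : ContinuousOn w (Icc a b)) (hw0 : ∀ θ ∈ Icc a b, 0 ≤ w θ) (hw1 : ∫ θ in a..b, w θ = 1)
    {κ : ℝ → ℝ → ℂ} (hκ : ContinuousOn (Function.uncurry κ) (Icc a b ×ˢ Icc 0 1)) {ε : ℝ}
    (hε : 0 < ε) :
    ∃ (n : ℕ) (μ θ : Fin n → ℝ), (∀ i, 0 ≤ μ i) ∧ ∑ i, μ i = 1 ∧ (∀ i, θ i ∈ Icc a b) ∧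
      ∀ s ∈ Icc (0 : ℝ) 1,
        ‖(∫ θ in a..b, (w θ : ℂ) * κ θ s) - ∑ i, (μ i : ℂ) * κ (θ i) s‖ ≤ ε := by
  have huc := (isCompact_Icc.prod isCompact_Icc).uniformContinuousOn_of_continuous hκ
  obtain ⟨δ, hδ, hunif⟩ := Metric.uniformContinuousOn_iff.1 huc ε hε
  obtain ⟨N, hN⟩ := exists_nat_gt ((b - a) / δ)
  have hNpos : (0 : ℝ) < N := lt_of_le_of_lt (div_nonneg (by linarith) hδ.le) hN
  have hstep : (b - a) / N < δ := by
    rw [div_lt_iff₀ hNpos]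
    rw [div_lt_iff₀ hδ] at hN
    linarith
  set p : ℕ → ℝ := fun k => a + k * ((b - a) / N) with hp
  have hd : 0 ≤ (b - a) / N := div_nonneg (by linarith) hNpos.le
  have hp0 : p 0 = a := by simp [hp]
  have hpN : p N = b := by simp only [hp]; field_simp; ring
  have hple : ∀ k, p k ≤ p (k + 1) := fun k => by simp only [hp]; push_cast; nlinarith
  have hmono : Monotone p := monotone_nat_of_le_succ hple
  have hsub : ∀ k < N, Icc (p k) (p (k + 1)) ⊆ Icc a b := fun k hk => by
    rw [← hp0, ← hpN]
    exact Icc_subset_Icc (hmono (Nat.zero_le k)) (hmono hk)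
  have hwi : ∀ k < N, IntervalIntegrable w volume (p k) (p (k + 1)) := fun k hk =>
    (hw.mono (hsub k hk)).intervalIntegrable_of_Icc (hple k)
  have hκs : ∀ s ∈ Icc (0 : ℝ) 1, ContinuousOn (fun θ => κ θ s) (Icc a b) := fun s hs =>
    hκ.comp (f := fun θ : ℝ => (θ, s)) (by fun_prop) fun θ hθ => ⟨hθ, hs⟩
  have hwc : ContinuousOn (fun θ => (w θ : ℂ)) (Icc a b) :=
    Complex.continuous_ofReal.comp_continuousOn hw
  have hwκi : ∀ s ∈ Icc (0 : ℝ) 1, ∀ k < N,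
      IntervalIntegrable (fun θ => (w θ : ℂ) * κ θ s) volume (p k) (p (k + 1)) := fun s hs k hk =>
    ((hwc.mul (hκs s hs)).mono (hsub k hk)).intervalIntegrable_of_Icc (hple k)
  have hnn : ∀ k < N, 0 ≤ ∫ θ in p k..p (k + 1), w θ := fun k hk =>
    intervalIntegral.integral_nonneg (hple k) fun θ hθ => hw0 θ (hsub k hk hθ)
  have hsum : ∑ k ∈ Finset.range N, ∫ θ in p k..p (k + 1), w θ = 1 := by
    rw [intervalIntegral.sum_integral_adjacent_intervals hwi, hp0, hpN, hw1]
  refine ⟨N, fun i => ∫ θ in p i..p (i + 1), w θ, fun i => p i, fun i => hnn i i.2, ?_,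
    fun i => hsub i i.2 (left_mem_Icc.2 (hple i)), fun s hs => ?_⟩
  · rw [Fin.sum_univ_eq_sum_range (fun k => ∫ θ in p k..p (k + 1), w θ), hsum]
  · rw [Fin.sum_univ_eq_sum_range (fun k => ((∫ θ in p k..p (k + 1), w θ : ℝ) : ℂ) * κ (p k) s)]
    nth_rewrite 1 [← hp0, ← hpN]
    rw [← intervalIntegral.sum_integral_adjacent_intervals (hwκi s hs), ← Finset.sum_sub_distrib]
    refine (norm_sum_le_of_le _ (f := fun k => _) (n := fun k => (∫ θ in p k..p (k + 1), w θ) * ε)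
      fun k hk => ?_).trans ?_
    · have hk := Finset.mem_range.1 hk
      have hwci : IntervalIntegrable (fun θ => (w θ : ℂ) * κ (p k) s) volume (p k) (p (k + 1)) :=
        ((hwc.mul continuousOn_const).mono (hsub k hk)).intervalIntegrable_of_Icc (hple k)
      rw [← intervalIntegral.integral_ofReal, ← intervalIntegral.integral_mul_const,
        ← intervalIntegral.integral_sub (hwκi s hs k hk) hwci,
        ← intervalIntegral.integral_mul_const]
      refine intervalIntegral.norm_integral_le_of_norm_le (hple k) ?_ ((hwi k hk).mul_const ε)
      refine Filter.Eventually.of_forall fun θ hθ => ?_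
      have hθ' : θ ∈ Icc a b := hsub k hk (Ioc_subset_Icc_self hθ)
      rw [← mul_sub, norm_mul, Complex.norm_real, Real.norm_of_nonneg (hw0 θ hθ')]
      refine mul_le_mul_of_nonneg_left ?_ (hw0 θ hθ')
      rw [← dist_eq_norm]
      refine (hunif (θ, s) ⟨hθ', hs⟩ (p k, s)
        ⟨hsub k hk (left_mem_Icc.2 (hple k)), hs⟩ ?_).le
      rw [Prod.dist_eq, dist_self, max_eq_left dist_nonneg, Real.dist_eq,
        abs_of_nonneg (by linarith [hθ.1])]
      have : p (k + 1) = p k + (b - a) / N := by simp only [hp]; push_cast; ring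
      linarith [hθ.2]
    · rw [← Finset.sum_mul, hsum, one_mul]

open Real in
/-- The Schwarz integral formula on the unit circle, for a function with value `1` at the origin and
the kernel `1 / (1 - z / w)`. -/
theorem circleAverage_re_mul_kernel {h : ℂ → ℂ} (hh : DiffContOnCl ℂ h (ball 0 1)) (h0 : h 0 = 1)
    {z : ℂ} (hz : ‖z‖ < 1) :
    circleAverage (fun w => ((h w).re : ℂ) * (1 / (1 - z / w))) 0 1 = (h z + 1) / 2 := by
  have hne : ∀ {w : ℂ}, ‖w‖ = 1 → w ≠ 0 ∧ w - z ≠ 0 := fun {w} hw => by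
    refine ⟨by rintro rfl; simp at hw, sub_ne_zero.2 ?_⟩
    rintro rfl
    linarith
  have hcirc : ContinuousOn h (sphere 0 1) := hh.continuousOn.mono (by
    rw [closure_ball _ one_ne_zero]; exact sphere_subset_closedBall)
  have hsph : ∀ {w : ℂ}, w ∈ sphere (0 : ℂ) |1| → ‖w‖ = 1 := fun hw => by simpa using hw
  -- The Cauchy average of `h`.
  have e1 : circleAverage (fun w => h w * (1 / (1 - z / w))) 0 1 = h z := by
    rw [← DiffContOnCl.circleAverage_smul_div (f := h) (c := 0) (R := 1) (by simpa using hh)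
      (by simpa using hz)]
    refine circleAverage_congr_sphere fun w hw => ?_
    obtain ⟨h1, h2⟩ := hne (hsph hw)
    simp only [sub_zero, smul_eq_mul]
    field_simp
  -- The Cauchy average of the conjugate is the conjugate of a mean value at the origin.
  have hconj0 : ∀ w : ℂ, ‖w‖ ≤ 1 → 1 - starRingEnd ℂ z * w ≠ 0 := fun w hw =>
    one_sub_ne_zero (by
      rw [norm_mul, RCLike.norm_conj]
      nlinarith [norm_nonneg z, norm_nonneg w])
  have e2 : circleAverage (fun w => h w * (1 / (1 - starRingEnd ℂ z * w))) 0 1 = 1 := by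
    have hd : DiffContOnCl ℂ (fun w => h w * (1 / (1 - starRingEnd ℂ z * w))) (ball 0 1) := by
      refine ⟨hh.differentiableOn.mul (DifferentiableOn.fun_div (by fun_prop) (by fun_prop)
        fun w hw => hconj0 w (mem_ball_zero_iff.1 hw).le), hh.continuousOn.mul
        (ContinuousOn.div (by fun_prop) (by fun_prop) fun w hw => hconj0 w ?_)⟩
      rw [closure_ball _ one_ne_zero] at hw
      simpa using hw
    have := DiffContOnCl.circleAverage (f := fun w => h w * (1 / (1 - starRingEnd ℂ z * w)))
      (c := 0) (R := 1) (by simpa using hd)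
    rw [this]
    simp [h0]
  have e3 : circleAverage (fun w => starRingEnd ℂ (h w * (1 / (1 - starRingEnd ℂ z * w)))) 0 1
      = 1 := by
    rw [circleAverage_def] at e2 ⊢
    rw [intervalIntegral.integral_of_le Real.two_pi_pos.le] at e2 ⊢
    rw [integral_conj]
    have := congrArg (starRingEnd ℂ) e2
    simpa only [real_smul, map_mul, conj_ofReal, map_one] using this
  have hci1 : CircleIntegrable (fun w => h w * (1 / (1 - z / w))) 0 1 := by
    refine ContinuousOn.circleIntegrable zero_le_one (hcirc.mul
      (ContinuousOn.div (by fun_prop) (continuousOn_const.sub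
        (ContinuousOn.div (by fun_prop) (by fun_prop) fun w hw => (hne (by simpa using hw)).1))
        fun w hw => ?_))
    obtain ⟨h1, h2⟩ := hne (w := w) (by simpa using hw)
    rw [one_sub_div h1]
    exact div_ne_zero h2 h1
  have hci2 : CircleIntegrable
      (fun w => starRingEnd ℂ (h w * (1 / (1 - starRingEnd ℂ z * w)))) 0 1 := by
    refine ContinuousOn.circleIntegrable zero_le_one
      (Complex.continuous_conj.comp_continuousOn (hcirc.mul
        (ContinuousOn.div (by fun_prop) (by fun_prop) fun w hw => hconj0 w ?_)))
    exact (by simpa using hw : ‖w‖ = 1).le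
  have e4 : circleAverage (fun w => ((h w).re : ℂ) * (1 / (1 - z / w))) 0 1 =
      circleAverage (fun w => (1 / 2 : ℂ) • (h w * (1 / (1 - z / w)) +
        starRingEnd ℂ (h w * (1 / (1 - starRingEnd ℂ z * w))))) 0 1 := by
    refine circleAverage_congr_sphere fun w hw => ?_
    obtain ⟨h1, h2⟩ := hne (hsph hw)
    have hw1 : w * starRingEnd ℂ w = 1 := by
      rw [mul_conj, normSq_eq_norm_sq, hsph hw]; simp
    have hk : starRingEnd ℂ (1 / (1 - starRingEnd ℂ z * w)) = 1 / (1 - z / w) := by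
      rw [map_div₀, map_sub, map_mul, conj_conj, map_one]
      congr 2
      rw [eq_div_iff h1]
      linear_combination z * hw1
    simp only [map_mul, hk, smul_eq_mul]
    have hre : ((h w).re : ℂ) = (h w + starRingEnd ℂ (h w)) / 2 := by
      rw [add_conj]; push_cast; ring
    rw [hre]
    ring
  rw [e4]
  have := circleAverage_fun_smul (𝕜 := ℂ) (a := (1 / 2 : ℂ)) (c := 0) (R := 1)
    (f := fun w => h w * (1 / (1 - z / w)) +
        starRingEnd ℂ (h w * (1 / (1 - starRingEnd ℂ z * w))))
  rw [this, circleAverage_fun_add hci1 hci2, e1, e3, smul_eq_mul]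
  ring

open Real in
/-- The Herglotz measure of `h` is approximated by finite measures, uniformly for the kernels
`y ↦ κ y s` with `0 ≤ s ≤ 1`. -/
theorem exists_finite_kernel_approx {h : ℂ → ℂ} (hh : DiffContOnCl ℂ h (ball 0 1)) (h0 : h 0 = 1)
    (hpos : ∀ w, ‖w‖ = 1 → 0 ≤ (h w).re) {z : ℂ} {κ : ℂ → ℝ → ℂ}
    (hκ : ContinuousOn (Function.uncurry κ) (closedBall 0 ‖z‖ ×ˢ Icc 0 1)) {ε : ℝ} (hε : 0 < ε) :
    ∃ (n : ℕ) (μ : Fin n → ℝ) (y : Fin n → ℂ), (∀ i, 0 ≤ μ i) ∧ ∑ i, μ i = 1 ∧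
      (∀ i, ‖y i‖ = ‖z‖) ∧ ∀ s ∈ Icc (0 : ℝ) 1,
        ‖circleAverage (fun w => ((h w).re : ℂ) * κ (z / w) s) 0 1
          - ∑ i, (μ i : ℂ) * κ (y i) s‖ ≤ ε := by
  have hnorm : ∀ θ, ‖circleMap 0 1 θ‖ = 1 := fun θ => by simp
  have hne : ∀ θ, circleMap 0 1 θ ≠ 0 := fun θ h => by simpa [h] using hnorm θ
  have hcont : Continuous fun θ => h (circleMap 0 1 θ) := by
    refine hh.continuousOn.comp_continuous (continuous_circleMap 0 1) fun θ => ?_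
    rw [closure_ball _ one_ne_zero, mem_closedBall_zero_iff, hnorm]
  have hwc : Continuous fun θ => (2 * π)⁻¹ * (h (circleMap 0 1 θ)).re :=
    continuous_const.mul (Complex.continuous_re.comp hcont)
  have hw1 : ∫ θ in (0 : ℝ)..2 * π, (2 * π)⁻¹ * (h (circleMap 0 1 θ)).re = 1 := by
    have := circleAverage_re_mul_kernel hh h0 (z := 0) (by simp)
    simp only [zero_div, sub_zero, div_one, mul_one, h0, circleAverage_def] at this
    rw [intervalIntegral.integral_ofReal] at this
    rw [intervalIntegral.integral_const_mul]
    have h2 := congrArg Complex.re this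
    rw [Complex.real_smul, ← ofReal_mul, ofReal_re] at h2
    rw [h2]; norm_num
  obtain ⟨n, μ, θ, h1, h2, -, h3⟩ := exists_finite_convex_approx two_pi_pos hwc.continuousOn
    (fun θ _ => mul_nonneg (by positivity) (hpos _ (hnorm θ))) hw1
    (κ := fun θ s => κ (z / circleMap 0 1 θ) s) (hκ.comp
      (f := fun q : ℝ × ℝ => (z / circleMap 0 1 q.1, q.2)) (by
        refine (ContinuousOn.prodMk (ContinuousOn.div continuousOn_const ?_ fun q _ => hne _)
          continuousOn_snd)
        exact ((continuous_circleMap 0 1).comp continuous_fst).continuousOn)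
      fun q hq => ⟨by
        rw [mem_closedBall_zero_iff, norm_div, hnorm, div_one], hq.2⟩) hε
  refine ⟨n, μ, fun i => z / circleMap 0 1 (θ i), h1, h2, fun i => by
    rw [norm_div, hnorm, div_one], fun s hs => ?_⟩
  convert h3 s hs using 3
  rw [circleAverage_def, Complex.real_smul, ← intervalIntegral.integral_const_mul]
  refine intervalIntegral.integral_congr fun θ _ => ?_
  simp only [ofReal_mul]
  ring

/-- A function with real part at least `1/2` is approximated on a radius by convex combinations of
the kernels `1 / (1 - y s)`. -/
theorem exists_halfPlaneSum_approx {R : ℝ} (hR : 1 < R) {P : ℂ → ℂ}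
    (hP : DifferentiableOn ℂ P (ball 0 R)) (hP0 : P 0 = 1)
    (hpos : ∀ w, ‖w‖ ≤ 1 → 0 < (P w - 1 / 2).re) {z : ℂ} (hz : ‖z‖ < 1) {ε : ℝ} (hε : 0 < ε) :
    ∃ (n : ℕ) (ν : Fin n → ℝ) (y : Fin n → ℂ), (∀ i, 0 ≤ ν i) ∧ ∑ i, ν i = 1 ∧
      (∀ i, ‖y i‖ = ‖z‖) ∧ ∀ s ∈ Icc (0 : ℝ) 1, ‖P (s * z) - halfPlaneSum ν y s‖ ≤ ε := by
  have hsub : closedBall (0 : ℂ) 1 ⊆ ball 0 R := closedBall_subset_ball hR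
  have hd : DiffContOnCl ℂ (fun w => 2 * P w - 1) (ball 0 1) := by
    refine DifferentiableOn.diffContOnCl ?_
    rw [closure_ball _ one_ne_zero]
    exact ((hP.mono hsub).const_mul 2).sub_const 1
  have hsn : ∀ s ∈ Icc (0 : ℝ) 1, ∀ y : ℂ, ‖y‖ ≤ ‖z‖ → ‖y * s‖ < 1 := fun s hs y hy => by
    rw [norm_mul, Complex.norm_real, Real.norm_of_nonneg hs.1]
    nlinarith [norm_nonneg y, hs.2]
  obtain ⟨n, ν, y, h1, h2, h3, h4⟩ := exists_finite_kernel_approx hd (by rw [hP0]; norm_num)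
    (fun w hw => by have := hpos w hw.le; simp at this ⊢; linarith) (z := z)
    (κ := fun y s => 1 / (1 - y * s)) (by
      refine ContinuousOn.div continuousOn_const (by fun_prop) fun q hq => ?_
      exact one_sub_ne_zero (hsn q.2 hq.2 q.1 (mem_closedBall_zero_iff.1 hq.1))) hε
  refine ⟨n, ν, y, h1, h2, h3, fun s hs => ?_⟩
  convert h4 s hs using 3
  have := circleAverage_re_mul_kernel hd (by rw [hP0]; norm_num) (z := s * z)
    (by rw [mul_comm]; exact hsn s hs z le_rfl)
  simp only [mul_comm (s : ℂ) z, ← div_mul_eq_mul_div] at this ⊢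
  · rw [this]
    ring
  · rfl

open Real in
/-- The logarithm of the derivative of a convex function is approximated on a radius by
logarithms of finite products. -/
theorem exists_logProd_approx {R : ℝ} (hR : 1 < R) {Γ : ℂ → ℂ}
    (hΓ : DifferentiableOn ℂ Γ (ball 0 R)) (hΓ0 : Γ 0 = 0)
    (hpos : ∀ w, ‖w‖ ≤ 1 → 0 < (1 + w * deriv Γ w).re) {z : ℂ} (hz : ‖z‖ < 1) {ε : ℝ}
    (hε : 0 < ε) :
    ∃ (n : ℕ) (μ : Fin n → ℝ) (y : Fin n → ℂ), (∀ i, 0 ≤ μ i) ∧ ∑ i, μ i = 1 ∧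
      (∀ i, ‖y i‖ = ‖z‖) ∧ ∀ s ∈ Icc (0 : ℝ) 1, ‖Γ (s * z) - logProd μ y s‖ ≤ ε := by
  have hsub : closedBall (0 : ℂ) 1 ⊆ ball 0 R := closedBall_subset_ball hR
  have hΓ' : DifferentiableOn ℂ (deriv Γ) (ball 0 R) := hΓ.deriv isOpen_ball
  have hd : DiffContOnCl ℂ (fun w => 1 + w * deriv Γ w) (ball 0 1) := by
    refine DifferentiableOn.diffContOnCl ?_
    rw [closure_ball _ one_ne_zero]
    exact (differentiableOn_id.mul (hΓ'.mono hsub)).const_add 1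
  have hsn : ∀ s ∈ Icc (0 : ℝ) 1, ∀ y : ℂ, ‖y‖ ≤ ‖z‖ → ‖y * s‖ < 1 := fun s hs y hy => by
    rw [norm_mul, Complex.norm_real, Real.norm_of_nonneg hs.1]
    nlinarith [norm_nonneg y, hs.2]
  have hsz : ∀ s ∈ Icc (0 : ℝ) 1, (s : ℂ) * z ∈ ball (0 : ℂ) R := fun s hs => hsub (by
    rw [mem_closedBall_zero_iff, mul_comm]; exact (hsn s hs z le_rfl).le)
  have h00 : 1 + 0 * deriv Γ 0 = 1 := by simp
  obtain ⟨n, μ, y, h1, h2, h3, h4⟩ := exists_finite_kernel_approx hd h00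
    (fun w hw => (hpos w hw.le).le) (z := z) (κ := fun y s => 2 * y / (1 - y * s)) (by
      refine ContinuousOn.div (by fun_prop) (by fun_prop) fun q hq => ?_
      exact one_sub_ne_zero (hsn q.2 hq.2 q.1 (mem_closedBall_zero_iff.1 hq.1))) hε
  refine ⟨n, μ, y, h1, h2, h3, ?_⟩
  have hlp : ∀ s ∈ Icc (0 : ℝ) 1, HasDerivAt (fun s : ℝ => Γ (s * z) - logProd μ y s)
      (deriv Γ (s * z) * z - ∑ k, (μ k : ℂ) * (2 * y k / (1 - y k * s))) s := by
    intro s hs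
    have e1 : HasDerivAt (fun s : ℂ => Γ (s * z)) (deriv Γ (s * z) * z) (s : ℂ) := by
      have := (hΓ.differentiableAt (isOpen_ball.mem_nhds (hsz s hs))).hasDerivAt
      exact HasDerivAt.comp (s : ℂ) this (by simpa using (hasDerivAt_id (s : ℂ)).mul_const z)
    exact (e1.sub (hasDerivAt_logProd fun k => hsn s hs _ (h3 k).le)).comp_ofReal
  -- For `s > 0` the derivatives are compared by the Schwarz formula.
  have hb : ∀ s ∈ Ioc (0 : ℝ) 1,
      ‖deriv Γ (s * z) * z - ∑ k, (μ k : ℂ) * (2 * y k / (1 - y k * s))‖ ≤ ε := by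
    intro s hs
    have hs' : s ∈ Icc (0 : ℝ) 1 := ⟨hs.1.le, hs.2⟩
    have hs0 : (s : ℂ) ≠ 0 := by exact_mod_cast hs.1.ne'
    convert h4 s hs' using 3
    have hzs : ‖z * s‖ < 1 := hsn s hs' z le_rfl
    have A1 := circleAverage_re_mul_kernel hd h00 hzs
    have A0 := circleAverage_re_mul_kernel hd h00 (z := 0) (by simp)
    have hcirc : ContinuousOn (fun w => 1 + w * deriv Γ w) (sphere 0 1) := hd.continuousOn.mono (by
      rw [closure_ball _ one_ne_zero]; exact sphere_subset_closedBall)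
    have hci : ∀ u : ℂ, ‖u‖ < 1 → CircleIntegrable
        (fun w => ((1 + w * deriv Γ w).re : ℂ) * (1 / (1 - u / w))) 0 1 := fun u hu => by
      refine ContinuousOn.circleIntegrable zero_le_one
        ((Complex.continuous_ofReal.comp_continuousOn
          (Complex.continuous_re.comp_continuousOn hcirc)).mul
        (ContinuousOn.div (by fun_prop) (continuousOn_const.sub
          (ContinuousOn.div (by fun_prop) (by fun_prop) fun w hw => ?_)) fun w hw => ?_))
      · rintro rfl; simp at hw
      · refine one_sub_ne_zero ?_
        rw [norm_div, mem_sphere_zero_iff_norm.1 hw, div_one]; exact hu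
    have e : circleAverage (fun w => ((1 + w * deriv Γ w).re : ℂ) *
        (2 * (z / w) / (1 - z / w * s))) 0 1 =
        circleAverage (fun w => (2 / s : ℂ) •
          (((1 + w * deriv Γ w).re : ℂ) * (1 / (1 - z * s / w)) -
            ((1 + w * deriv Γ w).re : ℂ) * (1 / (1 - 0 / w)))) 0 1 := by
      refine circleAverage_congr_sphere fun w hw => ?_
      have hw1 : ‖w‖ = 1 := by simpa using hw
      have hw0 : w ≠ 0 := by rintro rfl; simp at hw1
      have hne : w - z * s ≠ 0 := by
        rw [sub_ne_zero]; rintro rfl; linarith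
      simp only [smul_eq_mul, zero_div, sub_zero, div_one, mul_one]
      generalize ((1 + w * deriv Γ w).re : ℂ) = D
      rw [show (1 : ℂ) - z * s / w = (w - z * s) / w by field_simp,
        show (1 : ℂ) - z / w * s = (w - z * s) / w by field_simp]
      field_simp
      ring
    rw [e]
    have e' := circleAverage_fun_smul (𝕜 := ℂ) (a := (2 / s : ℂ)) (c := 0) (R := 1)
      (f := fun w => ((1 + w * deriv Γ w).re : ℂ) * (1 / (1 - z * s / w)) -
            ((1 + w * deriv Γ w).re : ℂ) * (1 / (1 - 0 / w)))
    rw [e', circleAverage_fun_sub (hci _ hzs) (hci 0 (by simp)), A1, A0, smul_eq_mul]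
    rw [mul_comm (s : ℂ) z]
    field_simp
    ring
  have hb' : ∀ s ∈ Icc (0 : ℝ) 1,
      ‖deriv Γ (s * z) * z - ∑ k, (μ k : ℂ) * (2 * y k / (1 - y k * s))‖ ≤ ε := by
    intro s hs
    rw [← closure_Ioc zero_ne_one] at hs
    refine le_on_closure (f := fun s : ℝ => ‖deriv Γ (s * z) * z -
      ∑ k, (μ k : ℂ) * (2 * y k / (1 - y k * s))‖) (g := fun _ => ε) hb ?_ continuousOn_const hs
    rw [closure_Ioc zero_ne_one]
    refine ContinuousOn.norm (((hΓ'.continuousOn.comp (by fun_prop) hsz).mul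
      continuousOn_const).sub (continuousOn_finsetSum _ fun k _ => continuousOn_const.mul
      (ContinuousOn.div (by fun_prop) (by fun_prop) fun s hs => ?_)))
    exact one_sub_ne_zero (hsn s hs _ (h3 k).le)
  intro s hs
  have := norm_image_sub_le_of_norm_deriv_le_segment_01'
    (f := fun t : ℝ => Γ ((s * t : ℝ) * z) - logProd μ y ((s * t : ℝ)))
    (f' := fun t : ℝ => (s : ℂ) * (deriv Γ ((s * t : ℝ) * z) * z -
      ∑ k, (μ k : ℂ) * (2 * y k / (1 - y k * (s * t : ℝ))))) (C := ε)
    (fun t ht => by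
      have hst : s * t ∈ Icc (0 : ℝ) 1 := ⟨mul_nonneg hs.1 ht.1, mul_le_one₀ hs.2 ht.1 ht.2⟩
      have := HasDerivAt.scomp t (g₁ := fun s : ℝ => Γ (s * z) - logProd μ y s) (hlp (s * t) hst)
        ((hasDerivAt_id t).const_mul s)
      refine (this.congr_deriv ?_).hasDerivWithinAt
      rw [mul_one, real_smul])
    (fun t ht => by
      have hst : s * t ∈ Icc (0 : ℝ) 1 := ⟨mul_nonneg hs.1 ht.1, mul_le_one₀ hs.2 ht.1 ht.2.le⟩
      rw [norm_mul, Complex.norm_real, Real.norm_of_nonneg hs.1]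
      have := hb' _ hst
      nlinarith [norm_nonneg (deriv Γ ((s * t : ℝ) * z) * z -
        ∑ k, (μ k : ℂ) * (2 * y k / (1 - y k * (s * t : ℝ)))), hs.2])
  simpa [hΓ0, logProd] using this

open Filter Topology in
/-- Joint continuity of `logValue` in the two functions, at functions for which the principal
logarithms are continuous. -/
theorem tendsto_logValue {X : ℂ} {γ P : ℝ → ℂ} {γ' P' : ℕ → ℝ → ℂ}
    (hγ : ContinuousOn γ (Icc 0 1)) (hP : ContinuousOn P (Icc 0 1))
    (hγ' : ∀ n, ContinuousOn (γ' n) (Icc 0 1)) (hP' : ∀ n, ContinuousOn (P' n) (Icc 0 1))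
    {ε : ℕ → ℝ} (hε : Tendsto ε atTop (𝓝 0))
    (hγlim : ∀ n, ∀ s ∈ Icc (0 : ℝ) 1, ‖γ s - γ' n s‖ ≤ ε n)
    (hPlim : ∀ n, ∀ s ∈ Icc (0 : ℝ) 1, ‖P s - P' n s‖ ≤ ε n)
    (h1 : (∫ t in (0 : ℝ)..1, exp (γ t)) / exp (γ 1) ∈ slitPlane)
    (h2 : X + (1 - X) * ((∫ t in (0 : ℝ)..1, P t * exp (γ t)) / ∫ t in (0 : ℝ)..1, exp (γ t))
      ∈ slitPlane) :
    Tendsto (fun n => logValue X (γ' n) (P' n)) atTop (𝓝 (logValue X γ P)) := by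
  have hI : uIoc (0 : ℝ) 1 ⊆ Icc 0 1 := by
    rw [uIoc_of_le zero_le_one]; exact Ioc_subset_Icc_self
  have lim : ∀ {f : ℝ → ℂ} {f' : ℕ → ℝ → ℂ}, (∀ n, ∀ s ∈ Icc (0 : ℝ) 1, ‖f s - f' n s‖ ≤ ε n) →
      ∀ s ∈ Icc (0 : ℝ) 1, Tendsto (fun n => f' n s) atTop (𝓝 (f s)) := by
    intro f f' hf s hs
    rw [tendsto_iff_norm_sub_tendsto_zero]
    refine squeeze_zero (fun _ => norm_nonneg _) (fun n => ?_) hε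
    rw [norm_sub_rev]; exact hf n s hs
  obtain ⟨Cγ, hCγ⟩ := isCompact_Icc.exists_bound_of_continuousOn hγ
  obtain ⟨CP, hCP⟩ := isCompact_Icc.exists_bound_of_continuousOn hP
  have hε1 : ∀ᶠ n in atTop, ε n ≤ 1 := hε.eventually_le_const zero_lt_one
  have bound : ∀ {f : ℝ → ℂ} {f' : ℕ → ℝ → ℂ} {C : ℝ}, (∀ s ∈ Icc (0 : ℝ) 1, ‖f s‖ ≤ C) →
      (∀ n, ∀ s ∈ Icc (0 : ℝ) 1, ‖f s - f' n s‖ ≤ ε n) →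
      ∀ᶠ n in atTop, ∀ s ∈ Icc (0 : ℝ) 1, ‖f' n s‖ ≤ C + 1 := by
    intro f f' C hC hf
    filter_upwards [hε1] with n hn s hs
    have := norm_sub_norm_le (f' n s) (f s)
    rw [norm_sub_rev] at this
    linarith [hC s hs, hf n s hs]
  have hexp : ∀ n, ∀ s, ‖γ' n s‖ ≤ Cγ + 1 → ‖exp (γ' n s)‖ ≤ Real.exp (Cγ + 1) :=
    fun n s hs => by
      rw [Complex.norm_exp]
      exact Real.exp_le_exp.2 ((Complex.re_le_norm _).trans hs)
  have t1 : Tendsto (fun n => ∫ t in (0 : ℝ)..1, exp (γ' n t)) atTop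
      (𝓝 (∫ t in (0 : ℝ)..1, exp (γ t))) := by
    refine intervalIntegral.tendsto_integral_filter_of_dominated_convergence
      (fun _ => Real.exp (Cγ + 1)) ?_ ?_ intervalIntegrable_const ?_
    · refine Eventually.of_forall fun n => ?_
      exact (((hγ' n).cexp).mono hI).aestronglyMeasurable measurableSet_uIoc
    · filter_upwards [bound hCγ hγlim] with n hn
      exact MeasureTheory.ae_of_all _ fun s hs => hexp n s (hn s (hI hs))
    · exact MeasureTheory.ae_of_all _ fun s hs => (lim hγlim s (hI hs)).cexp
  have t2 : Tendsto (fun n => ∫ t in (0 : ℝ)..1, P' n t * exp (γ' n t)) atTop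
      (𝓝 (∫ t in (0 : ℝ)..1, P t * exp (γ t))) := by
    refine intervalIntegral.tendsto_integral_filter_of_dominated_convergence
      (fun _ => (CP + 1) * Real.exp (Cγ + 1)) ?_ ?_ intervalIntegrable_const ?_
    · refine Eventually.of_forall fun n => ?_
      exact (((hP' n).mul (hγ' n).cexp).mono hI).aestronglyMeasurable measurableSet_uIoc
    · filter_upwards [bound hCγ hγlim, bound hCP hPlim] with n hn hn'
      refine MeasureTheory.ae_of_all _ fun s hs => ?_
      rw [norm_mul]
      exact mul_le_mul (hn' s (hI hs)) (hexp n s (hn s (hI hs))) (norm_nonneg _)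
        ((norm_nonneg _).trans (hn' s (hI hs)))
    · exact MeasureTheory.ae_of_all _ fun s hs =>
        (lim hPlim s (hI hs)).mul (lim hγlim s (hI hs)).cexp
  have t3 := lim hγlim 1 (right_mem_Icc.2 zero_le_one)
  have hne : (∫ t in (0 : ℝ)..1, exp (γ t)) ≠ 0 := by
    intro h; rw [h, zero_div] at h1; exact slitPlane_ne_zero h1 rfl
  exact (t3.add ((t1.div t3.cexp (exp_ne_zero _)).clog h1)).add
    ((((t2.div t1 hne).const_mul (1 - X)).const_add X).clog h2)

/-- The arguments of the principal logarithms in `logValue`, for a convex function with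
logarithmic derivative data `Γ` and a half-plane function `P`. -/
theorem logValue_mem_slitPlane {R : ℝ} (hR : 1 < R) {Γ P : ℂ → ℂ}
    (hΓ : DifferentiableOn ℂ Γ (ball 0 R))
    (hΓpos : ∀ w, ‖w‖ ≤ 1 → 0 < (1 + w * deriv Γ w).re) (hP : DifferentiableOn ℂ P (ball 0 R))
    (hPpos : ∀ w, ‖w‖ ≤ 1 → 0 < (P w - 1 / 2).re) {X z : ℂ} (hX : ‖X‖ ≤ 1) (hz : ‖z‖ ≤ 1) :
    (∫ t in (0 : ℝ)..1, exp (Γ (t * z))) / exp (Γ z) ∈ slitPlane ∧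
    X + (1 - X) * ((∫ t in (0 : ℝ)..1, P (t * z) * exp (Γ (t * z))) /
      ∫ t in (0 : ℝ)..1, exp (Γ (t * z))) ∈ slitPlane := by
  have hm : ∀ w ∈ ball (0 : ℂ) R, w * z ∈ ball (0 : ℂ) R := fun w hw => by
    rw [mem_ball_zero_iff] at hw ⊢
    rw [norm_mul]; nlinarith [norm_nonneg w, norm_nonneg z]
  have hm1 : ∀ w : ℂ, ‖w‖ ≤ 1 → ‖w * z‖ ≤ 1 := fun w hw => by
    rw [norm_mul]; exact mul_le_one₀ hw (norm_nonneg _) hz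
  have hd : ∀ w ∈ ball (0 : ℂ) R, HasDerivAt (fun w => exp (Γ (w * z)))
      (exp (Γ (w * z)) * (deriv Γ (w * z) * z)) w := fun w hw => by
    have := (hΓ.differentiableAt (isOpen_ball.mem_nhds (hm w hw))).hasDerivAt
    exact (HasDerivAt.comp w this (by simpa using (hasDerivAt_id w).mul_const z)).cexp
  have hmul : DifferentiableOn ℂ (fun w : ℂ => w * z) (ball 0 R) := by fun_prop
  obtain ⟨k1, k2⟩ := re_average_pos hR 0 (k := fun w => exp (Γ (w * z)))
    (F := fun w => P (w * z) - 1 / 2)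
    (fun w hw => (hd w hw).differentiableAt.differentiableWithinAt) (fun _ _ => exp_ne_zero _)
    (fun w hw => by
      have hw' : w ∈ ball (0 : ℂ) R := by rw [mem_ball_zero_iff]; linarith
      rw [(hd w hw').deriv, mul_div_assoc, mul_div_cancel_left₀ _ (exp_ne_zero _)]
      convert hΓpos _ (hm1 w hw) using 2
      push_cast; ring)
    ((hP.comp hmul hm).sub_const _) (fun w hw => hPpos _ (hm1 w hw))
  simp only [pow_zero, one_mul] at k1 k2
  refine ⟨mem_slitPlane_iff.2 (Or.inl k1), affine_mem_slitPlane hX ?_⟩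
  have hmz : ∀ t ∈ Icc (0 : ℝ) 1, (t : ℂ) * z ∈ ball (0 : ℂ) R := fun t ht => by
    refine hm t ?_
    rw [mem_ball_zero_iff, Complex.norm_real, Real.norm_of_nonneg ht.1]; linarith [ht.2]
  have c1 : ContinuousOn (fun t : ℝ => Γ (t * z)) (Icc 0 1) :=
    hΓ.continuousOn.comp (by fun_prop) hmz
  have c2 : ContinuousOn (fun t : ℝ => P (t * z)) (Icc 0 1) :=
    hP.continuousOn.comp (by fun_prop) hmz
  have e : (∫ t in (0 : ℝ)..1, (P (t * z) - 1 / 2) * exp (Γ (t * z))) =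
      (∫ t in (0 : ℝ)..1, P (t * z) * exp (Γ (t * z))) -
        1 / 2 * ∫ t in (0 : ℝ)..1, exp (Γ (t * z)) := by
    rw [← intervalIntegral.integral_const_mul, ← intervalIntegral.integral_sub]
    · exact intervalIntegral.integral_congr fun t _ => by ring
    · exact (c2.mul c1.cexp).intervalIntegrable_of_Icc zero_le_one
    · exact (c1.cexp.intervalIntegrable_of_Icc zero_le_one).const_mul _
  rw [e] at k2
  have hne : (∫ t in (0 : ℝ)..1, exp (Γ (t * z))) ≠ 0 := by
    intro h; rw [h] at k2; simp at k2
  rwa [sub_div, mul_div_cancel_right₀ _ hne] at k2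

open Filter Topology in
/-- The lower bound for the extremal functions carries over to all functions of the class, by
approximation with finite products and sums. -/
theorem le_logValue_of_extremal {R : ℝ} (hR : 1 < R) {Γ P : ℂ → ℂ}
    (hΓ : DifferentiableOn ℂ Γ (ball 0 R)) (hΓ0 : Γ 0 = 0)
    (hΓpos : ∀ w, ‖w‖ ≤ 1 → 0 < (1 + w * deriv Γ w).re)
    (hP : DifferentiableOn ℂ P (ball 0 R)) (hP0 : P 0 = 1)
    (hPpos : ∀ w, ‖w‖ ≤ 1 → 0 < (P w - 1 / 2).re) {z : ℂ} (hz0 : z ≠ 0) (hz : ‖z‖ < 1) {m : ℝ}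
    {c X : ℂ} (hc : c ≠ 0) (hX : ‖X‖ = 1)
    (hm : ∀ X ζ, ‖X‖ = 1 → ‖ζ‖ = ‖z‖ → m ≤ (c * extremalLog (1 - X * ζ) (1 - ζ)).re) :
    m ≤ (c * logValue X (fun t => Γ (t * z)) (fun t => P (t * z))).re := by
  have hpos : ∀ n : ℕ, (0 : ℝ) < 1 / (n + 1) := fun n => Nat.one_div_pos_of_nat
  choose n₁ μ y hμ hμ1 hy hapx using fun n : ℕ =>
    exists_logProd_approx hR hΓ hΓ0 hΓpos hz (hpos n)
  choose n₂ ν ζ hν hν1 hζ hapx' using fun n : ℕ =>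
    exists_halfPlaneSum_approx hR hP hP0 hPpos hz (hpos n)
  have hmz : ∀ t ∈ Icc (0 : ℝ) 1, (t : ℂ) * z ∈ ball (0 : ℂ) R := fun t ht => by
    rw [mem_ball_zero_iff, norm_mul, Complex.norm_real, Real.norm_of_nonneg ht.1]
    nlinarith [norm_nonneg z, ht.2]
  obtain ⟨s1, s2⟩ := logValue_mem_slitPlane hR hΓ hΓpos hP hPpos hX.le hz.le
  have hlim := tendsto_logValue (X := X) (γ := fun t => Γ (t * z)) (P := fun t => P (t * z))
    (γ' := fun n t => logProd (μ n) (y n) t) (P' := fun n t => halfPlaneSum (ν n) (ζ n) t)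
    (hΓ.continuousOn.comp (by fun_prop) hmz) (hP.continuousOn.comp (by fun_prop) hmz)
    (fun n => continuousOn_logProd hz fun k => (hy n k).le)
    (fun n => continuousOn_halfPlaneSum hz fun k => (hζ n k).le)
    tendsto_one_div_add_atTop_nhds_zero_nat hapx hapx' (by simpa using s1) s2
  refine ge_of_tendsto' ((Complex.continuous_re.tendsto _).comp (hlim.const_mul c)) fun n => ?_
  exact le_torusValue_of_extremal (norm_pos_iff.2 hz0) hz (hμ n) (hμ1 n) (hν n) (hν1 n) hc hm hX
    (hζ n) (hy n)

/-! ### Convex functions -/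

namespace IsConvexUnivalent

variable {g : ℂ → ℂ}

theorem hasDerivAt_invFunOn (hg : IsConvexUnivalent g) (hg' : ∀ z ∈ ball (0 : ℂ) 1, deriv g z ≠ 0)
    {z : ℂ} (hz : z ∈ ball (0 : ℂ) 1) :
    HasDerivAt (Function.invFunOn g (ball 0 1)) (deriv g z)⁻¹ (g z) := by
  have hs : HasStrictDerivAt g (deriv g z) z :=
    (hg.1.analyticAt (isOpen_ball.mem_nhds hz)).hasStrictDerivAt
  refine (hs.to_local_left_inverse (hg' z hz) ?_).hasDerivAt
  filter_upwards [isOpen_ball.mem_nhds hz] with x hx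
  exact hg.2.1.leftInvOn_invFunOn hx

/-- Schwarz's lemma for `z ↦ g⁻¹ ((1 - t) g z + t g (ωz))`. -/
theorem norm_invFunOn_le (hg : IsConvexUnivalent g) (hg' : ∀ z ∈ ball (0 : ℂ) 1, deriv g z ≠ 0)
    {ω : ℂ} (hω : ‖ω‖ ≤ 1) {t : ℝ} (ht : t ∈ Icc (0 : ℝ) 1) {z : ℂ} (hz : z ∈ ball (0 : ℂ) 1) :
    ‖Function.invFunOn g (ball 0 1) (g z + t * (g (ω * z) - g z))‖ ≤ ‖z‖ := by
  have hωm : ∀ z ∈ ball (0 : ℂ) 1, ω * z ∈ ball (0 : ℂ) 1 := fun z hz => by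
    rw [mem_ball_zero_iff] at hz ⊢
    rw [norm_mul]; nlinarith [norm_nonneg z, norm_nonneg ω]
  have him : ∀ z ∈ ball (0 : ℂ) 1, g z + t * (g (ω * z) - g z) ∈ g '' ball 0 1 := by
    intro z hz
    have := hg.2.2 (mem_image_of_mem g hz) (mem_image_of_mem g (hωm z hz))
      (sub_nonneg.2 ht.2) ht.1 (by ring)
    convert this using 1
    simp only [real_smul]; push_cast; ring
  refine norm_le_norm_of_mapsTo_ball
    (f := fun z => Function.invFunOn g (ball 0 1) (g z + t * (g (ω * z) - g z))) (R := 1) ?_ ?_ ?_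
    (mem_ball_zero_iff.1 hz)
  · intro z hz
    obtain ⟨x, hx, hxe⟩ := him z hz
    have h1 : DifferentiableAt ℂ (fun z => g z + t * (g (ω * z) - g z)) z := by
      have e1 := hg.1.differentiableAt (isOpen_ball.mem_nhds hz)
      have e2 := hg.1.differentiableAt (isOpen_ball.mem_nhds (hωm z hz))
      exact e1.add (((e2.comp z (by fun_prop)).sub e1).const_mul _)
    have h2 := (hg.hasDerivAt_invFunOn hg' hx).differentiableAt
    rw [hxe] at h2
    exact (h2.comp z h1).differentiableWithinAt
  · intro z hz
    exact ball_subset_closedBall (Function.invFunOn_mem (him z hz))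
  · simp only [mul_zero, sub_self, add_zero]
    exact hg.2.1.leftInvOn_invFunOn (mem_ball_self one_pos)

open Filter Topology in
/-- The values of a convex function on a disk lie on one side of each tangent of the boundary
curve. -/
theorem re_separation (hg : IsConvexUnivalent g) (hg' : ∀ z ∈ ball (0 : ℂ) 1, deriv g z ≠ 0)
    {ω : ℂ} (hω : ‖ω‖ ≤ 1) {z : ℂ} (hz : z ∈ ball (0 : ℂ) 1) :
    0 ≤ (starRingEnd ℂ z * ((g z - g (ω * z)) / deriv g z)).re := by
  set ψ := Function.invFunOn g (ball 0 1) with hψ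
  have h1 : HasDerivAt (fun t : ℝ => ψ (g z + t * (g (ω * z) - g z)))
      ((deriv g z)⁻¹ * (g (ω * z) - g z)) 0 := by
    have e : HasDerivAt (fun t : ℂ => g z + t * (g (ω * z) - g z)) (g (ω * z) - g z)
        ((0 : ℝ) : ℂ) := by
      simpa using ((hasDerivAt_id ((0 : ℝ) : ℂ)).mul_const (g (ω * z) - g z)).const_add (g z)
    have e2 : HasDerivAt ψ (deriv g z)⁻¹ (g z + ((0 : ℝ) : ℂ) * (g (ω * z) - g z)) := by
      simpa using hg.hasDerivAt_invFunOn hg' hz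
    exact (HasDerivAt.comp (h := fun t : ℂ => g z + t * (g (ω * z) - g z))
      ((0 : ℝ) : ℂ) e2 e).comp_ofReal
  have hz0 : ψ (g z + ((0 : ℝ) : ℂ) * (g (ω * z) - g z)) = z := by
    simpa using hg.2.1.leftInvOn_invFunOn hz
  have h2 := h1.norm_sq
  rw [hz0] at h2
  have h3 := (hasDerivWithinAt_iff_tendsto_slope' (s := Ioi (0 : ℝ)) (by simp)).1
    h2.hasDerivWithinAt
  have h4 : 2 * inner ℝ z ((deriv g z)⁻¹ * (g (ω * z) - g z)) ≤ 0 := by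
    refine le_of_tendsto h3 ?_
    filter_upwards [Ioo_mem_nhdsGT (zero_lt_one (α := ℝ))] with t ht
    rw [slope_def_field]
    refine div_nonpos_of_nonpos_of_nonneg ?_ (by linarith [ht.1])
    rw [hz0, sub_nonpos]
    exact pow_le_pow_left₀ (norm_nonneg _)
      (hg.norm_invFunOn_le hg' hω ⟨ht.1.le, ht.2.le⟩ hz) 2
  rw [Complex.inner] at h4
  have e : starRingEnd ℂ z * ((g z - g (ω * z)) / deriv g z) =
      -((deriv g z)⁻¹ * (g (ω * z) - g z) * starRingEnd ℂ z) := by ring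
  rw [e, neg_re]
  linarith

open Filter Topology in
/-- The analytic description of convexity. By `re_separation`, the function
`t ↦ Re (a (g z - g (e^{it} z)))` with `a = z̄ / g' z` has a minimum at `t = 0`, and its second
derivative there is `|z|² Re (1 + z g'' z / g' z)`. -/
theorem re_one_add_nonneg (hg : IsConvexUnivalent g)
    (hg' : ∀ z ∈ ball (0 : ℂ) 1, deriv g z ≠ 0) {z : ℂ} (hz : z ∈ ball (0 : ℂ) 1) :
    0 ≤ (1 + z * (deriv (deriv g) z / deriv g z)).re := by
  rcases eq_or_ne z 0 with rfl | hz0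
  · simp
  set a : ℂ := starRingEnd ℂ z / deriv g z with ha
  set e : ℝ → ℂ := fun t => exp (t * I) * z with he
  have hnorm : ∀ t : ℝ, ‖exp (t * I)‖ = 1 := fun t => norm_exp_ofReal_mul_I t
  have hem : ∀ t, e t ∈ ball (0 : ℂ) 1 := fun t => by
    rw [mem_ball_zero_iff, he, norm_mul, hnorm, one_mul]; exact mem_ball_zero_iff.1 hz
  have he0 : e 0 = z := by simp [he]
  have hed : ∀ t, HasDerivAt e (I * e t) t := fun t => by
    have : HasDerivAt (fun t : ℂ => exp (t * I) * z) (exp (t * I) * (1 * I) * z) (t : ℂ) :=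
      ((((hasDerivAt_id (t : ℂ)).mul_const I)).cexp).mul_const z
    exact this.comp_ofReal.congr_deriv (by simp only [he]; ring)
  have hgd : ∀ w ∈ ball (0 : ℂ) 1, HasDerivAt g (deriv g w) w := fun w hw =>
    (hg.1.differentiableAt (isOpen_ball.mem_nhds hw)).hasDerivAt
  have hgd' : ∀ w ∈ ball (0 : ℂ) 1, HasDerivAt (deriv g) (deriv (deriv g) w) w := fun w hw =>
    ((hg.1.deriv isOpen_ball).differentiableAt (isOpen_ball.mem_nhds hw)).hasDerivAt
  set u : ℝ → ℝ := fun t => (a * (g z - g (e t))).re with hu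
  have hre : ∀ {F : ℝ → ℂ} {F' : ℂ} {t : ℝ}, HasDerivAt F F' t →
      HasDerivAt (fun t => (F t).re) F'.re t := fun {F F' t} h =>
    (Complex.reCLM.hasFDerivAt.comp_hasDerivAt t h)
  have hu1 : ∀ t, HasDerivAt u (a * (-(I * e t * deriv g (e t)))).re t := fun t => by
    have h := HasDerivAt.scomp t (hgd _ (hem t)) (hed t)
    refine hre ((h.const_sub (g z)).const_mul a |>.congr_deriv ?_)
    rw [smul_eq_mul]
  have hu2 : HasDerivAt (fun t => (a * (-(I * e t * deriv g (e t)))).re)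
      (a * (z * deriv g z + z ^ 2 * deriv (deriv g) z)).re 0 := by
    have h := HasDerivAt.scomp 0 (hgd' _ (hem 0)) (hed 0)
    refine hre (((((hed 0).const_mul I).mul h).neg.const_mul a).congr_deriv ?_)
    simp only [he0, smul_eq_mul, Function.comp]
    linear_combination (-(a * (z * deriv g z + z ^ 2 * deriv (deriv g) z))) * I_sq
  have hdu : deriv u = fun t => (a * (-(I * e t * deriv g (e t)))).re :=
    funext fun t => (hu1 t).deriv
  have hd0 : (a * (z * deriv g z + z ^ 2 * deriv (deriv g) z)) =
      ((normSq z : ℝ) : ℂ) * (1 + z * (deriv (deriv g) z / deriv g z)) := by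
    rw [normSq_eq_conj_mul_self, ha]
    have := hg' z hz
    field_simp
  have hpos : ∀ t, 0 ≤ u t := fun t => by
    have := hg.re_separation hg' (hnorm t).le hz
    simp only [hu, he, ha]
    convert this using 2
    ring
  have hu0 : u 0 = 0 := by simp [hu, he0]
  by_contra hcon
  push Not at hcon
  have hneg : deriv (deriv u) 0 < 0 := by
    rw [hdu, hu2.deriv, hd0, re_ofReal_mul]
    exact mul_neg_of_pos_of_neg (normSq_pos.2 hz0) hcon
  have hmin : IsLocalMin u 0 := Eventually.of_forall fun t => by rw [hu0]; exact hpos t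
  have hmax := isLocalMax_of_deriv_deriv_neg hneg hmin.deriv_eq_zero (hu1 0).continuousAt
  have hconst : u =ᶠ[𝓝 0] fun _ => 0 := by
    filter_upwards [hmax] with t ht
    exact le_antisymm (ht.trans_eq hu0) (hpos t)
  have h1 := hconst.deriv.deriv.eq_of_nhds
  simp at h1
  rw [h1] at hneg
  exact lt_irrefl _ hneg

end IsConvexUnivalent

/-- The minimum principle for a half-plane. -/
theorem re_pos_of_re_nonneg {h : ℂ → ℂ} (hh : DifferentiableOn ℂ h (ball 0 1)) (h0 : 0 < (h 0).re)
    (hpos : ∀ z ∈ ball (0 : ℂ) 1, 0 ≤ (h z).re) {z : ℂ} (hz : z ∈ ball (0 : ℂ) 1) :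
    0 < (h z).re := by
  refine (hpos z hz).lt_of_ne fun hcon => ?_
  have := norm_eqOn_of_isPreconnected_of_isMaxOn (convex_ball (0 : ℂ) 1).isPreconnected isOpen_ball
    (f := fun w => exp (-h w)) hh.neg.cexp hz (fun w hw => by
      simp only [Function.comp, mem_ofPred_eq, Complex.norm_exp, neg_re, ← hcon]
      exact Real.exp_le_exp.2 (by linarith [hpos w hw]))
  have := this (mem_ball_self one_pos)
  simp only [Function.comp, Complex.norm_exp, neg_re, ← hcon, Function.const_apply,
    neg_zero, Real.exp_zero, Real.exp_eq_one_iff] at this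
  linarith

/-- The branch of the logarithm on a disk. -/
theorem exists_log_branch {h : ℂ → ℂ} (hh : DifferentiableOn ℂ h (ball 0 1)) (h0 : h 0 = 1)
    (hne : ∀ z ∈ ball (0 : ℂ) 1, h z ≠ 0) :
    ∃ Γ : ℂ → ℂ, Γ 0 = 0 ∧ ∀ z ∈ ball (0 : ℂ) 1, HasDerivAt Γ (deriv h z / h z) z ∧
      exp (Γ z) = h z := by
  obtain ⟨Γ, hΓ0, hΓ⟩ := ((hh.deriv isOpen_ball).fun_div hh hne).isExactOn_ball.with_val_at 0 0
  refine ⟨Γ, hΓ0, fun z hz => ⟨hΓ z hz, ?_⟩⟩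
  have hd : ∀ w ∈ ball (0 : ℂ) 1, HasDerivAt (fun w => h w * exp (-Γ w)) 0 w := fun w hw => by
    have h1 := (hh.differentiableAt (isOpen_ball.mem_nhds hw)).hasDerivAt
    refine (h1.mul ((hΓ w hw).neg.cexp)).congr_deriv ?_
    have := hne w hw
    field_simp
    ring
  have := isOpen_ball.is_const_of_deriv_eq_zero (convex_ball (0 : ℂ) 1).isPreconnected
    (fun w hw => (hd w hw).differentiableAt.differentiableWithinAt) (fun w hw => (hd w hw).deriv)
    hz (mem_ball_self one_pos)
  simp only [h0, hΓ0, neg_zero, exp_zero, mul_one, exp_neg] at this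
  exact (mul_inv_eq_one₀ (exp_ne_zero _)).1 this |>.symm

/-! ### The branch of `log (f z / z)` for a close-to-convex function -/

/-- The derivative of a close-to-convex function is `(X + (1 - X) P) e^Γ` with `e^Γ` the derivative
of a normalized convex function and `P` a function with `P 0 = 1` and values in `Re > 1/2`. -/
theorem exists_deriv_eq_of_mem_closeToConvex {f : ℂ → ℂ} (hf : f ∈ CloseToConvex) :
    ∃ (X : ℂ) (Γ P : ℂ → ℂ), ‖X‖ = 1 ∧ DifferentiableOn ℂ Γ (ball 0 1) ∧ Γ 0 = 0 ∧
      (∀ w ∈ ball (0 : ℂ) 1, 0 < (1 + w * deriv Γ w).re) ∧ DifferentiableOn ℂ P (ball 0 1) ∧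
      P 0 = 1 ∧ (∀ w ∈ ball (0 : ℂ) 1, 0 < (P w - 1 / 2).re) ∧
      ∀ w ∈ ball (0 : ℂ) 1, deriv f w = (X + (1 - X) * P w) * exp (Γ w) := by
  obtain ⟨⟨hfd, -, hf1⟩, g, hg, hfg⟩ := hf
  have h0 : (0 : ℂ) ∈ ball (0 : ℂ) 1 := mem_ball_self one_pos
  have hg' : ∀ z ∈ ball (0 : ℂ) 1, deriv g z ≠ 0 := fun z hz h => by
    have := hfg z hz; rw [h] at this; simp at this
  have hgd : DifferentiableOn ℂ (deriv g) (ball 0 1) := hg.1.deriv isOpen_ball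
  obtain ⟨Γ, hΓ0, hΓ⟩ := exists_log_branch (h := fun z => deriv g z / deriv g 0)
    (hgd.div_const _) (div_self (hg' 0 h0)) fun z hz => div_ne_zero (hg' z hz) (hg' 0 h0)
  have hΓd : DifferentiableOn ℂ Γ (ball 0 1) := fun w hw =>
    (hΓ w hw).1.differentiableAt.differentiableWithinAt
  set d : ℂ := (deriv g 0)⁻¹ with hd
  have hdre : 0 < d.re := by have := hfg 0 h0; rwa [hf1, one_div] at this
  -- The rotation of the half-plane is normalized to `Re c = 1/2`.
  set c : ℂ := ((1 / (2 * d.re) : ℝ) : ℂ) * d with hc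
  have hcre : c.re = 1 / 2 := by rw [hc, re_ofReal_mul]; field_simp
  have hc0 : c ≠ 0 := by intro h; rw [h] at hcre; norm_num at hcre
  have hd0 : d ≠ 0 := inv_ne_zero (hg' 0 h0)
  have hX : ‖1 - 1 / c‖ = 1 := by
    rw [show 1 - 1 / c = (c - 1) / c by field_simp, norm_div,
      div_eq_one_iff_eq (norm_ne_zero_iff.2 hc0)]
    rw [← sq_eq_sq₀ (norm_nonneg _) (norm_nonneg _), Complex.sq_norm, Complex.sq_norm, normSq_apply,
      normSq_apply]
    simp only [sub_re, sub_im, one_re, one_im, hcre]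
    ring
  have hpd : DifferentiableOn ℂ (fun z => c * (deriv f z / (deriv g z * d) - 1) + 1) (ball 0 1) :=
    ((((hfd.deriv isOpen_ball).fun_div (hgd.mul_const d)
      fun z hz => mul_ne_zero (hg' z hz) hd0).sub_const 1).const_mul c).add_const 1
  refine ⟨1 - 1 / c, Γ, fun z => c * (deriv f z / (deriv g z * d) - 1) + 1, hX, hΓd, hΓ0, ?_, hpd,
    ?_, ?_, ?_⟩
  · have hder : ∀ w ∈ ball (0 : ℂ) 1, deriv Γ w = deriv (deriv g) w / deriv g w := fun w hw => by
      rw [(hΓ w hw).1.deriv, deriv_div_const, div_div_div_cancel_right₀ (hg' 0 h0)]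
    refine fun w hw => re_pos_of_re_nonneg (h := fun w => 1 + w * deriv Γ w)
      ((differentiableOn_id.mul (hΓd.deriv isOpen_ball)).const_add 1) (by simp) (fun z hz => ?_) hw
    simp only [hder z hz]
    exact hg.re_one_add_nonneg hg' hz
  · simp only [hf1, hd, mul_inv_cancel₀ (hg' 0 h0)]
    simp
  · intro w hw
    have h1 := hfg w hw
    have e : c * (deriv f w / (deriv g w * d) - 1) + 1 - 1 / 2 =
        ((1 / (2 * d.re) : ℝ) : ℂ) * (deriv f w / deriv g w) - (c - 1 / 2) := by
      have := hg' w hw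
      rw [hc]; field_simp; ring
    rw [e, sub_re, sub_re, hcre, re_ofReal_mul]
    norm_num
    positivity
  · intro w hw
    have e : exp (Γ w) = deriv g w * d := by rw [(hΓ w hw).2, hd, div_eq_mul_inv]
    rw [e]
    have := hg' w hw
    field_simp
    ring

/-- The branch is unique: the difference of two branches takes values in `2πi ℤ`. -/
theorem IsLogRatio.eqOn {f L₁ L₂ : ℂ → ℂ} (h₁ : IsLogRatio f L₁) (h₂ : IsLogRatio f L₂) :
    EqOn L₁ L₂ (ball 0 1) := by
  have hexp : ∀ z ∈ ball (0 : ℂ) 1, exp (L₁ z - L₂ z) = 1 := by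
    intro z hz
    rcases eq_or_ne z 0 with rfl | hz0
    · rw [h₁.2.1, h₂.2.1, sub_self, exp_zero]
    · have e := (h₁.2.2 z hz hz0).trans (h₂.2.2 z hz hz0).symm
      rw [exp_sub, e, div_self (exp_ne_zero _)]
  have hd : ∀ z ∈ ball (0 : ℂ) 1, DifferentiableAt ℂ (fun z => L₁ z - L₂ z) z := fun z hz =>
    (h₁.1.sub h₂.1).differentiableAt (isOpen_ball.mem_nhds hz)
  have hd0 : EqOn (deriv fun z => L₁ z - L₂ z) 0 (ball 0 1) := by
    intro z hz
    have e1 : (fun z => exp (L₁ z - L₂ z)) =ᶠ[nhds z] fun _ => 1 := by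
      filter_upwards [isOpen_ball.mem_nhds hz] with w hw using hexp w hw
    have e2 := e1.deriv_eq
    rw [(hd z hz).hasDerivAt.cexp.deriv, hexp z hz] at e2
    simpa using e2
  intro z hz
  have := isOpen_ball.is_const_of_deriv_eq_zero (convex_ball (0 : ℂ) 1).isPreconnected
    (h₁.1.sub h₂.1) hd0 hz (mem_ball_self one_pos)
  simpa [h₁.2.1, h₂.2.1, sub_eq_zero] using this

theorem IsLogRatio.logRatio {f L : ℂ → ℂ} (h : IsLogRatio f L) : IsLogRatio f (logRatio f) := by
  have hex : ∃ L, IsLogRatio f L := ⟨L, h⟩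
  rw [_root_.logRatio, dif_pos hex]
  exact hex.choose_spec

section Dilation

variable {X : ℂ} {Γ P : ℂ → ℂ}

/-- A point of the disk as the image of a point of the disk under a contraction. -/
theorem exists_dilation {z : ℂ} (hz : z ∈ ball (0 : ℂ) 1) :
    ∃ (ρ : ℝ) (z₁ : ℂ), 0 < ρ ∧ 1 < ρ⁻¹ ∧ ‖z₁‖ < 1 ∧ ρ * z₁ = z := by
  rw [mem_ball_zero_iff] at hz
  have hρ : 0 < (1 + ‖z‖) / 2 := by positivity
  refine ⟨(1 + ‖z‖) / 2, z / ((1 + ‖z‖) / 2 : ℝ), hρ, (one_lt_inv₀ hρ).2 (by linarith), ?_,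
    mul_div_cancel₀ _ (by exact_mod_cast hρ.ne')⟩
  rw [norm_div, Complex.norm_real, Real.norm_of_nonneg hρ.le, div_lt_one hρ]
  linarith

theorem mapsTo_dilation {ρ : ℝ} (hρ : 0 < ρ) :
    MapsTo (fun w : ℂ => ρ * w) (ball 0 ρ⁻¹) (ball 0 1) := fun w hw => by
  rw [mem_ball_zero_iff] at hw ⊢
  rw [norm_mul, Complex.norm_real, Real.norm_of_nonneg hρ.le]
  calc ρ * ‖w‖ < ρ * ρ⁻¹ := mul_lt_mul_of_pos_left hw hρ
    _ = 1 := mul_inv_cancel₀ hρ.ne'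

theorem re_one_add_dilation_pos (hΓ : DifferentiableOn ℂ Γ (ball 0 1))
    (hΓpos : ∀ w ∈ ball (0 : ℂ) 1, 0 < (1 + w * deriv Γ w).re) {ρ : ℝ} (hρ : 0 < ρ) {w : ℂ}
    (hw : w ∈ ball (0 : ℂ) ρ⁻¹) : 0 < (1 + w * deriv (fun w => Γ (ρ * w)) w).re := by
  have h1 := mapsTo_dilation hρ hw
  have h2 : HasDerivAt (fun w => Γ (ρ * w)) (deriv Γ (ρ * w) * ρ) w :=
    HasDerivAt.comp w (hΓ.differentiableAt (isOpen_ball.mem_nhds h1)).hasDerivAt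
      (by simpa using (hasDerivAt_id w).const_mul (ρ : ℂ))
  rw [h2.deriv]
  convert hΓpos _ h1 using 2
  ring

/-- The principal logarithms in `logValue` fit together to a holomorphic branch, because their
arguments stay in the slit plane. -/
theorem isLogRatio_logValue {f : ℂ → ℂ} (hf : DifferentiableOn ℂ f (ball 0 1)) (hf0 : f 0 = 0)
    (hX : ‖X‖ = 1) (hΓ : DifferentiableOn ℂ Γ (ball 0 1)) (hΓ0 : Γ 0 = 0)
    (hΓpos : ∀ w ∈ ball (0 : ℂ) 1, 0 < (1 + w * deriv Γ w).re)
    (hP : DifferentiableOn ℂ P (ball 0 1)) (hP0 : P 0 = 1)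
    (hPpos : ∀ w ∈ ball (0 : ℂ) 1, 0 < (P w - 1 / 2).re)
    (hfd : ∀ w ∈ ball (0 : ℂ) 1, deriv f w = (X + (1 - X) * P w) * exp (Γ w)) :
    IsLogRatio f fun z => logValue X (fun t => Γ (t * z)) (fun t => P (t * z)) := by
  have hslit : ∀ z ∈ ball (0 : ℂ) 1,
      (∫ t in (0 : ℝ)..1, exp (Γ (t * z))) / exp (Γ z) ∈ slitPlane ∧
      X + (1 - X) * ((∫ t in (0 : ℝ)..1, P (t * z) * exp (Γ (t * z))) /
        ∫ t in (0 : ℝ)..1, exp (Γ (t * z))) ∈ slitPlane := by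
    intro z hz
    obtain ⟨ρ, z₁, hρ, hρ1, hz₁, rfl⟩ := exists_dilation hz
    have hm := mapsTo_dilation hρ
    have hin : ∀ w : ℂ, ‖w‖ ≤ 1 → w ∈ ball (0 : ℂ) ρ⁻¹ := fun w hw =>
      mem_ball_zero_iff.2 (hw.trans_lt hρ1)
    have := logValue_mem_slitPlane hρ1 (Γ := fun w => Γ (ρ * w)) (P := fun w => P (ρ * w))
      (hΓ.comp (by fun_prop) hm) (fun w hw => re_one_add_dilation_pos hΓ hΓpos hρ (hin w hw))
      (hP.comp (by fun_prop) hm) (fun w hw => hPpos _ (hm (hin w hw))) hX.le hz₁.le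
    simpa only [mul_left_comm] using this
  have hint : ∀ h : ℂ → ℂ, DifferentiableOn ℂ h (ball 0 1) →
      DifferentiableOn ℂ (fun z => ∫ t in (0 : ℝ)..1, h (t * z)) (ball 0 1) := fun h hh => by
    obtain ⟨α', hα⟩ := hasDerivAt_average 0 hh
    simp only [pow_zero, one_mul] at hα
    exact fun z hz => (hα z hz).1.differentiableAt.differentiableWithinAt
  have hA := hint _ hΓ.cexp
  have hB := hint _ (hP.mul hΓ.cexp)
  have hAne : ∀ z ∈ ball (0 : ℂ) 1, (∫ t in (0 : ℝ)..1, exp (Γ (t * z))) ≠ 0 := fun z hz h => by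
    have := slitPlane_ne_zero (hslit z hz).1
    rw [h, zero_div] at this
    exact this rfl
  refine ⟨?_, ?_, ?_⟩
  · simp only [logValue, ofReal_one, one_mul]
    refine (hΓ.add
      ((hA.fun_div hΓ.cexp fun z _ => exp_ne_zero _).clog fun z hz => (hslit z hz).1)).add
      ((((hB.fun_div hA hAne).const_mul (1 - X)).const_add X).clog fun z hz => (hslit z hz).2)
  · simp [logValue, hΓ0, hP0]
  · intro z hz hz0
    have hseg : ∀ t ∈ Icc (0 : ℝ) 1, (t : ℂ) * z ∈ ball (0 : ℂ) 1 := fun t ht => by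
      rw [mem_ball_zero_iff] at hz ⊢
      rw [norm_mul, Complex.norm_real, Real.norm_of_nonneg ht.1]
      nlinarith [norm_nonneg z, ht.2]
    have c1 : ContinuousOn (fun t : ℝ => Γ (t * z)) (Icc 0 1) :=
      hΓ.continuousOn.comp (by fun_prop) hseg
    have c2 : ContinuousOn (fun t : ℝ => P (t * z)) (Icc 0 1) :=
      hP.continuousOn.comp (by fun_prop) hseg
    have i1 : IntervalIntegrable (fun t : ℝ => exp (Γ (t * z))) MeasureTheory.volume 0 1 :=
      c1.cexp.intervalIntegrable_of_Icc zero_le_one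
    have i2 : IntervalIntegrable (fun t : ℝ => P (t * z) * exp (Γ (t * z)))
        MeasureTheory.volume 0 1 := (c2.mul c1.cexp).intervalIntegrable_of_Icc zero_le_one
    have hftc : ∫ t in (0 : ℝ)..1, (X * exp (Γ (t * z)) +
        (1 - X) * (P (t * z) * exp (Γ (t * z)))) * z = f z := by
      have := intervalIntegral.integral_eq_sub_of_hasDerivAt (a := 0) (b := 1)
        (f := fun t : ℝ => f (t * z)) (f' := fun t : ℝ => (X * exp (Γ (t * z)) +
          (1 - X) * (P (t * z) * exp (Γ (t * z)))) * z) (fun t ht => by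
          rw [uIcc_of_le zero_le_one] at ht
          have h1 : HasDerivAt (fun t : ℂ => f (t * z)) (deriv f (t * z) * z) (t : ℂ) :=
            HasDerivAt.comp (t : ℂ)
              (hf.differentiableAt (isOpen_ball.mem_nhds (hseg t ht))).hasDerivAt
              (by simpa using (hasDerivAt_id (t : ℂ)).mul_const z)
          refine h1.comp_ofReal.congr_deriv ?_
          rw [hfd _ (hseg t ht)]
          ring) (((i1.const_mul X).add (i2.const_mul (1 - X))).mul_const z)
      simpa [hf0] using this
    rw [intervalIntegral.integral_mul_const, intervalIntegral.integral_add (i1.const_mul X)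
      (i2.const_mul (1 - X)), intervalIntegral.integral_const_mul,
      intervalIntegral.integral_const_mul] at hftc
    simp only [logValue, ofReal_one, one_mul]
    rw [exp_add, exp_add, exp_log (slitPlane_ne_zero (hslit z hz).1),
      exp_log (slitPlane_ne_zero (hslit z hz).2), ← hftc]
    have h1 := hAne z hz
    have h2 := exp_ne_zero (Γ z)
    generalize (∫ t in (0 : ℝ)..1, exp (Γ (t * z))) = A at h1 ⊢
    generalize (∫ t in (0 : ℝ)..1, P (t * z) * exp (Γ (t * z))) = B
    field_simp

end Dilation

/-- Existence of the branch of `log (f z / z)`, and the reduction of a lower bound for it to the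
extremal functions. -/
theorem isLogRatio_and_le_of_extremal {f : ℂ → ℂ} (hf : f ∈ CloseToConvex) :
    IsLogRatio f (logRatio f) ∧ ∀ {c : ℂ} {m : ℝ}, c ≠ 0 →
      (∀ X ζ, ‖X‖ = 1 → ‖ζ‖ < 1 → m ≤ (c * extremalLog (1 - X * ζ) (1 - ζ)).re) →
      ∀ z ∈ ball (0 : ℂ) 1, m ≤ (c * logRatio f z).re := by
  obtain ⟨X, Γ, P, hX, hΓ, hΓ0, hΓpos, hP, hP0, hPpos, hfd⟩ :=
    exists_deriv_eq_of_mem_closeToConvex hf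
  have hL := isLogRatio_logValue hf.1.1 hf.1.2.1 hX hΓ hΓ0 hΓpos hP hP0 hPpos hfd
  refine ⟨hL.logRatio, fun {c m} hc hm z hz => ?_⟩
  rcases eq_or_ne z 0 with rfl | hz0
  · have h1 := hm 1 0 (by simp) (by simp)
    have h2 : extremalLog 1 1 = 0 := by norm_num [extremalLog]
    simpa [h2, hL.logRatio.2.1] using h1
  · rw [hL.logRatio.eqOn hL hz]
    obtain ⟨ρ, z₁, hρ, hρ1, hz₁, rfl⟩ := exists_dilation hz
    have hmap := mapsTo_dilation hρ
    have hin : ∀ w : ℂ, ‖w‖ ≤ 1 → w ∈ ball (0 : ℂ) ρ⁻¹ := fun w hw =>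
      mem_ball_zero_iff.2 (hw.trans_lt hρ1)
    have := le_logValue_of_extremal hρ1 (Γ := fun w => Γ (ρ * w)) (P := fun w => P (ρ * w))
      (hΓ.comp (by fun_prop) hmap) (by simpa using hΓ0)
      (fun w hw => re_one_add_dilation_pos hΓ hΓpos hρ (hin w hw))
      (hP.comp (by fun_prop) hmap) (by simpa using hP0) (fun w hw => hPpos _ (hmap (hin w hw)))
      (right_ne_zero_of_mul hz0) hz₁ hc hX fun X ζ h1 h2 => hm X ζ h1 (h2.trans_lt hz₁)
    simpa only [mul_left_comm] using this

/-! ### The range of the extremal functions -/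

section Range

variable {u v : ℂ}

theorem sq_norm_lt_two_mul_re (hu : ‖1 - u‖ < 1) : u.re ^ 2 + u.im ^ 2 < 2 * u.re := by
  have h := Complex.sq_norm (1 - u)
  rw [normSq_apply] at h
  simp only [sub_re, sub_im, one_re, one_im] at h
  nlinarith [norm_nonneg (1 - u)]

theorem re_pos_of_norm_one_sub_lt (hu : ‖1 - u‖ < 1) : 0 < u.re := by
  nlinarith [sq_norm_lt_two_mul_re hu]

theorem extremalLog_eq (hu : ‖1 - u‖ < 1) (hv : ‖1 - v‖ < 1) :
    extremalLog u v = log ((u + v) / 2) - 2 * log v := by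
  have hu0 := re_pos_of_norm_one_sub_lt hu
  have hv0 := re_pos_of_norm_one_sub_lt hv
  have hv1 : v ≠ 0 := by rintro rfl; simp at hv0
  have hs0 : 0 < ((u + v) / 2).re := by
    rw [show (u + v) / 2 = ((1 / 2 : ℝ) : ℂ) * (u + v) by push_cast; ring, re_ofReal_mul, add_re]
    linarith
  have hs1 : (u + v) / 2 ≠ 0 := by intro h; rw [h] at hs0; simp at hs0
  have a1 := abs_lt.1 (abs_arg_lt_pi_div_two_iff.2 (Or.inl hs0))
  have a2 := abs_lt.1 (abs_arg_lt_pi_div_two_iff.2 (Or.inl hv0))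
  have e : log ((u + v) / (2 * v)) = log ((u + v) / 2) - log v := by
    have hπ : v.arg ≠ Real.pi := by linarith [Real.pi_pos]
    rw [← div_div, div_eq_mul_inv, (log_mul_eq_add_log_iff hs1 (inv_ne_zero hv1)).2, log_inv _ hπ,
      sub_eq_add_neg]
    rw [arg_inv, if_neg hπ]
    constructor <;> linarith
  rw [extremalLog, e]
  ring

theorem exp_extremalLog (hu : ‖1 - u‖ < 1) (hv : ‖1 - v‖ < 1) :
    exp (extremalLog u v) = (u + v) / (2 * v ^ 2) := by
  have hu0 := re_pos_of_norm_one_sub_lt hu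
  have hv0 := re_pos_of_norm_one_sub_lt hv
  have hv1 : v ≠ 0 := by rintro rfl; simp at hv0
  have hs1 : u + v ≠ 0 := by
    intro h
    have := congrArg re h
    simp at this
    linarith
  rw [extremalLog, exp_add, exp_neg, exp_log hv1,
    exp_log (div_ne_zero hs1 (mul_ne_zero two_ne_zero hv1))]
  field_simp

theorem abs_im_extremalLog_lt (hu : ‖1 - u‖ < 1) (hv : ‖1 - v‖ < 1) :
    |(extremalLog u v).im| < 3 * Real.pi / 2 := by
  have hu0 := re_pos_of_norm_one_sub_lt hu
  have hv0 := re_pos_of_norm_one_sub_lt hv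
  have hs0 : 0 < ((u + v) / 2).re := by
    rw [show (u + v) / 2 = ((1 / 2 : ℝ) : ℂ) * (u + v) by push_cast; ring, re_ofReal_mul, add_re]
    linarith
  have a1 := abs_lt.1 (abs_arg_lt_pi_div_two_iff.2 (Or.inl hs0))
  have a2 := abs_lt.1 (abs_arg_lt_pi_div_two_iff.2 (Or.inl hv0))
  rw [extremalLog_eq hu hv, sub_im, log_im, show (2 : ℂ) * log v = ((2 : ℝ) : ℂ) * log v by simp,
    im_ofReal_mul, log_im, abs_lt]
  constructor <;> linarith

/-- In terms of `w = exp (extremalLog u v) = (u + v) / (2 v²)` this says `|1 / w - 1| ≤ 3`. -/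
theorem norm_two_mul_sq_sub_le (hu : ‖1 - u‖ < 1) (hv : ‖1 - v‖ < 1) :
    ‖2 * v ^ 2 - (u + v)‖ ≤ 3 * ‖u + v‖ := by
  have h1 := sq_norm_lt_two_mul_re hu
  have h2 := sq_norm_lt_two_mul_re hv
  refine le_of_sq_le_sq ?_ (by positivity)
  rw [mul_pow, Complex.sq_norm, Complex.sq_norm, normSq_apply, normSq_apply]
  simp only [pow_two, sub_re, sub_im, add_re, add_im, mul_re, mul_im, re_ofNat, im_ofNat]
  obtain ⟨a, b⟩ := u
  obtain ⟨c, d⟩ := v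
  simp only at h1 h2 ⊢
  -- A sum of squares in `p = 1 - u`, `q = 1 - v`: twice `|p (3 - q̄) - (3 - q)|²` and multiples
  -- of `1 - |p|²` and `1 - |q|²`.
  have hα : 0 ≤ (2 + c) ^ 2 + d ^ 2 - 4 := by nlinarith
  have hβ : 0 ≤ 2 + ((1 - c) ^ 2 + d ^ 2) - 3 * (1 - c) := by nlinarith
  nlinarith [mul_nonneg hα (sub_nonneg.2 h1.le), mul_nonneg hβ (sub_nonneg.2 h2.le),
    sq_nonneg ((1 - a) * (2 + c) - b * d - (2 + c)), sq_nonneg ((1 - a) * d + b * (2 + c) + d)]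

/-- The disk `|1 / w - 1| ≤ 3` in polar coordinates: `1 / |w|` is at most the positive root of
`s² - 2 s cos (arg w) - 8`. -/
theorem neg_log_le_re_extremalLog (hu : ‖1 - u‖ < 1) (hv : ‖1 - v‖ < 1) :
    -Real.log (Real.cos (extremalLog u v).im + √(Real.cos (extremalLog u v).im ^ 2 + 8)) ≤
      (extremalLog u v).re := by
  set L := extremalLog u v with hL
  have hv0 := re_pos_of_norm_one_sub_lt hv
  have hv1 : v ≠ 0 := by rintro rfl; simp at hv0
  have hs1 : u + v ≠ 0 := by
    intro h
    have := congrArg re h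
    simp at this
    linarith [re_pos_of_norm_one_sub_lt hu]
  have h1 := norm_two_mul_sq_sub_le hu hv
  have h20 : 2 * v ^ 2 ≠ 0 := mul_ne_zero two_ne_zero (pow_ne_zero 2 hv1)
  have h2 : ‖1 - exp L‖ ≤ 3 * ‖exp L‖ := by
    rw [hL, exp_extremalLog hu hv, one_sub_div h20, norm_div, norm_div, ← mul_div_assoc]
    gcongr
  have h3 : (1 - exp L).re ^ 2 + (1 - exp L).im ^ 2 ≤ 9 * Real.exp L.re ^ 2 := by
    have := pow_le_pow_left₀ (norm_nonneg _) h2 2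
    rw [mul_pow, Complex.sq_norm, normSq_apply, Complex.norm_exp] at this
    nlinarith
  simp only [sub_re, sub_im, one_re, one_im, exp_re, exp_im] at h3
  set ρ := Real.exp L.re with hρ
  have hρ0 : 0 < ρ := Real.exp_pos _
  set t := Real.cos L.im
  have h4 : Real.sin L.im ^ 2 = 1 - t ^ 2 := Real.sin_sq _
  have h5 : 0 ≤ 8 * ρ ^ 2 + 2 * ρ * t - 1 := by nlinarith
  have hq := Real.sq_sqrt (show 0 ≤ t ^ 2 + 8 by positivity)
  have hq0 := Real.sqrt_nonneg (t ^ 2 + 8)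
  set q := √(t ^ 2 + 8)
  have hq1 : |t| < q := abs_lt_of_sq_lt_sq (by linarith) hq0
  have hq2 := abs_lt.1 hq1
  have h6 : 0 < t + q := by linarith
  have h7 : 1 ≤ ρ * (t + q) := by
    by_contra hcon
    push Not at hcon
    nlinarith [mul_pos hρ0 h6, mul_pos hρ0 (show 0 < q - t by linarith)]
  have h8 : Real.log (1 / (t + q)) ≤ Real.log ρ :=
    Real.log_le_log (by positivity) ((div_le_iff₀ h6).2 h7)
  rwa [one_div, Real.log_inv, hρ, Real.log_exp] at h8

/-- The key estimate behind `re_exp_extremalLog_le`, in polar coordinates: `v = ρ (C - i S)` and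
`-(X + i Y)` is `u` rotated by twice the argument of `v̄`. -/
theorem le_of_mem_rotated_disk {C S ρ X Y : ℝ} (hC : 0 < C) (hS : 0 < S) (hρ : 0 < ρ)
    (hCS : C ^ 2 + S ^ 2 = 1) (hρC : ρ < 2 * C) (hX : 0 < X) (hY : ρ * S < Y)
    (hdisk : X ^ 2 + Y ^ 2 + 2 * ((2 * C ^ 2 - 1) * X + 2 * S * C * Y) < 0) :
    ρ ^ 2 + ρ * C ≤ X := by
  have hSC := mul_pos hS hC
  have h1 : X ^ 2 - 2 * (1 - 2 * C ^ 2) * X + S ^ 2 * (ρ ^ 2 + 4 * C * ρ) < 0 := by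
    nlinarith [mul_pos hρ hS]
  have hc : 0 < 1 - 2 * C ^ 2 := by
    by_contra hcon
    push Not at hcon
    have : 0 < S ^ 2 * (ρ ^ 2 + 4 * C * ρ) := by positivity
    nlinarith
  have hS2 : S ^ 2 = 1 - C ^ 2 := by linarith
  rw [hS2] at h1
  set c := 1 - 2 * C ^ 2 with hcdef
  by_contra hcon
  push Not at hcon
  rcases le_total (ρ ^ 2 + ρ * C) c with hle | hle
  · have h2 : 0 < ρ * (2 * C + (4 * C ^ 2 - 1) * ρ + 2 * C * ρ ^ 2 + ρ ^ 3) := by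
      refine mul_pos hρ ?_
      have : 0 < 4 * C ^ 2 * ρ + 2 * C * ρ ^ 2 + ρ ^ 3 := by positivity
      nlinarith
    have h3 : (ρ ^ 2 + ρ * C) ^ 2 - 2 * c * (ρ ^ 2 + ρ * C) + (1 - C ^ 2) * (ρ ^ 2 + 4 * C * ρ) =
        ρ * (2 * C + (4 * C ^ 2 - 1) * ρ + 2 * C * ρ ^ 2 + ρ ^ 3) := by rw [hcdef]; ring
    nlinarith
  · have h2 : c * c ≤ (1 - C ^ 2) * (ρ ^ 2 + 4 * C * ρ) :=
      mul_le_mul (by rw [hcdef]; nlinarith) (by nlinarith) hc.le (by nlinarith)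
    nlinarith [sq_nonneg (X - c)]

theorem add_div_two_mul_sq_eq {C S ρ : ℝ} (hρ : 0 < ρ) (hCS : C ^ 2 + S ^ 2 = 1)
    (hv : v = ρ * ⟨C, -S⟩) :
    (u + v) / (2 * v ^ 2) = ((1 / (2 * ρ ^ 2) : ℝ) : ℂ) *
      ⟨ρ * C - -(u.re * (C ^ 2 - S ^ 2) - u.im * (2 * S * C)),
        ρ * S - -(u.re * (2 * S * C) + u.im * (C ^ 2 - S ^ 2))⟩ := by
  have hee : (⟨C, -S⟩ : ℂ) * ⟨C, S⟩ = 1 := by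
    apply Complex.ext
    · simp only [mul_re, one_re]; linarith
    · simp only [mul_im, one_im]; ring
  have hnum : (⟨ρ * C - -(u.re * (C ^ 2 - S ^ 2) - u.im * (2 * S * C)),
      ρ * S - -(u.re * (2 * S * C) + u.im * (C ^ 2 - S ^ 2))⟩ : ℂ) =
      u * ⟨C, S⟩ ^ 2 + ρ * ⟨C, S⟩ := by
    apply Complex.ext
    · simp only [pow_two, mul_re, mul_im, add_re, ofReal_re, ofReal_im]
      ring
    · simp only [pow_two, mul_re, mul_im, add_im, ofReal_re, ofReal_im]
      ring
  have hρc : (ρ : ℂ) ≠ 0 := by exact_mod_cast hρ.ne'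
  rw [hnum, hv]
  generalize (⟨C, -S⟩ : ℂ) = e at hee ⊢
  generalize (⟨C, S⟩ : ℂ) = e' at hee ⊢
  have he : e ≠ 0 := left_ne_zero_of_mul_eq_one hee
  obtain rfl : e' = e⁻¹ := eq_inv_of_mul_eq_one_right hee
  push_cast
  field_simp

/-- For arguments beyond `π` the range of `exp (extremalLog u v)` is smaller: it lies in a
half-plane. -/
theorem re_exp_extremalLog_le (hu : ‖1 - u‖ < 1) (hv : ‖1 - v‖ < 1)
    (h : Real.pi < (extremalLog u v).im) : (exp (extremalLog u v)).re ≤ -(1 / 2) := by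
  have hu1 := sq_norm_lt_two_mul_re hu
  have hv1 := sq_norm_lt_two_mul_re hv
  have hu0 := re_pos_of_norm_one_sub_lt hu
  have hv0 := re_pos_of_norm_one_sub_lt hv
  have hvne : v ≠ 0 := by rintro rfl; simp at hv0
  have hs0 : 0 < ((u + v) / 2).re := by
    rw [show (u + v) / 2 = ((1 / 2 : ℝ) : ℂ) * (u + v) by push_cast; ring, re_ofReal_mul, add_re]
    linarith
  have a1 := abs_lt.1 (abs_arg_lt_pi_div_two_iff.2 (Or.inl hs0))
  have hlt := (abs_lt.1 (abs_im_extremalLog_lt hu hv)).2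
  have hvim : v.im < 0 := by
    rw [← arg_neg_iff]
    have := h
    rw [extremalLog_eq hu hv, sub_im, log_im,
      show (2 : ℂ) * log v = ((2 : ℝ) : ℂ) * log v by simp, im_ofReal_mul, log_im] at this
    linarith
  have hexp := exp_extremalLog hu hv
  have hre : (exp (extremalLog u v)).re < 0 := by
    rw [exp_re]
    exact mul_neg_of_pos_of_neg (Real.exp_pos _)
      (Real.cos_neg_of_pi_div_two_lt_of_lt (by linarith [Real.pi_pos]) (by linarith))
  have him : (exp (extremalLog u v)).im < 0 := by
    rw [exp_im]
    refine mul_neg_of_pos_of_neg (Real.exp_pos _) ?_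
    rw [← neg_neg (Real.sin _), ← Real.sin_sub_pi, neg_lt_zero]
    exact Real.sin_pos_of_pos_of_lt_pi (by linarith) (by linarith [Real.pi_pos])
  rw [hexp] at hre him ⊢
  set ρ := ‖v‖ with hρ
  have hρ0 : 0 < ρ := norm_pos_iff.2 hvne
  have hρ2 : ρ ^ 2 = v.re ^ 2 + v.im ^ 2 := by rw [hρ, Complex.sq_norm, normSq_apply]; ring
  set C := v.re / ρ with hC
  set S := -v.im / ρ with hS
  have hvre : v.re = ρ * C := by rw [hC]; field_simp
  have hvim' : v.im = -(ρ * S) := by rw [hS]; field_simp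
  have hC0 : 0 < C := div_pos hv0 hρ0
  have hS0 : 0 < S := div_pos (neg_pos.2 hvim) hρ0
  have hCS : C ^ 2 + S ^ 2 = 1 := by
    rw [hC, hS, div_pow, div_pow, ← add_div, neg_sq, ← hρ2, div_self (by positivity)]
  -- The rotated point `u`.
  set X := -(u.re * (C ^ 2 - S ^ 2) - u.im * (2 * S * C)) with hX
  set Y := -(u.re * (2 * S * C) + u.im * (C ^ 2 - S ^ 2)) with hY
  have hw : (u + v) / (2 * v ^ 2) = ((1 / (2 * ρ ^ 2) : ℝ) : ℂ) * ⟨ρ * C - X, ρ * S - Y⟩ :=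
    add_div_two_mul_sq_eq hρ0 hCS (Complex.ext (by simp [hvre]) (by simp [hvim']))
  rw [hw, re_ofReal_mul] at hre ⊢
  rw [hw, im_ofReal_mul] at him
  have hk : 0 < 1 / (2 * ρ ^ 2) := by positivity
  have hX0 : ρ * C < X := by
    have := neg_of_mul_neg_right hre hk.le
    simp only at this; linarith
  have hY0 : ρ * S < Y := by
    have := neg_of_mul_neg_right him hk.le
    simp only at this; linarith
  have hXY : X ^ 2 + Y ^ 2 = u.re ^ 2 + u.im ^ 2 := by
    rw [hX, hY]
    linear_combination ((u.re ^ 2 + u.im ^ 2) * (C ^ 2 + S ^ 2 + 1)) * hCS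
  have hXY' : (2 * C ^ 2 - 1) * X + 2 * S * C * Y = -u.re := by
    rw [hX, hY, show 2 * C ^ 2 - 1 = C ^ 2 - S ^ 2 by linarith]
    linear_combination (-u.re * (C ^ 2 + S ^ 2 + 1)) * hCS
  have key := le_of_mem_rotated_disk (X := X) (Y := Y) hC0 hS0 hρ0 hCS
    (by nlinarith) (by nlinarith) hY0 (by rw [hXY, hXY']; linarith)
  have : 1 / (2 * ρ ^ 2) * (ρ * C - X) ≤ 1 / (2 * ρ ^ 2) * -ρ ^ 2 :=
    mul_le_mul_of_nonneg_left (by linarith) hk.le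
  refine this.trans_eq ?_
  field_simp

theorem extremalLog_conj (hu : ‖1 - u‖ < 1) (hv : ‖1 - v‖ < 1) :
    extremalLog (starRingEnd ℂ u) (starRingEnd ℂ v) = starRingEnd ℂ (extremalLog u v) := by
  have hcn : ∀ {w : ℂ}, ‖1 - w‖ < 1 → ‖1 - starRingEnd ℂ w‖ < 1 := fun {w} hw => by
    rwa [← map_one (starRingEnd ℂ), ← map_sub, RCLike.norm_conj]
  have harg : ∀ {w : ℂ}, 0 < w.re → w.arg ≠ Real.pi := fun {w} hw => by
    have := abs_lt.1 (abs_arg_lt_pi_div_two_iff.2 (Or.inl hw))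
    linarith [Real.pi_pos]
  have hs0 : 0 < ((u + v) / 2).re := by
    rw [show (u + v) / 2 = ((1 / 2 : ℝ) : ℂ) * (u + v) by push_cast; ring, re_ofReal_mul, add_re]
    linarith [re_pos_of_norm_one_sub_lt hu, re_pos_of_norm_one_sub_lt hv]
  rw [extremalLog_eq hu hv, extremalLog_eq (hcn hu) (hcn hv), map_sub, map_mul,
    ← log_conj _ (harg hs0), ← log_conj _ (harg (re_pos_of_norm_one_sub_lt hv)), map_div₀, map_add,
    show starRingEnd ℂ 2 = 2 from conj_ofNat 2]

/-- The half-plane `Re w ≤ -1/2` in polar coordinates. -/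
theorem neg_log_le_re_extremalLog_of_pi_lt (hu : ‖1 - u‖ < 1) (hv : ‖1 - v‖ < 1)
    (h : Real.pi < |(extremalLog u v).im|) :
    -Real.log 2 - Real.log (-Real.cos (extremalLog u v).im) ≤ (extremalLog u v).re := by
  have hre : (exp (extremalLog u v)).re ≤ -(1 / 2) := by
    rcases lt_abs.1 h with h1 | h1
    · exact re_exp_extremalLog_le hu hv h1
    · have hcn : ∀ {w : ℂ}, ‖1 - w‖ < 1 → ‖1 - starRingEnd ℂ w‖ < 1 := fun {w} hw => by
        rwa [← map_one (starRingEnd ℂ), ← map_sub, RCLike.norm_conj]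
      have := re_exp_extremalLog_le (hcn hu) (hcn hv) (by
        rwa [extremalLog_conj hu hv, conj_im])
      rwa [extremalLog_conj hu hv, exp_conj, conj_re] at this
  rw [exp_re] at hre
  set L := extremalLog u v
  have hc : 0 < -Real.cos L.im := by nlinarith [Real.exp_pos L.re]
  have h1 : 1 / (2 * -Real.cos L.im) ≤ Real.exp L.re := by
    rw [div_le_iff₀ (by positivity)]
    nlinarith
  have h2 := Real.log_le_log (by positivity) h1
  rw [Real.log_exp, one_div, Real.log_inv, Real.log_mul two_ne_zero hc.ne'] at h2
  linarith

end Range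

/-! ### Minimization in the argument -/

section Calculus

open Real

theorem hasDerivAt_neg_log_cos_add_sqrt (b t : ℝ) :
    HasDerivAt (fun t => -Real.log (Real.cos t + √(Real.cos t ^ 2 + 8)) - b * t)
      (Real.sin t / √(Real.cos t ^ 2 + 8) - b) t := by
  have hq : 0 < √(Real.cos t ^ 2 + 8) := Real.sqrt_pos.2 (by positivity)
  have hq2 := Real.sq_sqrt (show 0 ≤ Real.cos t ^ 2 + 8 by positivity)
  have hpos : 0 < Real.cos t + √(Real.cos t ^ 2 + 8) := by
    nlinarith [Real.neg_one_le_cos t, Real.cos_le_one t]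
  have h1 : HasDerivAt (fun t => Real.cos t ^ 2 + 8) (2 * Real.cos t * -Real.sin t) t := by
    simpa using ((Real.hasDerivAt_cos t).fun_pow 2).add_const 8
  have h2 := ((Real.hasDerivAt_cos t).add (h1.sqrt (by positivity))).log hpos.ne'
  refine (h2.neg.sub ((hasDerivAt_id t).const_mul b)).congr_deriv ?_
  simp only [Pi.add_apply]
  field_simp
  ring

theorem sin_le_mul_sqrt_iff {b t : ℝ} (hb : 0 ≤ b) (ht : 0 ≤ Real.sin t) :
    Real.sin t / √(Real.cos t ^ 2 + 8) ≤ b ↔ Real.sin t ≤ 3 * b / √(1 + b ^ 2) := by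
  have hq : 0 < √(Real.cos t ^ 2 + 8) := Real.sqrt_pos.2 (by positivity)
  have hq2 := Real.sq_sqrt (show 0 ≤ Real.cos t ^ 2 + 8 by positivity)
  have hp : 0 < √(1 + b ^ 2) := Real.sqrt_pos.2 (by positivity)
  have hp2 := Real.sq_sqrt (show 0 ≤ 1 + b ^ 2 by positivity)
  rw [div_le_iff₀ hq, le_div_iff₀ hp, ← sq_le_sq₀ ht (by positivity),
    ← sq_le_sq₀ (mul_nonneg ht hp.le) (by positivity), mul_pow, mul_pow, hq2, hp2, Real.cos_sq']
  constructor <;> intro h <;> nlinarith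

/-- The value of `-log (cos t + √(cos² t + 8)) - b t` at its critical point in `[0, π / 2]`. -/
noncomputable def interiorMin (b : ℝ) : ℝ :=
  -(1 / 2) * Real.log (2 * (5 - 4 * b ^ 2 + 3 * √(1 - 8 * b ^ 2)) / (1 + b ^ 2))
    - b * Real.arctan (3 * b / √(1 - 8 * b ^ 2))

/-- For `b ≥ 0`, the minimum over `[π, 3π/2)` of `-log 2 - log (-cos t) - b t`. -/
noncomputable def boundaryMin (b : ℝ) : ℝ :=
  1 / 2 * Real.log (1 + b ^ 2) - Real.log 2 - b * (Real.arctan b + π)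

theorem sin_arctan_div {b : ℝ} (h : 8 * b ^ 2 < 1) :
    Real.sin (Real.arctan (3 * b / √(1 - 8 * b ^ 2))) = 3 * b / √(1 + b ^ 2) ∧
    Real.cos (Real.arctan (3 * b / √(1 - 8 * b ^ 2))) = √(1 - 8 * b ^ 2) / √(1 + b ^ 2) := by
  have hR : 0 < √(1 - 8 * b ^ 2) := Real.sqrt_pos.2 (by linarith)
  have hR2 := Real.sq_sqrt (show 0 ≤ 1 - 8 * b ^ 2 by linarith)
  have hp : 0 < √(1 + b ^ 2) := Real.sqrt_pos.2 (by positivity)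
  have e : √(1 + (3 * b / √(1 - 8 * b ^ 2)) ^ 2) = √(1 + b ^ 2) / √(1 - 8 * b ^ 2) := by
    rw [← Real.sqrt_div (by positivity)]
    congr 1
    have : 1 - 8 * b ^ 2 ≠ 0 := by linarith
    rw [div_pow, hR2, eq_div_iff this, add_mul, div_mul_cancel₀ _ this]
    ring
  rw [Real.sin_arctan, Real.cos_arctan, e]
  generalize √(1 - 8 * b ^ 2) = R at hR
  constructor <;> field_simp

theorem log_five_sub_eq {b : ℝ} (h : 8 * b ^ 2 ≤ 1) :
    Real.log (5 - 4 * b ^ 2 + 3 * √(1 - 8 * b ^ 2)) =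
      2 * Real.log (√(1 - 8 * b ^ 2) + 3) - Real.log 2 := by
  have hR := Real.sqrt_nonneg (1 - 8 * b ^ 2)
  have hR2 := Real.sq_sqrt (show 0 ≤ 1 - 8 * b ^ 2 by linarith)
  have e : 5 - 4 * b ^ 2 + 3 * √(1 - 8 * b ^ 2) = (√(1 - 8 * b ^ 2) + 3) ^ 2 / 2 := by nlinarith
  rw [e, Real.log_div (by positivity) two_ne_zero, Real.log_pow]
  norm_num

theorem interiorMin_eq {b : ℝ} (h : 8 * b ^ 2 ≤ 1) :
    interiorMin b = 1 / 2 * Real.log (1 + b ^ 2) - Real.log (√(1 - 8 * b ^ 2) + 3) -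
      b * Real.arctan (3 * b / √(1 - 8 * b ^ 2)) := by
  have hR := Real.sqrt_nonneg (1 - 8 * b ^ 2)
  have hpos : 0 < 5 - 4 * b ^ 2 + 3 * √(1 - 8 * b ^ 2) := by nlinarith
  rw [interiorMin, Real.log_div (by positivity) (by positivity),
    Real.log_mul two_ne_zero hpos.ne', log_five_sub_eq h]
  ring

/-- With `t₁` the critical point, the function decreases on `[0, t₁]`, increases on
`[t₁, π - t₁]` and decreases on `[π - t₁, π]`, so its minimum is taken at `t₁` or at `π`. -/
theorem interiorMin_le {b t : ℝ} (hb : 0 ≤ b) (h : 8 * b ^ 2 < 1) (ht : t ∈ Icc 0 π) :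
    min (interiorMin b) (-Real.log 2 - b * π) ≤
      -Real.log (Real.cos t + √(Real.cos t ^ 2 + 8)) - b * t := by
  set F : ℝ → ℝ := fun t => -Real.log (Real.cos t + √(Real.cos t ^ 2 + 8)) - b * t with hF
  set t₁ := Real.arctan (3 * b / √(1 - 8 * b ^ 2)) with ht₁
  obtain ⟨hsin, hcos⟩ := sin_arctan_div h
  rw [← ht₁] at hsin hcos
  have ht₁0 : 0 ≤ t₁ := arctan_nonneg.2 (by positivity)
  have ht₁2 : t₁ < π / 2 := Real.arctan_lt_pi_div_two _
  have hcont : Continuous F := continuous_iff_continuousAt.2 fun t =>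
    (hasDerivAt_neg_log_cos_add_sqrt b t).continuousAt
  have hdec : ∀ a c, 0 ≤ a → c ≤ π → (∀ x ∈ Ioo a c, Real.sin x ≤ Real.sin t₁) →
      AntitoneOn F (Icc a c) := by
    intro a c ha hc hs
    refine antitoneOn_of_deriv_nonpos (convex_Icc _ _) hcont.continuousOn
      (fun x _ => (hasDerivAt_neg_log_cos_add_sqrt b x).differentiableAt.differentiableWithinAt) ?_
    intro x hx
    rw [interior_Icc] at hx
    rw [(hasDerivAt_neg_log_cos_add_sqrt b x).deriv, sub_nonpos, sin_le_mul_sqrt_iff hb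
      (Real.sin_nonneg_of_mem_Icc ⟨by linarith [hx.1], by linarith [hx.2]⟩), ← hsin]
    exact hs x hx
  have hF1 : F t₁ = interiorMin b := by
    have hp : 0 < √(1 + b ^ 2) := Real.sqrt_pos.2 (by positivity)
    have hp2 := Real.sq_sqrt (show 0 ≤ 1 + b ^ 2 by positivity)
    have hR2 := Real.sq_sqrt (show 0 ≤ 1 - 8 * b ^ 2 by linarith)
    have hR := Real.sqrt_nonneg (1 - 8 * b ^ 2)
    have e : √(Real.cos t₁ ^ 2 + 8) = 3 / √(1 + b ^ 2) := by
      rw [Real.sqrt_eq_iff_mul_self_eq (by positivity) (by positivity), hcos, div_pow, hR2, hp2,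
        div_mul_div_comm, ← pow_two √(1 + b ^ 2), hp2]
      field_simp
      ring
    simp only [hF]
    rw [e, interiorMin_eq h.le, hcos, ← add_div, Real.log_div (by positivity) hp.ne',
      Real.log_sqrt (by positivity)]
    ring
  have hFπ : F π = -Real.log 2 - b * π := by
    have : √((-1 : ℝ) ^ 2 + 8) = 3 := by
      rw [show (-1 : ℝ) ^ 2 + 8 = 3 ^ 2 by norm_num, Real.sqrt_sq (by norm_num)]
    simp only [hF, Real.cos_pi]
    rw [this]
    norm_num
  rw [← hF1, ← hFπ]
  change _ ≤ F t
  have hmono : ∀ x y, -(π / 2) ≤ x → x ≤ y → y ≤ π / 2 → Real.sin x ≤ Real.sin y :=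
    fun x y h1 h2 h3 => Real.sin_le_sin_of_le_of_le_pi_div_two h1 h3 h2
  rcases le_total t t₁ with h1 | h1
  · refine min_le_of_left_le (hdec 0 t₁ le_rfl (by linarith) (fun x hx => ?_) ⟨ht.1, h1⟩
      ⟨ht₁0, le_rfl⟩ h1)
    exact hmono _ _ (by linarith [hx.1, pi_pos]) hx.2.le ht₁2.le
  rcases le_total t (π - t₁) with h2 | h2
  · have hinc : MonotoneOn F (Icc t₁ (π - t₁)) := by
      refine monotoneOn_of_deriv_nonneg (convex_Icc _ _) hcont.continuousOn
        (fun x _ => (hasDerivAt_neg_log_cos_add_sqrt b x).differentiableAt.differentiableWithinAt)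
        ?_
      intro x hx
      rw [interior_Icc] at hx
      rw [(hasDerivAt_neg_log_cos_add_sqrt b x).deriv, sub_nonneg]
      have hx0 : 0 ≤ Real.sin x :=
        Real.sin_nonneg_of_mem_Icc ⟨by linarith [hx.1], by linarith [hx.2]⟩
      by_contra hcon
      push Not at hcon
      have h3 := (sin_le_mul_sqrt_iff hb hx0).1 hcon.le
      rw [← hsin] at h3
      -- Equality of the sines forces equality in the derivative.
      have h4 : Real.sin t₁ ≤ Real.sin x := by
        rcases le_total x (π / 2) with h5 | h5
        · exact hmono _ _ (by linarith) hx.1.le h5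
        · rw [← Real.sin_pi_sub x]
          exact hmono _ _ (by linarith) (by linarith [hx.2]) (by linarith)
      have h5 : Real.sin x = 3 * b / √(1 + b ^ 2) := (le_antisymm h3 h4).trans hsin
      have hp : 0 < √(1 + b ^ 2) := Real.sqrt_pos.2 (by positivity)
      have hp2 := Real.sq_sqrt (show 0 ≤ 1 + b ^ 2 by positivity)
      have e : √(Real.cos x ^ 2 + 8) = 3 / √(1 + b ^ 2) := by
        rw [Real.sqrt_eq_iff_mul_self_eq (by positivity) (by positivity), Real.cos_sq', h5, div_pow,
          hp2, div_mul_div_comm, ← pow_two √(1 + b ^ 2), hp2]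
        field_simp
        ring
      rw [e, h5] at hcon
      have : 3 * b / √(1 + b ^ 2) / (3 / √(1 + b ^ 2)) = b := by field_simp
      linarith
    exact min_le_of_left_le (hinc ⟨le_rfl, by linarith⟩ ⟨h1, h2⟩ h1)
  · refine min_le_of_right_le (hdec (π - t₁) π (by linarith) le_rfl (fun x hx => ?_) ⟨h2, ht.2⟩
      ⟨by linarith, le_rfl⟩ ht.2)
    rw [← Real.sin_pi_sub x]
    exact hmono _ _ (by linarith [hx.2, pi_pos]) (by linarith [hx.1]) ht₁2.le

theorem le_of_one_le_eight_mul_sq {b t : ℝ} (hb : 0 ≤ b) (h : 1 ≤ 8 * b ^ 2) (ht : t ∈ Icc 0 π) :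
    -Real.log 2 - b * π ≤ -Real.log (Real.cos t + √(Real.cos t ^ 2 + 8)) - b * t := by
  have hanti : AntitoneOn (fun t => -Real.log (Real.cos t + √(Real.cos t ^ 2 + 8)) - b * t)
      (Icc 0 π) := by
    refine antitoneOn_of_deriv_nonpos (convex_Icc _ _) (fun x _ =>
      (hasDerivAt_neg_log_cos_add_sqrt b x).continuousAt.continuousWithinAt)
      (fun x _ => (hasDerivAt_neg_log_cos_add_sqrt b x).differentiableAt.differentiableWithinAt) ?_
    intro x hx
    rw [interior_Icc] at hx
    rw [(hasDerivAt_neg_log_cos_add_sqrt b x).deriv, sub_nonpos, sin_le_mul_sqrt_iff hb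
      (Real.sin_nonneg_of_mem_Icc ⟨hx.1.le, hx.2.le⟩)]
    refine (Real.sin_le_one x).trans ((one_le_div (Real.sqrt_pos.2 (by positivity))).2 ?_)
    exact Real.sqrt_le_iff.2 ⟨by positivity, by nlinarith⟩
  have := hanti ht ⟨pi_pos.le, le_rfl⟩ ht.2
  have h3 : √((-1 : ℝ) ^ 2 + 8) = 3 := by
    rw [show (-1 : ℝ) ^ 2 + 8 = 3 ^ 2 by norm_num, Real.sqrt_sq (by norm_num)]
  simp only [Real.cos_pi] at this
  rw [h3] at this
  norm_num at this ⊢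
  exact this

/-- In the variable `x = tan (t - π)` the right-hand side has its minimum at `x = b`. -/
theorem boundaryMin_le {b t : ℝ} (ht : t ∈ Ico π (3 * π / 2)) :
    boundaryMin b ≤ -Real.log 2 - Real.log (-Real.cos t) - b * t := by
  set x := Real.tan (t - π) with hx
  have hτ : t - π ∈ Ioo (-(π / 2)) (π / 2) := ⟨by linarith [ht.1, pi_pos], by linarith [ht.2]⟩
  have hτx : t - π = Real.arctan x := (Real.arctan_tan hτ.1 hτ.2).symm
  have hcos : -Real.cos t = 1 / √(1 + x ^ 2) := by
    rw [← Real.cos_sub_pi, hτx, Real.cos_arctan]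
  have hlog : Real.log (-Real.cos t) = -(1 / 2 * Real.log (1 + x ^ 2)) := by
    rw [hcos, one_div, Real.log_inv, Real.log_sqrt (by positivity)]
    ring
  set h : ℝ → ℝ := fun x => 1 / 2 * Real.log (1 + x ^ 2) - b * Real.arctan x with hh
  have hd : ∀ x, HasDerivAt h ((x - b) / (1 + x ^ 2)) x := fun x => by
    have h1 : HasDerivAt (fun x : ℝ => 1 + x ^ 2) (2 * x) x := by
      simpa using ((hasDerivAt_id x).fun_pow 2).const_add 1
    refine (((h1.log (by positivity)).const_mul (1 / 2)).sub
      ((Real.hasDerivAt_arctan x).const_mul b)).congr_deriv ?_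
    field_simp
  have hc : Continuous h := continuous_iff_continuousAt.2 fun x => (hd x).continuousAt
  have key : h b ≤ h x := by
    rcases le_total b x with hbx | hbx
    · refine monotoneOn_of_deriv_nonneg (convex_Ici b) hc.continuousOn
        (fun x _ => (hd x).differentiableAt.differentiableWithinAt) (fun y hy => ?_)
        self_mem_Ici hbx hbx
      rw [interior_Ici] at hy
      rw [(hd y).deriv]
      exact div_nonneg (sub_nonneg.2 (le_of_lt hy)) (by positivity)
    · refine antitoneOn_of_deriv_nonpos (convex_Iic b) hc.continuousOn
        (fun x _ => (hd x).differentiableAt.differentiableWithinAt) (fun y hy => ?_)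
        hbx self_mem_Iic hbx
      rw [interior_Iic] at hy
      rw [(hd y).deriv]
      exact div_nonpos_of_nonpos_of_nonneg (sub_nonpos.2 (le_of_lt hy)) (by positivity)
  simp only [hh] at key
  rw [boundaryMin, hlog, show t = Real.arctan x + π by linarith]
  linarith

theorem boundaryMin_le_neg_log_two (b : ℝ) : boundaryMin b ≤ -Real.log 2 - b * π := by
  have := boundaryMin_le (b := b) (t := π) ⟨le_rfl, by linarith [pi_pos]⟩
  simpa using this

end Calculus

section Range

variable {u v : ℂ}

/-- The lower bound for the functional on the extremal functions. -/
theorem min_le_extremalLog (b : ℝ) (hu : ‖1 - u‖ < 1) (hv : ‖1 - v‖ < 1) :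
    (8 * b ^ 2 < 1 → min (interiorMin |b|) (boundaryMin |b|) ≤
      (extremalLog u v).re + b * (extremalLog u v).im) ∧
    (1 ≤ 8 * b ^ 2 → boundaryMin |b| ≤ (extremalLog u v).re + b * (extremalLog u v).im) := by
  have h1 := neg_log_le_re_extremalLog hu hv
  have h2 := neg_log_le_re_extremalLog_of_pi_lt hu hv
  have h3 := abs_im_extremalLog_lt hu hv
  have h4 : -(|b| * |(extremalLog u v).im|) ≤ b * (extremalLog u v).im := by
    rw [← abs_mul]; exact neg_abs_le _
  rw [← Real.cos_abs] at h1
  rw [← Real.cos_abs] at h2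
  set t := |(extremalLog u v).im|
  have hb := boundaryMin_le_neg_log_two |b|
  rw [← sq_abs b]
  rcases le_or_gt t Real.pi with ht | ht
  · constructor
    · intro h
      have := interiorMin_le (abs_nonneg b) h ⟨abs_nonneg _, ht⟩
      have h5 := min_le_min_left (interiorMin |b|) hb
      linarith
    · intro h
      have := le_of_one_le_eight_mul_sq (abs_nonneg b) h ⟨abs_nonneg _, ht⟩
      linarith
  · have h5 := boundaryMin_le (b := |b|) ⟨ht.le, h3⟩
    have h6 := h2 ht
    exact ⟨fun _ => min_le_of_right_le (by linarith), fun _ => by linarith⟩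

end Range

/-! ### The threshold -/

theorem arctan_le_of_nonneg {x : ℝ} (hx : 0 ≤ x) :
    Real.arctan x ≤ x - x ^ 3 / 3 + x ^ 5 / 5 := by
  have hd : ∀ x : ℝ, HasDerivAt (fun x => x - x ^ 3 / 3 + x ^ 5 / 5 - Real.arctan x)
      (1 - x ^ 2 + x ^ 4 - 1 / (1 + x ^ 2)) x := fun x => by
    have h3 := (hasDerivAt_pow 3 x).div_const 3
    have h5 := (hasDerivAt_pow 5 x).div_const 5
    refine ((((hasDerivAt_id x).sub h3).add h5).sub (Real.hasDerivAt_arctan x)).congr_deriv ?_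
    norm_num
  have hm : MonotoneOn (fun x => x - x ^ 3 / 3 + x ^ 5 / 5 - Real.arctan x) (Ici 0) := by
    refine monotoneOn_of_deriv_nonneg (convex_Ici 0)
      (fun x _ => (hd x).continuousAt.continuousWithinAt)
      (fun x _ => (hd x).differentiableAt.differentiableWithinAt) fun x _ => ?_
    rw [(hd x).deriv, show 1 - x ^ 2 + x ^ 4 - 1 / (1 + x ^ 2) = x ^ 6 / (1 + x ^ 2) by
      field_simp; ring]
    positivity
  have := hm self_mem_Ici hx hx
  simp at this
  linarith

theorem le_arctan_of_nonneg {x : ℝ} (hx : 0 ≤ x) :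
    x - x ^ 3 / 3 + x ^ 5 / 5 - x ^ 7 / 7 ≤ Real.arctan x := by
  have hd : ∀ x : ℝ, HasDerivAt
      (fun x => Real.arctan x - (x - x ^ 3 / 3 + x ^ 5 / 5 - x ^ 7 / 7))
      (1 / (1 + x ^ 2) - (1 - x ^ 2 + x ^ 4 - x ^ 6)) x := fun x => by
    have h3 := (hasDerivAt_pow 3 x).div_const 3
    have h5 := (hasDerivAt_pow 5 x).div_const 5
    have h7 := (hasDerivAt_pow 7 x).div_const 7
    refine ((Real.hasDerivAt_arctan x).sub
      ((((hasDerivAt_id x).sub h3).add h5).sub h7)).congr_deriv ?_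
    norm_num
  have hm : MonotoneOn (fun x => Real.arctan x - (x - x ^ 3 / 3 + x ^ 5 / 5 - x ^ 7 / 7))
      (Ici 0) := by
    refine monotoneOn_of_deriv_nonneg (convex_Ici 0)
      (fun x _ => (hd x).continuousAt.continuousWithinAt)
      (fun x _ => (hd x).differentiableAt.differentiableWithinAt) fun x _ => ?_
    rw [(hd x).deriv, show 1 / (1 + x ^ 2) - (1 - x ^ 2 + x ^ 4 - x ^ 6) = x ^ 8 / (1 + x ^ 2) by
      field_simp; ring]
    positivity
  have := hm self_mem_Ici hx hx
  simp at this
  linarith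

/-- The difference `interiorMin b - boundaryMin b`. -/
noncomputable def thresholdGap (b : ℝ) : ℝ :=
  Real.log 2 - Real.log (√(1 - 8 * b ^ 2) + 3) +
    b * (Real.pi + Real.arctan b - Real.arctan (3 * b / √(1 - 8 * b ^ 2)))

theorem thresholdGap_eq_sub {b : ℝ} (h : 8 * b ^ 2 ≤ 1) :
    thresholdGap b = interiorMin b - boundaryMin b := by
  rw [interiorMin_eq h, boundaryMin, thresholdGap]
  ring

theorem thresholdEq_iff {b : ℝ} (h : 8 * b ^ 2 ≤ 1) : ThresholdEq b ↔ thresholdGap b = 0 := by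
  rw [ThresholdEq, log_five_sub_eq h, thresholdGap]
  constructor <;> intro h <;> linarith

theorem hasDerivAt_thresholdGap {b : ℝ} (h : 8 * b ^ 2 < 1) :
    HasDerivAt thresholdGap
      (Real.pi + Real.arctan b - Real.arctan (3 * b / √(1 - 8 * b ^ 2))) b := by
  have hpos : 0 < 1 - 8 * b ^ 2 := by linarith
  have hR : 0 < √(1 - 8 * b ^ 2) := Real.sqrt_pos.2 hpos
  have hR2 := Real.sq_sqrt hpos.le
  have h1 : HasDerivAt (fun b : ℝ => √(1 - 8 * b ^ 2)) (-(8 * b) / √(1 - 8 * b ^ 2)) b := by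
    have e : HasDerivAt (fun b : ℝ => 1 - 8 * b ^ 2) (-(16 * b)) b := by
      refine (((hasDerivAt_pow 2 b).const_mul 8).const_sub 1).congr_deriv ?_
      norm_num; ring
    refine (e.sqrt hpos.ne').congr_deriv ?_
    field_simp
    ring
  have h2 := (h1.add_const 3).log (by positivity)
  have h3 := (((hasDerivAt_id b).const_mul 3).div h1 hR.ne').arctan
  refine ((h2.const_sub (Real.log 2)).add ((hasDerivAt_id b).mul
    (((Real.hasDerivAt_arctan b).const_add Real.pi).sub h3))).congr_deriv ?_
  simp only [id, Pi.div_apply, Pi.sub_apply]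
  generalize Real.arctan b = A
  generalize Real.arctan (3 * b / √(1 - 8 * b ^ 2)) = A'
  set R := √(1 - 8 * b ^ 2)
  have e1 : 1 + (3 * b / R) ^ 2 = (1 + b ^ 2) / R ^ 2 := by
    rw [div_pow, eq_div_iff (by positivity), add_mul, div_mul_cancel₀ _ (by positivity)]
    linarith
  rw [e1]
  have hb2 : 0 < 1 + b ^ 2 := by positivity
  have e2 : 8 * b / R / (R + 3) + b * (1 / (1 + b ^ 2) -
      1 / ((1 + b ^ 2) / R ^ 2) * ((3 * R - 3 * b * (-(8 * b) / R)) / R ^ 2)) = 0 := by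
    have e3 : (3 * R - 3 * b * (-(8 * b) / R)) = 3 / R := by
      field_simp
      linarith
    rw [e3]
    field_simp
    linear_combination b * hR2
  linear_combination e2

/-- The derivative `π + arctan b - arctan (3b / √(1 - 8b²))` exceeds `π / 2`. -/
theorem strictMonoOn_thresholdGap {c : ℝ} (hc : 8 * c ^ 2 < 1) :
    StrictMonoOn thresholdGap (Icc 0 c) := by
  have hlt : ∀ x ∈ Icc 0 c, 8 * x ^ 2 < 1 := fun x hx => by nlinarith [hx.1, hx.2]
  refine strictMonoOn_of_deriv_pos (convex_Icc 0 c)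
    (fun x hx => (hasDerivAt_thresholdGap (hlt x hx)).continuousAt.continuousWithinAt)
    fun x hx => ?_
  have hx' := interior_subset hx
  rw [(hasDerivAt_thresholdGap (hlt x hx')).deriv]
  have := Real.arctan_lt_pi_div_two (3 * x / √(1 - 8 * x ^ 2))
  have := Real.arctan_nonneg.2 hx'.1
  linarith [Real.pi_pos]

theorem pi_div_four_sub_arctan {x : ℝ} (hx : 0 ≤ x) :
    Real.pi / 4 - Real.arctan x = Real.arctan ((1 - x) / (1 + x)) := by
  have h := Real.arctan_add (x := x) (y := (1 - x) / (1 + x)) (by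
    rw [← mul_div_assoc, div_lt_one (by positivity)]; nlinarith)
  have e : (x + (1 - x) / (1 + x)) / (1 - x * ((1 - x) / (1 + x))) = 1 := by
    have : 1 - x * ((1 - x) / (1 + x)) = (1 + x ^ 2) / (1 + x) := by field_simp; ring
    rw [this]
    have : 1 + x ^ 2 ≠ 0 := by positivity
    field_simp
    ring
  rw [e, Real.arctan_one] at h
  linarith

/-- A form of `thresholdGap` suited for numerical evaluation. -/
theorem thresholdGap_eq {b R : ℝ} (hb : 0 ≤ b) (hR : 0 < R) (h : R ^ 2 = 1 - 8 * b ^ 2) :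
    thresholdGap b = -Real.log 2 - Real.log (1 - (1 - R) / 4) +
      b * (3 * Real.pi / 4 + Real.arctan b + Real.arctan ((R - 3 * b) / (R + 3 * b))) := by
  have hs : √(1 - 8 * b ^ 2) = R := by rw [← h, Real.sqrt_sq hR.le]
  have e1 := pi_div_four_sub_arctan (x := 3 * b / R) (by positivity)
  have e2 : (1 - 3 * b / R) / (1 + 3 * b / R) = (R - 3 * b) / (R + 3 * b) := by
    field_simp
  have e3 : Real.log (R + 3) = 2 * Real.log 2 + Real.log (1 - (1 - R) / 4) := by
    rw [← Real.log_rpow two_pos, ← Real.log_mul (by positivity) (by nlinarith)]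
    norm_num
    ring_nf
  rw [thresholdGap, hs, e3, ← e2, ← e1]
  ring

/-- The margin is about `1e-05`; the logarithm and the arctangents are bounded by Taylor
polynomials. -/
theorem thresholdGap_lower_nonpos : thresholdGap 0.24001 ≤ 0 := by
  set R := √(1 - 8 * (0.24001 : ℝ) ^ 2) with hR
  have hR2 : R ^ 2 = 1 - 8 * (0.24001 : ℝ) ^ 2 := Real.sq_sqrt (by norm_num)
  have h1 : 0.7342762 ≤ R := Real.le_sqrt_of_sq_le (by norm_num)
  have h2 : R ≤ 0.7342763 := Real.sqrt_le_iff.2 ⟨by norm_num, by norm_num⟩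
  rw [thresholdGap_eq (by norm_num) (by linarith) hR2]
  have hlog : -Real.log (1 - (1 - R) / 4) ≤ 0.0687405 := by
    -- The bound `0.7342762 ≤ R` gives `(1 - R) / 4 ≤ 0.06643095`.
    have h3 := Real.abs_log_sub_add_sum_range_le (x := 0.06643095) (by norm_num [abs_of_pos]) 5
    norm_num [Finset.sum_range_succ, abs_of_pos] at h3
    have h4 := (abs_le.1 h3).1
    have h5 : Real.log (1 - 0.06643095) ≤ Real.log (1 - (1 - R) / 4) :=
      Real.log_le_log (by norm_num) (by linarith)
    norm_num at h5 ⊢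
    linarith
  have hy : Real.arctan ((R - 3 * 0.24001) / (R + 3 * 0.24001)) ≤ 0.009796 := by
    have h3 : (R - 3 * 0.24001) / (R + 3 * 0.24001) ≤ 0.009796 := by
      rw [div_le_iff₀ (by linarith)]; linarith
    refine (Real.arctan_mono h3).trans ((arctan_le_of_nonneg (by norm_num)).trans (by norm_num))
  have ha := arctan_le_of_nonneg (x := 0.24001) (by norm_num)
  have hπ := Real.pi_lt_d6
  have hl := Real.log_two_gt_d9
  norm_num at ha hπ hl hlog hy ⊢
  linarith

theorem thresholdGap_upper_pos : 0 < thresholdGap 0.24002 := by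
  set R := √(1 - 8 * (0.24002 : ℝ) ^ 2) with hR
  have hR2 : R ^ 2 = 1 - 8 * (0.24002 : ℝ) ^ 2 := Real.sq_sqrt (by norm_num)
  have h1 : 0.73425 ≤ R := Real.le_sqrt_of_sq_le (by norm_num)
  have h2 : R ≤ 0.7342501 := Real.sqrt_le_iff.2 ⟨by norm_num, by norm_num⟩
  rw [thresholdGap_eq (by norm_num) (by linarith) hR2]
  have hlog : 0.06874723 ≤ -Real.log (1 - (1 - R) / 4) := by
    -- The bound `R ≤ 0.7342501` gives `0.066437475 ≤ (1 - R) / 4`.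
    have h3 := Real.abs_log_sub_add_sum_range_le (x := 0.066437475) (by norm_num [abs_of_pos]) 5
    norm_num [Finset.sum_range_succ, abs_of_pos] at h3
    have h4 := (abs_le.1 h3).2
    have h5 : Real.log (1 - (1 - R) / 4) ≤ Real.log (1 - 0.066437475) :=
      Real.log_le_log (by linarith) (by linarith)
    norm_num at h5 ⊢
    linarith
  have hy : 0.009756 ≤ Real.arctan ((R - 3 * 0.24002) / (R + 3 * 0.24002)) := by
    have h3 : 0.009757 ≤ (R - 3 * 0.24002) / (R + 3 * 0.24002) := by
      rw [le_div_iff₀ (by linarith)]; linarith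
    refine le_trans ?_ (Real.arctan_mono h3)
    exact le_trans (by norm_num) (le_arctan_of_nonneg (by norm_num))
  have ha := le_arctan_of_nonneg (x := 0.24002) (by norm_num)
  have hπ := Real.pi_gt_d6
  have hl := Real.log_two_lt_d9
  norm_num at ha hπ hl hlog hy ⊢
  linarith

theorem exists_threshold :
    ∃ b₀ : ℝ, 0.24001 ≤ b₀ ∧ b₀ < 0.24002 ∧ thresholdGap b₀ = 0 := by
  have hlt : ∀ x ∈ Icc (0.24001 : ℝ) 0.24002, 8 * x ^ 2 < 1 := fun x hx => by
    have h1 := hx.1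
    have h2 := hx.2
    nlinarith
  obtain ⟨b₀, hb₀, h0⟩ := intermediate_value_Icc (by norm_num : (0.24001 : ℝ) ≤ 0.24002)
    (fun x hx => (hasDerivAt_thresholdGap (hlt x hx)).continuousAt.continuousWithinAt)
    ⟨thresholdGap_lower_nonpos, thresholdGap_upper_pos.le⟩
  refine ⟨b₀, hb₀.1, hb₀.2.lt_of_ne ?_, h0⟩
  rintro rfl
  exact thresholdGap_upper_pos.ne' h0

/-! ### Extremal functions -/

/-- The close-to-convex functions with derivative `(1 - xz) / (1 - yz) ^ 3`; the slit mappings of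
the class are among them. -/
noncomputable def slitMap (x y z : ℂ) : ℂ := z * ((1 - x * z) + (1 - y * z)) / (2 * (1 - y * z) ^ 2)

theorem norm_one_sub_one_sub_mul_lt {x z : ℂ} (hx : ‖x‖ = 1) (hz : z ∈ ball (0 : ℂ) 1) :
    ‖1 - (1 - x * z)‖ < 1 := by
  rw [sub_sub_cancel, norm_mul, hx, one_mul]
  exact mem_ball_zero_iff.1 hz

theorem hasDerivAt_slitMap {x y z : ℂ} (h : 1 - y * z ≠ 0) :
    HasDerivAt (slitMap x y) ((1 - x * z) / (1 - y * z) ^ 3) z := by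
  have hl : ∀ a : ℂ, HasDerivAt (fun z => 1 - a * z) (-a) z := fun a => by
    simpa using ((hasDerivAt_id z).const_mul a).const_sub 1
  refine (((hasDerivAt_id z).mul ((hl x).add (hl y))).div (((hl y).fun_pow 2).const_mul 2)
    (mul_ne_zero two_ne_zero (pow_ne_zero 2 h))).congr_deriv ?_
  simp only [id, Pi.add_apply, Pi.mul_apply]
  rw [div_eq_div_iff (pow_ne_zero 2 (mul_ne_zero two_ne_zero (pow_ne_zero 2 h)))
    (pow_ne_zero 3 h)]
  ring

theorem isConvexUnivalent_mul_div {y d : ℂ} (hy : ‖y‖ = 1) (hd : d ≠ 0) :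
    IsConvexUnivalent fun z => d * (z / (1 - y * z)) := by
  have hne : ∀ z ∈ ball (0 : ℂ) 1, 1 - y * z ≠ 0 := fun z hz => one_sub_ne_zero (by
    rw [norm_mul, hy, one_mul]; exact mem_ball_zero_iff.1 hz)
  refine ⟨(DifferentiableOn.fun_div (by fun_prop) (by fun_prop) hne).const_mul d, ?_, ?_⟩
  · intro z hz w hw h
    have h := mul_left_cancel₀ hd h
    rw [div_eq_div_iff (hne z hz) (hne w hw)] at h
    linear_combination h
  · -- The image is a half-plane.
    have himg : (fun z => d * (z / (1 - y * z))) '' ball 0 1 = {w | -1 / 2 < (y / d * w).re} := by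
      have hnorm : ∀ w : ℂ, ‖w‖ < ‖1 + y * w‖ ↔ -1 / 2 < (y * w).re := fun w => by
        have e : ‖w‖ = ‖y * w‖ := by rw [norm_mul, hy, one_mul]
        rw [e, ← sq_lt_sq₀ (norm_nonneg _) (norm_nonneg _), Complex.sq_norm, Complex.sq_norm,
          normSq_apply, normSq_apply, add_re, add_im, one_re, one_im]
        constructor <;> intro h <;> nlinarith
      ext w
      constructor
      · rintro ⟨z, hz, rfl⟩
        have h0 := hne z hz
        have e1 : y / d * (d * (z / (1 - y * z))) = y * (z / (1 - y * z)) := by field_simp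
        have e2 : 1 + y * (z / (1 - y * z)) = 1 / (1 - y * z) := by field_simp; ring
        rw [mem_ofPred_eq, e1, ← hnorm, e2, norm_div, norm_div, norm_one]
        exact div_lt_div_of_pos_right (mem_ball_zero_iff.1 hz) (norm_pos_iff.2 h0)
      · intro hw
        have hw' : -1 / 2 < (y * (w / d)).re := by
          rw [mem_ofPred_eq] at hw
          convert hw using 2
          ring
        have h1 := (hnorm _).2 hw'
        have h2 : 1 + y * (w / d) ≠ 0 := norm_pos_iff.1 ((norm_nonneg _).trans_lt h1)
        refine ⟨w / d / (1 + y * (w / d)), ?_, ?_⟩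
        · rw [mem_ball_zero_iff, norm_div, div_lt_one (norm_pos_iff.2 h2)]
          exact h1
        · have h3 : ∀ ω : ℂ, 1 + y * ω ≠ 0 →
              ω / (1 + y * ω) / (1 - y * (ω / (1 + y * ω))) = ω := fun ω hω => by
            rw [show 1 - y * (ω / (1 + y * ω)) = 1 / (1 + y * ω) by field_simp; ring,
              div_div_div_cancel_right₀ hω, div_one]
          simp only [h3 _ h2, mul_div_cancel₀ _ hd]
    rw [himg]
    intro p hp q hq s t hs ht hst
    rw [mem_ofPred_eq] at hp hq ⊢
    have e : y / d * (s • p + t • q) = (s : ℂ) * (y / d * p) + (t : ℂ) * (y / d * q) := by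
      simp only [real_smul]; ring
    rw [e, add_re, re_ofReal_mul, re_ofReal_mul]
    rcases hs.eq_or_lt with rfl | hs
    · have : t = 1 := by linarith
      subst this
      linarith
    · nlinarith

/-- The half-plane map `d z / (1 - yz)` serves as the convex function, with `d` chosen such that the
quotient of the derivatives, a multiple of `(1 - xz) / (1 - yz)`, has positive real part. -/
theorem slitMap_mem_closeToConvex {x y : ℂ} (hx : ‖x‖ = 1) (hy : ‖y‖ = 1) :
    slitMap x y ∈ CloseToConvex := by
  have hlt : ∀ z ∈ ball (0 : ℂ) 1, ‖y * z‖ < 1 := fun z hz => by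
    rw [norm_mul, hy, one_mul]; exact mem_ball_zero_iff.1 hz
  have hne : ∀ z ∈ ball (0 : ℂ) 1, 1 - y * z ≠ 0 := fun z hz => one_sub_ne_zero (hlt z hz)
  refine ⟨⟨fun z hz => (hasDerivAt_slitMap (hne z hz)).differentiableAt.differentiableWithinAt,
    by simp [slitMap], ?_⟩, ?_⟩
  · rw [(hasDerivAt_slitMap (x := x) (by simp : 1 - y * 0 ≠ 0)).deriv]
    simp
  have hy0 : y ≠ 0 := by rintro rfl; simp at hy
  -- With `X = x / y` the quotient `(1 - xz) / (1 - yz)` is `X + (1 - X) / (1 - yz)`.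
  obtain ⟨d, hd, hre⟩ : ∃ d : ℂ, d ≠ 0 ∧
      ∀ z ∈ ball (0 : ℂ) 1, 0 < ((1 - x * z) / (1 - y * z) / d).re := by
    rcases eq_or_ne x y with rfl | hxy
    · exact ⟨1, one_ne_zero, fun z hz => by rw [div_self (hne z hz)]; simp⟩
    · have hX : ‖x / y‖ = 1 := by rw [norm_div, hx, hy, div_one]
      have hX1 : 1 - x / y ≠ 0 := by
        rw [sub_ne_zero]; intro h; exact hxy ((div_eq_one_iff_eq hy0).1 h.symm)
      refine ⟨1 - x / y, hX1, fun z hz => ?_⟩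
      have e : (1 - x * z) / (1 - y * z) / (1 - x / y) =
          (x / y / (1 - x / y) + 1 / 2) + (1 / (1 - y * z) - 1 / 2) := by
        have h1 := hne z hz
        have h2 : (1 - x * z) / (1 - y * z) = x / y + (1 - x / y) * (1 / (1 - y * z)) := by
          rw [div_eq_iff h1, add_mul, mul_assoc, div_mul_cancel₀ _ h1]
          field_simp
          ring
        rw [h2, add_div, mul_div_cancel_left₀ _ hX1]
        ring
      have h3 : (x / y / (1 - x / y) + 1 / 2).re = 0 := by
        generalize x / y = X at hX hX1
        have h4 := Complex.sq_norm X
        rw [hX, normSq_apply] at h4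
        have h5 := normSq_pos.2 hX1
        rw [show X / (1 - X) + 1 / 2 = ((1 / 2 : ℝ) : ℂ) * ((1 + X) / (1 - X)) by
          push_cast; field_simp; ring, re_ofReal_mul, Complex.div_re, ← add_div]
        simp only [add_re, sub_re, add_im, sub_im, one_re, one_im]
        rw [show (1 + X.re) * (1 - X.re) + (0 + X.im) * (0 - X.im) = 0 by linarith]
        simp
      rw [e, add_re, h3, zero_add]
      exact re_one_div_one_sub (hlt z hz)
  refine ⟨_, isConvexUnivalent_mul_div hy hd, fun z hz => ?_⟩
  have h1 : HasDerivAt (fun z => d * (z / (1 - y * z))) (d * (1 / (1 - y * z) ^ 2)) z := by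
    have hl : HasDerivAt (fun z => 1 - y * z) (-y) z := by
      simpa using ((hasDerivAt_id z).const_mul y).const_sub 1
    refine (((hasDerivAt_id z).div hl (hne z hz)).const_mul d).congr_deriv ?_
    simp only [id]
    have := hne z hz
    field_simp
    ring
  rw [(hasDerivAt_slitMap (hne z hz)).deriv, h1.deriv]
  convert hre z hz using 2
  have := hne z hz
  field_simp

/-- The branch of `log (slitMap x y z / z)`. -/
theorem isLogRatio_slitMap {x y : ℂ} (hx : ‖x‖ = 1) (hy : ‖y‖ = 1) :
    IsLogRatio (slitMap x y) fun z =>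
      log ((1 - x * z + (1 - y * z)) / 2) - 2 * log (1 - y * z) := by
  have hu : ∀ {x : ℂ}, ‖x‖ = 1 → ∀ z ∈ ball (0 : ℂ) 1, 0 < (1 - x * z).re := fun hx z hz =>
    re_pos_of_norm_one_sub_lt (norm_one_sub_one_sub_mul_lt hx hz)
  refine ⟨?_, by norm_num, fun z hz hz0 => ?_⟩
  · refine DifferentiableOn.sub (DifferentiableOn.clog (by fun_prop) fun z hz => ?_)
      ((DifferentiableOn.clog (by fun_prop) fun z hz => ?_).const_mul 2)
    · refine mem_slitPlane_iff.2 (Or.inl ?_)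
      rw [show (1 - x * z + (1 - y * z)) / 2 = ((1 / 2 : ℝ) : ℂ) * (1 - x * z + (1 - y * z)) by
        push_cast; ring, re_ofReal_mul, add_re]
      linarith [hu hx z hz, hu hy z hz]
    · exact mem_slitPlane_iff.2 (Or.inl (hu hy z hz))
  · simp only
    rw [← extremalLog_eq (norm_one_sub_one_sub_mul_lt hx hz) (norm_one_sub_one_sub_mul_lt hy hz),
      exp_extremalLog (norm_one_sub_one_sub_mul_lt hx hz) (norm_one_sub_one_sub_mul_lt hy hz),
      slitMap]
    field_simp

theorem logArgFunctional_slitMap {x y : ℂ} (hx : ‖x‖ = 1) (hy : ‖y‖ = 1) (b : ℝ) {z : ℂ}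
    (hz : z ∈ ball (0 : ℂ) 1) :
    logArgFunctional b (slitMap x y) z =
      (log ((1 - x * z + (1 - y * z)) / 2) - 2 * log (1 - y * z)).re +
      b * (log ((1 - x * z + (1 - y * z)) / 2) - 2 * log (1 - y * z)).im := by
  have h := isLogRatio_slitMap hx hy
  rw [logArgFunctional, h.logRatio.eqOn h hz]

open Filter Topology in
/-- A lower bound for the functional persists on the boundary of the disk. -/
theorem le_boundary_slitMap {b m : ℝ}
    (h : ∀ f ∈ CloseToConvex, ∀ z ∈ ball (0 : ℂ) 1, m ≤ logArgFunctional b f z)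
    {x y : ℂ} (hx : ‖x‖ = 1) (hy : ‖y‖ = 1) (hy1 : y ≠ 1) :
    m ≤ (log ((1 - x + (1 - y)) / 2) - 2 * log (1 - y)).re +
      b * (log ((1 - x + (1 - y)) / 2) - 2 * log (1 - y)).im := by
  have hx0 : 0 ≤ (1 - x).re := by
    rw [sub_re, one_re, sub_nonneg, ← hx]; exact re_le_norm x
  have hy0 : 0 < (1 - y).re := by
    rw [sub_re, one_re, sub_pos]
    refine lt_of_le_of_ne (hy ▸ re_le_norm y) fun hre => hy1 ?_
    have := Complex.sq_norm y
    rw [hy, normSq_apply, hre] at this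
    exact Complex.ext hre (by simpa using (by nlinarith : y.im * y.im = 0))
  have hs0 : 0 < ((1 - x + (1 - y)) / 2).re := by
    rw [show (1 - x + (1 - y)) / 2 = ((1 / 2 : ℝ) : ℂ) * (1 - x + (1 - y)) by push_cast; ring,
      re_ofReal_mul, add_re]
    linarith
  have hcont : ContinuousAt (fun r : ℝ => log ((1 - x * r + (1 - y * r)) / 2) - 2 * log (1 - y * r))
      1 := by
    refine ContinuousAt.sub (ContinuousAt.clog (by fun_prop) ?_)
      (continuousAt_const.mul (ContinuousAt.clog (by fun_prop) ?_))
    · simpa using mem_slitPlane_iff.2 (Or.inl hs0)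
    · simpa using mem_slitPlane_iff.2 (Or.inl hy0)
  have hJ : ContinuousAt (fun r : ℝ =>
      (log ((1 - x * r + (1 - y * r)) / 2) - 2 * log (1 - y * r)).re +
      b * (log ((1 - x * r + (1 - y * r)) / 2) - 2 * log (1 - y * r)).im) 1 :=
    (Complex.continuous_re.continuousAt.comp hcont).add
      (continuousAt_const.mul (Complex.continuous_im.continuousAt.comp hcont))
  have hlim : Tendsto (fun r : ℝ =>
      (log ((1 - x * r + (1 - y * r)) / 2) - 2 * log (1 - y * r)).re +
      b * (log ((1 - x * r + (1 - y * r)) / 2) - 2 * log (1 - y * r)).im) (𝓝[<] 1) (𝓝 _) :=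
    hJ.tendsto.mono_left nhdsWithin_le_nhds
  simp only [ofReal_one, mul_one] at hlim
  refine ge_of_tendsto hlim ?_
  filter_upwards [Ioo_mem_nhdsLT (zero_lt_one (α := ℝ))] with r hr
  have hrz : (r : ℂ) ∈ ball (0 : ℂ) 1 := by
    rw [mem_ball_zero_iff, Complex.norm_real, Real.norm_of_nonneg hr.1.le]; exact hr.2
  rw [← logArgFunctional_slitMap hx hy b hrz]
  exact h _ (slitMap_mem_closeToConvex hx hy) _ hrz

/-! ### Sharpness -/

/-- The value at the interior critical point is attained on the boundary: the two parameters are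
chosen such that `exp L = (u + v) / (2 v ^ 2)` has the optimal argument and satisfies
`1 / exp L = 1 - 3 y`. -/
theorem le_interiorMin {b m : ℝ} (hb : 8 * b ^ 2 < 1)
    (h : ∀ f ∈ CloseToConvex, ∀ z ∈ ball (0 : ℂ) 1, m ≤ logArgFunctional b f z) :
    m ≤ interiorMin b := by
  have hR : 0 < √(1 - 8 * b ^ 2) := Real.sqrt_pos.2 (by linarith)
  have hR2 := Real.sq_sqrt (show 0 ≤ 1 - 8 * b ^ 2 by linarith)
  have hmin := interiorMin_eq hb.le
  set R := √(1 - 8 * b ^ 2)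
  have hb2 : 0 < 1 + b ^ 2 := by positivity
  -- The inverse of the optimal value of `exp L`.
  set W : ℂ := (((R + 3) / (1 + b ^ 2) : ℝ) : ℂ) * ⟨R, 3 * b⟩ with hW
  have hWre : W.re = (R + 3) / (1 + b ^ 2) * R := by rw [hW, re_ofReal_mul]
  have hWim : W.im = (R + 3) / (1 + b ^ 2) * (3 * b) := by rw [hW, im_ofReal_mul]
  have hWpos : 0 < W.re := by rw [hWre]; positivity
  have hW0 : W ≠ 0 := by intro h; rw [h] at hWpos; simp at hWpos
  set y : ℂ := (1 - W) / 3 with hy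
  have hyW : W = 1 - 3 * y := by rw [hy]; ring
  have hynorm : ‖y‖ = 1 := by
    rw [hy, norm_div, Complex.norm_ofNat, div_eq_one_iff_eq (by norm_num)]
    rw [← sq_eq_sq₀ (norm_nonneg _) (by norm_num), Complex.sq_norm, normSq_apply, sub_re, sub_im,
      one_re, one_im, hWre, hWim]
    field_simp
    have hR3 : R ^ 3 = R * (1 - 8 * b ^ 2) := by rw [pow_succ, hR2]; ring
    have hR4 : R ^ 4 = (1 - 8 * b ^ 2) ^ 2 := by rw [← hR2]; ring
    ring_nf
    rw [hR4, hR3, hR2]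
    ring
  have hy1 : y ≠ 1 := by
    rintro h1
    rw [h1] at hyW
    rw [hyW] at hWpos
    norm_num at hWpos
  have hy0 : y ≠ 0 := by intro h0; rw [h0] at hynorm; simp at hynorm
  have hyc : y * starRingEnd ℂ y = 1 := by rw [mul_conj, normSq_eq_norm_sq, hynorm]; simp
  have h3y : 3 * y - 1 ≠ 0 := by
    intro h0; apply hW0; rw [hyW]; linear_combination -h0
  set x : ℂ := y * (3 - y) / (3 * y - 1) with hx
  have hxnorm : ‖x‖ = 1 := by
    have e : 3 * y - 1 = y * starRingEnd ℂ (3 - y) := by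
      rw [map_sub, show starRingEnd ℂ 3 = 3 from conj_ofNat 3]
      linear_combination hyc
    have h0 : 3 - y ≠ 0 := by
      intro h0
      rw [← sub_eq_zero.1 h0] at hynorm
      norm_num at hynorm
    rw [hx, e, norm_div, norm_mul, norm_mul, RCLike.norm_conj, hynorm, one_mul,
      div_self (norm_ne_zero_iff.2 h0)]
  have key := le_boundary_slitMap h hxnorm hynorm hy1
  set L := log ((1 - x + (1 - y)) / 2) - 2 * log (1 - y) with hL
  have hs : (1 - x + (1 - y)) / 2 = (1 - y) ^ 2 / W := by
    have hxm : x * (3 * y - 1) = y * (3 - y) := div_mul_cancel₀ _ h3y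
    rw [div_eq_div_iff two_ne_zero hW0, hyW]
    linear_combination hxm
  have h1y : 1 - y ≠ 0 := sub_ne_zero.2 hy1.symm
  have hs0 : (1 - x + (1 - y)) / 2 ≠ 0 := by
    rw [hs]; exact div_ne_zero (pow_ne_zero 2 h1y) hW0
  have hexp : exp L = exp (-log W) := by
    rw [hL, exp_sub, exp_neg, exp_log hs0, exp_log hW0, two_mul, exp_add, exp_log h1y, hs]
    field_simp
  have hLW : L = -log W := by
    have a1 : |arg ((1 - x + (1 - y)) / 2)| ≤ Real.pi / 2 := abs_arg_le_pi_div_two_iff.2 (by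
      rw [show (1 - x + (1 - y)) / 2 = ((1 / 2 : ℝ) : ℂ) * (1 - x + (1 - y)) by push_cast; ring,
        re_ofReal_mul]
      have h1 := re_le_norm x
      have h2 := re_le_norm y
      simp only [add_re, sub_re, one_re]
      linarith)
    have a2 : |arg (1 - y)| ≤ Real.pi / 2 := abs_arg_le_pi_div_two_iff.2 (by
      have h2 := re_le_norm y
      simp only [sub_re, one_re]
      linarith)
    have a3 := abs_lt.1 (abs_arg_lt_pi_div_two_iff.2 (Or.inl hWpos))
    obtain ⟨n, hn⟩ := Complex.exp_eq_exp_iff_exists_int.1 hexp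
    have him := congrArg im hn
    rw [hL, sub_im, log_im, show (2 : ℂ) * log (1 - y) = ((2 : ℝ) : ℂ) * log (1 - y) by simp,
      im_ofReal_mul, log_im, add_im, neg_im, log_im,
      show ((n : ℂ) * (2 * Real.pi * I)).im = n * (2 * Real.pi) by simp] at him
    have a4 := abs_le.1 a1
    have a5 := abs_le.1 a2
    have hπ := Real.pi_pos
    have n1 : (-1 : ℝ) < n := by nlinarith
    have n2 : (n : ℝ) < 1 := by nlinarith
    have hn0 : n = 0 := by
      have : -1 < n := by exact_mod_cast n1
      have : n < 1 := by exact_mod_cast n2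
      omega
    rw [hn, hn0]
    simp
  rw [hLW, neg_re, neg_im, log_re, log_im] at key
  have harg : arg W = Real.arctan (3 * b / R) := by
    have a3 := abs_lt.1 (abs_arg_lt_pi_div_two_iff.2 (Or.inl hWpos))
    rw [← Real.arctan_tan a3.1 a3.2, tan_arg, hWre, hWim, mul_div_mul_left _ _ (by positivity)]
  have hnorm : Real.log ‖W‖ = Real.log (R + 3) - 1 / 2 * Real.log (1 + b ^ 2) := by
    have e : ‖W‖ ^ 2 = (R + 3) ^ 2 / (1 + b ^ 2) := by
      rw [Complex.sq_norm, normSq_apply, hWre, hWim]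
      field_simp
      nlinarith
    have := congrArg Real.log e
    rw [Real.log_div (by positivity) hb2.ne', Real.log_pow, Real.log_pow] at this
    push_cast at this
    linarith
  rw [harg, hnorm] at key
  rw [hmin]
  linarith

open Filter Topology in
theorem tendsto_exp_sub_one_div (c : ℂ) :
    Tendsto (fun t : ℝ => (exp (c * t) - 1) / t) (𝓝[>] 0) (𝓝 c) := by
  have h1 : HasDerivAt (fun t : ℝ => exp (c * t)) c 0 := by
    have : HasDerivAt (fun t : ℂ => exp (c * t)) (exp (c * ((0 : ℝ) : ℂ)) * (c * 1))
        ((0 : ℝ) : ℂ) :=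
      ((hasDerivAt_id _).const_mul c).cexp
    simpa using this.comp_ofReal
  have h2 := (hasDerivAt_iff_tendsto_slope_zero.1 h1).mono_left
    (nhdsWithin_mono 0 fun t (ht : 0 < t) => ht.ne')
  refine h2.congr fun t => ?_
  simp [div_eq_inv_mul]

open Filter Topology in
/-- Approach to the value `boundaryMin b`: the two parameters are `exp (i (φ + b φ ^ 2))` and
`exp (-iφ)` with `φ` tending to zero. -/
theorem le_boundaryMin_of_boundary {b m : ℝ}
    (h : ∀ x y : ℂ, ‖x‖ = 1 → ‖y‖ = 1 → y ≠ 1 →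
      m ≤ (log ((1 - x + (1 - y)) / 2) - 2 * log (1 - y)).re +
        b * (log ((1 - x + (1 - y)) / 2) - 2 * log (1 - y)).im) :
    m ≤ boundaryMin b := by
  set x : ℝ → ℂ := fun φ => exp (((φ + b * φ ^ 2 : ℝ) : ℂ) * I) with hx
  set y : ℝ → ℂ := fun φ => exp (((-φ : ℝ) : ℂ) * I) with hy
  have hv : Tendsto (fun φ : ℝ => (1 - y φ) / φ) (𝓝[>] 0) (𝓝 I) := by
    have := (tendsto_exp_sub_one_div (-I)).neg
    rw [neg_neg] at this
    refine this.congr fun φ => ?_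
    have e : y φ = exp (-I * φ) := congrArg exp (by push_cast; ring)
    rw [e, ← neg_div, neg_sub]
  have hs : Tendsto (fun φ : ℝ => (1 - x φ + (1 - y φ)) / 2 / ((φ ^ 2 : ℝ) : ℂ)) (𝓝[>] 0)
      (𝓝 ((1 - b * I) / 2)) := by
    have h1 := tendsto_exp_sub_one_div I
    have h2 := tendsto_exp_sub_one_div (-I)
    have hsq : Tendsto (fun φ : ℝ => φ ^ 2) (𝓝[>] 0) (𝓝[>] 0) := by
      refine tendsto_nhdsWithin_iff.2 ⟨?_, ?_⟩
      · have : Continuous fun φ : ℝ => φ ^ 2 := by fun_prop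
        simpa using (this.tendsto 0).mono_left nhdsWithin_le_nhds
      · filter_upwards [self_mem_nhdsWithin] with φ hφ
        exact mem_Ioi.2 (pow_pos (mem_Ioi.1 hφ) 2)
    have h3 := (tendsto_exp_sub_one_div (b * I)).comp hsq
    have h4 : Tendsto (fun φ : ℝ => exp (I * φ)) (𝓝[>] 0) (𝓝 1) := by
      have : Continuous fun φ : ℝ => exp (I * φ) := by fun_prop
      simpa using (this.tendsto 0).mono_left nhdsWithin_le_nhds
    have h5 := ((h1.mul h2).sub (h4.mul h3)).div_const 2
    rw [show (I * -I - 1 * (b * I)) / 2 = (1 - b * I) / 2 by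
      rw [mul_neg, I_mul_I]; ring] at h5
    refine h5.congr' ?_
    filter_upwards [self_mem_nhdsWithin] with φ hφ
    have hφ0 : (φ : ℂ) ≠ 0 := by exact_mod_cast (ne_of_gt hφ)
    have e1 : x φ = exp (I * φ) * exp (b * I * ((φ ^ 2 : ℝ) : ℂ)) := by
      rw [← exp_add]; exact congrArg exp (by push_cast; ring)
    have e2 : y φ = exp (-(I * φ)) := congrArg exp (by push_cast; ring)
    have e3 : exp (I * φ) * exp (-(I * φ)) = 1 := by rw [← exp_add]; simp
    rw [e1, e2]
    simp only [Function.comp, neg_mul]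
    push_cast
    field_simp
    linear_combination e3
  have hlim : Tendsto (fun φ : ℝ => log ((1 - x φ + (1 - y φ)) / 2) - 2 * log (1 - y φ)) (𝓝[>] 0)
      (𝓝 (log ((1 - b * I) / 2) - 2 * log I)) := by
    have hslit : (1 - b * I) / 2 ∈ slitPlane := mem_slitPlane_iff.2 (Or.inl (by
      rw [show (1 - b * I) / 2 = ((1 / 2 : ℝ) : ℂ) * (1 - b * I) by push_cast; ring, re_ofReal_mul]
      simp))
    have hI : I ∈ slitPlane := mem_slitPlane_iff.2 (Or.inr (by simp))
    refine ((hs.clog hslit).sub ((hv.clog hI).const_mul 2)).congr' ?_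
    filter_upwards [self_mem_nhdsWithin, hs.eventually_ne (slitPlane_ne_zero hslit),
      hv.eventually_ne I_ne_zero] with φ hφ n1 n2
    have hφ0 : (φ : ℂ) ≠ 0 := by exact_mod_cast (ne_of_gt hφ)
    have hφ' : (0 : ℝ) < φ := hφ
    have e1 := log_ofReal_mul (pow_pos hφ' 2) n1
    have e2 := log_ofReal_mul hφ' n2
    rw [mul_div_cancel₀ _ (by exact_mod_cast pow_ne_zero 2 hφ0)] at e1
    rw [mul_div_cancel₀ _ hφ0] at e2
    rw [e1, e2, Real.log_pow]
    push_cast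
    ring
  have hJ := ((Complex.continuous_re.tendsto _).comp hlim).add
    (((Complex.continuous_im.tendsto _).comp hlim).const_mul b)
  have hval : (log ((1 - b * I) / 2) - 2 * log I).re + b * (log ((1 - b * I) / 2) - 2 * log I).im =
      boundaryMin b := by
    have hz : 1 - b * I ≠ 0 := by
      intro h0; have := congrArg re h0; simp at this
    have e0 : log ((1 - b * I) / 2) = ((Real.log (1 / 2) : ℝ) : ℂ) + log (1 - b * I) := by
      rw [← log_ofReal_mul (by norm_num) hz]
      congr 1; push_cast; ring
    have e1 : arg (1 - b * I) = -Real.arctan b := by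
      have hre : 0 < (1 - b * I).re := by simp
      have a3 := abs_lt.1 (abs_arg_lt_pi_div_two_iff.2 (Or.inl hre))
      rw [← Real.arctan_tan a3.1 a3.2, tan_arg, ← Real.arctan_neg]
      simp
    have e2 : Real.log ‖1 - b * I‖ = 1 / 2 * Real.log (1 + b ^ 2) := by
      have : ‖1 - b * I‖ ^ 2 = 1 + b ^ 2 := by
        rw [Complex.sq_norm, normSq_apply]; simp; ring
      rw [← this, Real.log_pow]
      push_cast; ring
    have e3 : Real.log (1 / 2) = -Real.log 2 := by rw [one_div, Real.log_inv]
    rw [e0, log_I, sub_re, sub_im, add_re, add_im, ofReal_re, ofReal_im, log_re, log_im, e1, e2, e3,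
      show (2 * (Real.pi / 2 * I) : ℂ) = (Real.pi : ℂ) * I by ring, re_ofReal_mul, im_ofReal_mul,
      boundaryMin]
    simp
    ring
  rw [hval] at hJ
  refine ge_of_tendsto hJ ?_
  filter_upwards [Ioo_mem_nhdsGT (zero_lt_one (α := ℝ))] with φ hφ
  refine h (x φ) (y φ) (norm_exp_ofReal_mul_I _) (norm_exp_ofReal_mul_I _) fun h1 => ?_
  have him := congrArg im h1
  rw [hy, exp_ofReal_mul_I_im, Real.sin_neg, one_im, neg_eq_zero] at him
  exact (Real.sin_pos_of_pos_of_lt_pi hφ.1 (by linarith [hφ.2, Real.pi_gt_three])).ne' him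

/-- The case of negative `b` follows by complex conjugation. -/
theorem le_boundaryMin {b m : ℝ}
    (h : ∀ f ∈ CloseToConvex, ∀ z ∈ ball (0 : ℂ) 1, m ≤ logArgFunctional b f z) :
    m ≤ boundaryMin |b| := by
  have key := fun x y hx hy hy1 => le_boundary_slitMap h (x := x) (y := y) hx hy hy1
  rcases abs_cases b with ⟨hb, -⟩ | ⟨hb, -⟩
  · rw [hb]; exact le_boundaryMin_of_boundary key
  · rw [hb]
    refine le_boundaryMin_of_boundary fun x y hx hy hy1 => ?_
    have hconj := key (starRingEnd ℂ x) (starRingEnd ℂ y) (by rwa [RCLike.norm_conj])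
      (by rwa [RCLike.norm_conj]) (fun h1 => hy1 (by simpa using congrArg (starRingEnd ℂ) h1))
    have harg : ∀ {w : ℂ}, 0 < w.re → w.arg ≠ Real.pi := fun {w} hw => by
      have := abs_lt.1 (abs_arg_lt_pi_div_two_iff.2 (Or.inl hw))
      linarith [Real.pi_pos]
    have hy0 : 0 < (1 - y).re := by
      rw [sub_re, one_re, sub_pos]
      refine lt_of_le_of_ne (hy ▸ re_le_norm y) fun hre => hy1 ?_
      have := Complex.sq_norm y
      rw [hy, normSq_apply, hre] at this
      exact Complex.ext hre (by simpa using (by nlinarith : y.im * y.im = 0))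
    have hs0 : 0 < ((1 - x + (1 - y)) / 2).re := by
      rw [show (1 - x + (1 - y)) / 2 = ((1 / 2 : ℝ) : ℂ) * (1 - x + (1 - y)) by push_cast; ring,
        re_ofReal_mul, add_re, sub_re 1 x]
      have := re_le_norm x
      simp only [one_re]
      linarith
    have e1 : log ((1 - starRingEnd ℂ x + (1 - starRingEnd ℂ y)) / 2) =
        starRingEnd ℂ (log ((1 - x + (1 - y)) / 2)) := by
      rw [← log_conj _ (harg hs0)]
      simp only [map_div₀, map_add, map_sub, map_one, show starRingEnd ℂ 2 = 2 from conj_ofNat 2]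
    have e2 : log (1 - starRingEnd ℂ y) = starRingEnd ℂ (log (1 - y)) := by
      rw [← log_conj _ (harg hy0)]
      simp only [map_sub, map_one]
    have e3 : starRingEnd ℂ (log ((1 - x + (1 - y)) / 2)) - 2 * starRingEnd ℂ (log (1 - y)) =
        starRingEnd ℂ (log ((1 - x + (1 - y)) / 2) - 2 * log (1 - y)) := by
      rw [map_sub, map_mul, show starRingEnd ℂ 2 = 2 from conj_ofNat 2]
    rw [e1, e2, e3, conj_re, conj_im] at hconj
    linarith

/-! ### The two extremal problems -/

theorem le_logArgFunctional {b m : ℝ}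
    (hm : ∀ u v : ℂ, ‖1 - u‖ < 1 → ‖1 - v‖ < 1 →
      m ≤ (extremalLog u v).re + b * (extremalLog u v).im)
    {f : ℂ → ℂ} (hf : f ∈ CloseToConvex) {z : ℂ} (hz : z ∈ ball (0 : ℂ) 1) :
    m ≤ logArgFunctional b f z := by
  -- The functional is the real part of `(1 - ib) L`.
  have hre : ∀ w : ℂ, ((1 - b * I) * w).re = w.re + b * w.im := fun w => by simp
  have hc : 1 - b * I ≠ 0 := by
    intro h0; have := congrArg re h0; simp at this
  rw [logArgFunctional, ← hre]
  refine (isLogRatio_and_le_of_extremal hf).2 hc (fun X ζ hX hζ => ?_) z hz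
  rw [hre]
  refine hm _ _ ?_ ?_
  · rwa [sub_sub_cancel, norm_mul, hX, one_mul]
  · rwa [sub_sub_cancel]

/-- The sharpness hypothesis avoids extremal functions, since the infimum need not be attained. -/
theorem phiMinus_eq {b M : ℝ} (hle : ∀ u v : ℂ, ‖1 - u‖ < 1 → ‖1 - v‖ < 1 →
      M ≤ (extremalLog u v).re + b * (extremalLog u v).im)
    (hsharp : ∀ m : ℝ, (∀ f ∈ CloseToConvex, ∀ z ∈ ball (0 : ℂ) 1, m ≤ logArgFunctional b f z) →
      m ≤ M) : PhiMinus b CloseToConvex = (M : EReal) := by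
  refine le_antisymm ?_ ?_
  · by_contra hcon
    push Not at hcon
    obtain ⟨m, hm1, hm2⟩ := EReal.lt_iff_exists_real_btwn.1 hcon
    refine (EReal.coe_lt_coe_iff.1 hm1).not_ge (hsharp m fun f hf z hz => ?_)
    rw [← EReal.coe_le_coe_iff]
    exact hm2.le.trans ((iInf₂_le z hz).trans (iInf₂_le f hf))
  · exact le_iInf₂ fun z hz => le_iInf₂ fun f hf =>
      EReal.coe_le_coe_iff.2 (le_logArgFunctional hle hf hz)

theorem phiPlus_eq_top (b : ℝ) : PhiPlus b CloseToConvex = ⊤ := by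
  refine EReal.eq_top_iff_forall_lt _ |>.2 fun M => ?_
  -- On the positive radius the half-plane map `z / (1 - z)` has `log (f z / z) = -log (1 - z)`.
  set r : ℝ := 1 - Real.exp (-(|M| + 1)) with hr
  have hexp : Real.exp (-(|M| + 1)) < 1 :=
    (Real.exp_lt_exp.2 (by linarith [abs_nonneg M])).trans_eq Real.exp_zero
  have hrpos : 0 < 1 - r := by rw [hr, sub_sub_cancel]; exact Real.exp_pos _
  have hrz : (r : ℂ) ∈ ball (0 : ℂ) 1 := by
    rw [mem_ball_zero_iff, Complex.norm_real, Real.norm_of_nonneg (by linarith)]; linarith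
  have hval : logArgFunctional b (slitMap 1 1) r = |M| + 1 := by
    have e : log ((1 - (r : ℂ) + (1 - r)) / 2) - 2 * log (1 - r) = ((|M| + 1 : ℝ) : ℂ) := by
      rw [add_self_div_two, show (1 : ℂ) - r = ((Real.exp (-(|M| + 1)) : ℝ) : ℂ) by
        rw [hr]; push_cast; ring, ← ofReal_log (Real.exp_pos _).le, Real.log_exp]
      push_cast
      ring
    rw [logArgFunctional_slitMap norm_one norm_one b hrz, one_mul, e, ofReal_re, ofReal_im,
      mul_zero, add_zero]
  have h1 : ((|M| + 1 : ℝ) : EReal) ≤ PhiPlus b CloseToConvex := by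
    rw [← hval]
    exact (le_iSup₂ (f := fun f (_ : f ∈ CloseToConvex) => (logArgFunctional b f r : EReal))
      (slitMap 1 1) (slitMap_mem_closeToConvex norm_one norm_one)).trans
      (le_iSup₂ (f := fun z (_ : z ∈ ball (0 : ℂ) 1) => PhiPlusAt b CloseToConvex z) (r : ℂ) hrz)
  exact lt_of_lt_of_le (EReal.coe_lt_coe_iff.2 (by linarith [le_abs_self M])) h1

theorem interiorMin_abs (b : ℝ) : interiorMin |b| = interiorMin b := by
  rcases abs_cases b with ⟨hb, -⟩ | ⟨hb, -⟩
  · rw [hb]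
  · rw [hb, interiorMin, interiorMin, neg_sq, mul_neg, neg_div, Real.arctan_neg]
    ring

theorem theorem4p2 :
    (∀ f ∈ CloseToConvex, IsLogRatio f (logRatio f)) ∧
    (∀ b : ℝ, PhiPlus b CloseToConvex = ⊤) ∧
    ∃ b₀ : ℝ,
      (0 < b₀ ∧ b₀ < 1 / (2 * √2) ∧ ThresholdEq b₀ ∧
        ∀ b : ℝ, 0 < b → b < 1 / (2 * √2) → ThresholdEq b → b = b₀) ∧
      (0.24001 ≤ b₀ ∧ b₀ < 0.24002) ∧
      ∀ b : ℝ,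
        (|b| ≤ b₀ → PhiMinus b CloseToConvex =
          ((-(1 / 2) * Real.log (2 * (5 - 4 * b ^ 2 + 3 * √(1 - 8 * b ^ 2)) / (1 + b ^ 2))
            - b * Real.arctan (3 * b / √(1 - 8 * b ^ 2)) : ℝ) : EReal)) ∧
        (b₀ ≤ |b| → PhiMinus b CloseToConvex =
          ((1 / 2 * Real.log (1 + b ^ 2) - Real.log 2
            - |b| * (Real.arctan |b| + Real.pi) : ℝ) : EReal)) := by
  obtain ⟨b₀, hlo, hhi, hgap⟩ := exists_threshold
  have hb₀ : 0 < b₀ := lt_of_lt_of_le (by norm_num) hlo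
  have h8 : 8 * b₀ ^ 2 < 1 := by nlinarith
  have hlt_iff : ∀ b : ℝ, 0 ≤ b → (b < 1 / (2 * √2) ↔ 8 * b ^ 2 < 1) := fun b hb => by
    have h2 := Real.sq_sqrt (zero_le_two (α := ℝ))
    have h20 := Real.sqrt_pos.2 (zero_lt_two (α := ℝ))
    rw [lt_div_iff₀ (by positivity), ← sq_lt_sq₀ (by positivity) zero_le_one, mul_pow, mul_pow, h2]
    constructor <;> intro h <;> linarith
  have hgap_mono : ∀ b c : ℝ, 0 ≤ b → b ≤ c → 8 * c ^ 2 < 1 → thresholdGap b ≤ thresholdGap c :=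
    fun b c hb hbc hc => (strictMonoOn_thresholdGap hc).monotoneOn ⟨hb, hbc⟩ ⟨hb.trans hbc, le_rfl⟩
      hbc
  refine ⟨fun f hf => (isLogRatio_and_le_of_extremal hf).1, phiPlus_eq_top, b₀,
    ⟨hb₀, (hlt_iff b₀ hb₀.le).2 h8, (thresholdEq_iff h8.le).2 hgap, fun b hb hlt hE => ?_⟩,
    ⟨hlo, hhi⟩, fun b => ⟨fun hb => ?_, fun hb => ?_⟩⟩
  · have hb8 := (hlt_iff b hb.le).1 hlt
    have h0 := (thresholdEq_iff hb8.le).1 hE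
    rcases le_total b b₀ with h | h
    · exact (strictMonoOn_thresholdGap h8).injOn ⟨hb.le, h⟩ ⟨hb₀.le, le_rfl⟩ (h0.trans hgap.symm)
    · exact (strictMonoOn_thresholdGap hb8).injOn ⟨hb.le, le_rfl⟩ ⟨hb₀.le, h⟩ (h0.trans hgap.symm)
  · have hb8 : 8 * b ^ 2 < 1 := by rw [← sq_abs]; nlinarith [abs_nonneg b]
    have hb8' : 8 * |b| ^ 2 < 1 := by rwa [sq_abs]
    have hle : interiorMin |b| ≤ boundaryMin |b| := by
      have := hgap_mono _ _ (abs_nonneg b) hb h8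
      rw [hgap, thresholdGap_eq_sub hb8'.le] at this
      linarith
    change _ = ((interiorMin b : ℝ) : EReal)
    refine phiMinus_eq (fun u v hu hv => ?_) fun m hm => le_interiorMin hb8 hm
    have := (min_le_extremalLog b hu hv).1 hb8
    rwa [min_eq_left hle, interiorMin_abs] at this
  · have hval : 1 / 2 * Real.log (1 + b ^ 2) - Real.log 2 - |b| * (Real.arctan |b| + Real.pi) =
        boundaryMin |b| := by rw [boundaryMin, sq_abs]
    rw [hval]
    refine phiMinus_eq (fun u v hu hv => ?_) fun m hm => le_boundaryMin hm
    rcases lt_or_ge (8 * b ^ 2) 1 with hb8 | hb8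
    · have hb8' : 8 * |b| ^ 2 < 1 := by rwa [sq_abs]
      have hle : boundaryMin |b| ≤ interiorMin |b| := by
        have := hgap_mono _ _ hb₀.le hb hb8'
        rw [hgap, thresholdGap_eq_sub hb8'.le] at this
        linarith
      have := (min_le_extremalLog b hu hv).1 hb8
      rwa [min_eq_right hle] at this
    · exact (min_le_extremalLog b hu hv).2 hb8
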